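/- **Theorem.** Fix $D,R,\Lambda\in\mathbb N$, $K,\mathfrak d,p\ge 1$ and $T\in\mathbb R$. Consider $n\ge 2$ qubits at distinct points of $\mathbb Z^D$ and $K$ geometrically local Hamiltonians $H^{(k)}=\sum_X\lambda^{(k)}_Xh^{(k)}_X$ with $\lambda^{(k)}_X\in\mathbb R$, $|\lambda_X^{(k)}|\le1$, $h_X^{(k)}$ Hermitian, $\|h_X^{(k)}\|\le1$, where every $h^{(k)}_X$ acts on at most $\Lambda$ qubits of mutual ($\ell_\infty$) distance at most $R$ and every term of $H^{(k)}$ overlaps at most $\mathfrak d$ other terms of $H^{(k)}$. Let $\vec t=(t_1,\dots,t_K)\in\mathbb R^K$, $t=\max_k|t_k|\le T$, $U=e^{-iH^{(1)}t_1}\cdots e^{-iH^{(K)}t_K}$, $\mathcal U(\rho)=U\rho U^\dagger$, let $0<\varepsilon<1$, and put $t^*=1/(2eK\mathfrak d)$ and $$M(t)=\begin{cases}\dfrac{\log(n/\varepsilon)}{\log(t^*/t)},& t<t^*,\\[2mm] e^{\pi teK\mathfrak d}\,\log\!\big(e^{\pi teK\mathfrak d}\,n/\varepsilon\big),& t\ge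 t^*\end{cases}$$ (read as $M(0)=0$). For a natural number $m$, a *learned model of order $m$* is a family of operators $V_{O_i}=\sum_Q\alpha_{Q}Q$ ($1\le i\le n$, $O\in\{X,Y,Z\}$), with real coefficients $\alpha_Q=\alpha_{O_i,Q}$ and $Q$ ranging over the Pauli strings whose support lies in the union of $\{i\}$ and the supports of the members of a finite set of terms of the Hamiltonians that is connected to qubit $i$ through overlaps and has at most $m$ members from each $H^{(k)}$, such that $\|V_{O_i}-U^\dagger O_iU\|\le\varepsilon/n$ for all $i$ and $O$. With $V_{I_i}=I$, put $V_i=\frac12\sum_{O\in\{I,X,Y,Z\}}V_{O_i}\otimes O_{i+n}$, an operator on $2n$ qubits; let $S$ be the swap of the two $n$-qubit registers, and for an operator $W$ on $2n$ qubits let $\mathcal V_W(\rho)=\mathrm{Tr}_{>n}[W(\rho\otimes I/2^n)W^\dagger]$. There are constants $c_1,c_2,C>0$ depending only on $D,R,K,\Lambda,\mathfrak d,p,T$, and for every $\tau>0$ a constant $c_3>0$ depending only on these and on $\tau$, such that for all data as above the following holds with $m=\lceil c_1M(t)\rceil$. 1. A learned model of order $m$ exists. 2. For every learned model of order $m$,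 the operator $V'=S\prod_{i=1}^n e^{-\frac{i\pi}2(V_i-I)}$ is unitary and $\|\mathcal V_{V'}-\mathcal U\|_\diamond\le C\varepsilon$. 3. For every learned model of order $m$ there are $r\ge1$ and a circuit of one- and two-qubit gates on the $2n$ qubits that implements exactly the unitary $W$ obtained from $V'$ by replacing each factor $e^{-\frac{i\pi}2(V_i-I)}$ by $r$ steps of the $p$-th order Trotter–Suzuki formula for the Pauli terms of $V_i-I$ (the first-order formula if $p=1$, the symmetric formula of order $2\lceil p/2\rceil$ otherwise). It satisfies $\|\mathcal V_W-\mathcal U\|_\diamond\le C\varepsilon$, and if $t\ge\tau$ its depth is at most $$C\,\frac{\log^D(n)\,\big[4^{K\Lambda}e\mathfrak d\big]^{c_3M(t)}}{\varepsilon^{1/p}} .$$ Without the assumption $t\ge\tau$, its depth is at most the same expression with $c_3M(t)$ replaced by $c_2\max\{M(t),\log(n/\varepsilon)\}$. -/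

import Mathlib

open scoped Matrix.Norms.L2Operator ComplexOrder

/-! ### Operators on registers of qubits -/

/-- Operators on a register of qubits labelled by `ι`, as matrices in the computational basis.
The norm `‖·‖` on them is the operator norm induced by the Euclidean norm. -/
abbrev QOp (ι : Type) := Matrix (ι → Fin 2) (ι → Fin 2) ℂ

/-- `A ⊗ B` on the union of two registers. -/
def opTensor {α β : Type} (A : QOp α) (B : QOp β) : QOp (α ⊕ β) :=
  Matrix.of fun x y => A (x ∘ Sum.inl) (y ∘ Sum.inl) * B (x ∘ Sum.inr) (y ∘ Sum.inr)

/-- `B ⊗ I`, where `B` acts on the qubits in `X` and `I` on all other qubits. -/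
def embedOp {ι : Type} [Fintype ι] [DecidableEq ι] (X : Finset ι) (B : QOp X) : QOp ι :=
  Matrix.of fun x y =>
    if ∀ q, q ∉ X → x q = y q then B (fun q => x q) (fun q => y q) else 0

/-- `A` acts as the identity outside of the set `X` of qubits. -/
def ActsOn {ι : Type} [Fintype ι] [DecidableEq ι] (X : Finset ι) (A : QOp ι) : Prop :=
  ∃ B : QOp X, A = embedOp X B

/-- The single-qubit Pauli matrices `I, X, Y, Z`, numbered `0, 1, 2, 3`. -/
def pauliMatrix : Fin 4 → Matrix (Fin 2) (Fin 2) ℂ :=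
  ![1, !![0, 1; 1, 0], !![0, -Complex.I; Complex.I, 0], !![1, 0; 0, -1]]

/-- The tensor product over all qubits `q` of the Pauli matrices numbered `P q`. -/
def pauliString {ι : Type} [Fintype ι] (P : ι → Fin 4) : QOp ι :=
  Matrix.of fun x y => ∏ q, pauliMatrix (P q) (x q) (y q)

/-- The qubits on which a Pauli string is not the identity. -/
def pauliSupport {ι : Type} [Fintype ι] (P : ι → Fin 4) : Finset ι :=
  Finset.univ.filter fun q => P q ≠ 0

/-- The Pauli matrix number `a` on qubit `i`, tensored with the identity elsewhere. -/
def pauliAt {ι : Type} [Fintype ι] [DecidableEq ι] (i : ι) (a : Fin 4) : QOp ι :=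
  pauliString (Pi.single i a)

/-! ### Channels and the diamond distance -/

/-- The partial trace over the second register. -/
def partialTrace {α β : Type} [Fintype β] [DecidableEq β] : QOp (α ⊕ β) →ₗ[ℂ] QOp α where
  toFun A := Matrix.of fun x y => ∑ z : β → Fin 2, A (Sum.elim x z) (Sum.elim y z)
  map_add' A B := by
    ext x y
    simp [Finset.sum_add_distrib]
  map_smul' c A := by
    ext x y
    simp [Finset.mul_sum]

/-- The map `ρ ↦ U ρ U†`. -/
noncomputable def conjChannel {ι : Type} [Fintype ι] [DecidableEq ι] (U : QOp ι) :
    QOp ι →ₗ[ℂ] QOp ι :=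
  LinearMap.mulLeft ℂ U ∘ₗ LinearMap.mulRight ℂ U.conjTranspose

/-- The map `ρ ↦ ρ ⊗ I / 2 ^ |β|`, which adds a maximally mixed second register. -/
noncomputable def addMixed (α β : Type) [Fintype β] [DecidableEq β] :
    QOp α →ₗ[ℂ] QOp (α ⊕ β) where
  toFun ρ := opTensor ρ (((2 : ℂ) ^ Fintype.card β)⁻¹ • (1 : QOp β))
  map_add' A B := by
    ext x y
    simp [opTensor, add_mul]
  map_smul' c A := by
    ext x y
    simp [opTensor, mul_assoc]

/-- The channel `ρ ↦ Tr_{>n} [W (ρ ⊗ I / 2 ^ n) W†]` on `n` qubits that an operator `W` on `2 n`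
qubits gives rise to. -/
noncomputable def reducedChannel {n : ℕ} (W : QOp (Fin n ⊕ Fin n)) :
    QOp (Fin n) →ₗ[ℂ] QOp (Fin n) :=
  partialTrace ∘ₗ conjChannel W ∘ₗ addMixed (Fin n) (Fin n)

/-- `(Φ ⊗ id) ρ`, where `id` acts on the second register. -/
def extendMap {α β : Type} (Φ : QOp α →ₗ[ℂ] QOp α) (ρ : QOp (α ⊕ β)) : QOp (α ⊕ β) :=
  Matrix.of fun x y =>
    Φ (Matrix.of fun u v => ρ (Sum.elim u (x ∘ Sum.inr)) (Sum.elim v (y ∘ Sum.inr)))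
      (x ∘ Sum.inl) (y ∘ Sum.inl)

/-- The trace norm `‖A‖₁ = Tr √(A† A)`, the sum of the singular values. -/
noncomputable def traceNorm {ι : Type} [Fintype ι] [DecidableEq ι] (A : QOp ι) : ℝ :=
  ∑ x, √((Matrix.isHermitian_conjTranspose_mul_self A).eigenvalues x)

/-- Density matrices. -/
def IsDensity {ι : Type} [Fintype ι] [DecidableEq ι] (ρ : QOp ι) : Prop :=
  ρ.PosSemidef ∧ ρ.trace = 1

/-- The diamond distance `max_ρ ‖(Φ ⊗ id) ρ - (Ψ ⊗ id) ρ‖₁`, over all density matrices `ρ` on the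
register and a second copy of it. -/
noncomputable def diamondDist {ι : Type} [Fintype ι] [DecidableEq ι]
    (Φ Ψ : QOp ι →ₗ[ℂ] QOp ι) : ENNReal :=
  ⨆ (ρ : QOp (ι ⊕ ι)) (_ : IsDensity ρ), ENNReal.ofReal (traceNorm (extendMap Φ ρ - extendMap Ψ ρ))

/-! ### Quantum circuits -/

/-- A quantum gate: a unitary that acts on at most two qubits. -/
structure QGate (ι : Type) [Fintype ι] [DecidableEq ι] where
  qubits : Finset ι
  card_le : qubits.card ≤ 2
  op : QOp ι
  unitary : op ∈ Matrix.unitaryGroup (ι → Fin 2) ℂ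
  actsOn : ActsOn qubits op

/-- A layer of a circuit: gates on pairwise disjoint sets of qubits, carried out in parallel. -/
structure QLayer (ι : Type) [Fintype ι] [DecidableEq ι] where
  gates : List (QGate ι)
  disjoint : gates.Pairwise fun g h => Disjoint g.qubits h.qubits

/-- A quantum circuit is a sequence of layers. The leftmost layer is applied last, so that the list
is in the order of the operator product. -/
structure QCircuit (ι : Type) [Fintype ι] [DecidableEq ι] where
  layers : List (QLayer ι)

/-- The depth of a circuit is the number of its layers. -/
def QCircuit.depth {ι : Type} [Fintype ι] [DecidableEq ι] (c : QCircuit ι) : ℕ :=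
  c.layers.length

/-- The unitary that a circuit carries out. -/
noncomputable def QCircuit.toOp {ι : Type} [Fintype ι] [DecidableEq ι] (c : QCircuit ι) : QOp ι :=
  (c.layers.map fun l => (l.gates.map fun g => g.op).prod).prod

/-! ### Trotter-Suzuki product formulas -/

/-- `exp (τ A₁) exp (τ A₂) ⋯`, the first-order formula. -/
noncomputable def lieTrotter {ι : Type} [Fintype ι] [DecidableEq ι] (A : List (QOp ι)) (τ : ℂ) :
    QOp ι :=
  (A.map fun B => NormedSpace.exp (τ • B)).prod

/-- The symmetric Suzuki formula of order `2 k + 2`, by Suzuki's recursion. -/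
noncomputable def suzukiEven {ι : Type} [Fintype ι] [DecidableEq ι] (A : List (QOp ι)) :
    ℕ → ℂ → QOp ι
  | 0, τ => lieTrotter A (τ / 2) * lieTrotter A.reverse (τ / 2)
  | k + 1, τ =>
    let u : ℂ := ((1 / (4 - (4 : ℝ) ^ (1 / (2 * (k : ℝ) + 3))) : ℝ) : ℂ)
    suzukiEven A k (u * τ) ^ 2 * suzukiEven A k ((1 - 4 * u) * τ) * suzukiEven A k (u * τ) ^ 2

/-- The Trotter-Suzuki formula of order `p ≥ 1`: the first-order formula for `p = 1`, and the
symmetric formula of order `2 ⌈p / 2⌉` for `p ≥ 2`. -/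
noncomputable def trotterSuzuki {ι : Type} [Fintype ι] [DecidableEq ι] (p : ℕ)
    (A : List (QOp ι)) (τ : ℂ) : QOp ι :=
  if p = 1 then lieTrotter A τ else suzukiEven A ((p + 1) / 2 - 1) τ

/-! ### Geometrically local Hamiltonians and their dynamics -/

/-- The graph that joins two different labels when the sets of qubits attached to them overlap. -/
def overlapGraph {V : Type} {n : ℕ} (s : V → Finset (Fin n)) : SimpleGraph V :=
  SimpleGraph.fromRel fun a b => ¬ Disjoint (s a) (s b)

/-- A Hamiltonian `H = ∑ λ_X h_X` on `n` qubits placed at the points `pos` of the lattice `ℤ ^ D`,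
with `|λ_X| ≤ 1`, `h_X` Hermitian, `‖h_X‖ ≤ 1`, terms on at most `Λ` qubits that are at distance at
most `R` from each other, and an interaction graph of maximum degree at most `𝔡`. -/
structure LocalHamiltonian {n D : ℕ} (pos : Fin n → Fin D → ℤ) (R Λ 𝔡 : ℕ) where
  numTerms : ℕ
  supp : Fin numTerms → Finset (Fin n)
  coeff : Fin numTerms → ℝ
  term : Fin numTerms → QOp (Fin n)
  abs_coeff_le : ∀ j, |coeff j| ≤ 1
  isHermitian : ∀ j, (term j).IsHermitian
  norm_le : ∀ j, ‖term j‖ ≤ 1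
  actsOn : ∀ j, ActsOn (supp j) (term j)
  card_supp_le : ∀ j, (supp j).card ≤ Λ
  range_le : ∀ j, ∀ u ∈ supp j, ∀ v ∈ supp j, ∀ d, |pos u d - pos v d| ≤ R
  degree_le : ∀ j, ((overlapGraph supp).neighborSet j).ncard ≤ 𝔡

/-- The operator `H = ∑ λ_X h_X`. -/
noncomputable def LocalHamiltonian.op {n D : ℕ} {pos : Fin n → Fin D → ℤ} {R Λ 𝔡 : ℕ}
    (H : LocalHamiltonian pos R Λ 𝔡) : QOp (Fin n) :=
  ∑ j, (H.coeff j : ℂ) • H.term j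

section Dynamics

variable {n D K : ℕ} {pos : Fin n → Fin D → ℤ} {R Λ 𝔡 : ℕ}

/-- `U(t) = exp (-i H⁽¹⁾ t₁) ⋯ exp (-i H⁽ᴷ⁾ t_K)`. -/
noncomputable def evolution (H : Fin K → LocalHamiltonian pos R Λ 𝔡) (t : Fin K → ℝ) :
    QOp (Fin n) :=
  (List.ofFn fun k => NormedSpace.exp ((-Complex.I * (t k : ℂ)) • (H k).op)).prod

/-- `U(t)† A U(t)`. -/
noncomputable def heisenberg (H : Fin K → LocalHamiltonian pos R Λ 𝔡) (t : Fin K → ℝ)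
    (A : QOp (Fin n)) : QOp (Fin n) :=
  (evolution H t).conjTranspose * A * evolution H t

/-! ### Clusters and learned models -/

/-- The terms in `W` (taken from all `K` Hamiltonians) form, together with a single-qubit operator
on qubit `i`, a connected graph of overlaps. -/
def IsLinkedCluster (H : Fin K → LocalHamiltonian pos R Λ 𝔡) (i : Fin n)
    (W : Finset (Σ k, Fin (H k).numTerms)) : Prop :=
  (overlapGraph fun o : Option W => o.elim {i} fun a => (H a.1.1).supp a.1.2).Connected

/-- All qubits touched by the cluster `W` or equal to `i`. -/
def clusterRegion (H : Fin K → LocalHamiltonian pos R Λ 𝔡) (i : Fin n)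
    (W : Finset (Σ k, Fin (H k).numTerms)) : Finset (Fin n) :=
  insert i (W.biUnion fun a => (H a.1).supp a.2)

open Classical in
/-- The Pauli strings linked to qubit `i` at order `m`: those that live on a cluster that is
connected to `i` and has at most `m` terms from each Hamiltonian. -/
noncomputable def linkedPaulis (H : Fin K → LocalHamiltonian pos R Λ 𝔡) (i : Fin n) (m : ℕ) :
    Finset (Fin n → Fin 4) :=
  Finset.univ.filter fun P => ∃ W : Finset (Σ k, Fin (H k).numTerms),
    (∀ k, (W.filter fun a => a.1 = k).card ≤ m) ∧ IsLinkedCluster H i W ∧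
      pauliSupport P ⊆ clusterRegion H i W

/-- Real coefficients `α i a Q` of the Pauli strings `Q` in the learned operator `V_{O_i}` for the
Pauli matrix `O` with number `a`. -/
abbrev PauliModel (n : ℕ) := Fin n → Fin 4 → (Fin n → Fin 4) → ℝ

/-- `V_{O_i} = ∑_Q α_Q Q` over the Pauli strings linked to `i` at order `m` when `O` is one of
`X, Y, Z`, and `V_{I_i} = I`. -/
noncomputable def modelOp (H : Fin K → LocalHamiltonian pos R Λ 𝔡) (m : ℕ) (α : PauliModel n)
    (i : Fin n) (a : Fin 4) : QOp (Fin n) :=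
  if a = 0 then 1 else ∑ Q ∈ linkedPaulis H i m, (α i a Q : ℂ) • pauliString Q

/-- The model has accuracy `δ`: `‖V_{O_i} - U(t)† O_i U(t)‖ ≤ δ` for all `i` and `O = X, Y, Z`. -/
def IsLearnedModel (H : Fin K → LocalHamiltonian pos R Λ 𝔡) (t : Fin K → ℝ) (m : ℕ) (δ : ℝ)
    (α : PauliModel n) : Prop :=
  ∀ (i : Fin n) (a : Fin 4), a ≠ 0 →
    ‖modelOp H m α i a - heisenberg H t (pauliAt i a)‖ ≤ δ

/-! ### Compilation -/

/-- The swap `S` of the two registers. -/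
def swapOp (n : ℕ) : QOp (Fin n ⊕ Fin n) :=
  Matrix.of fun x y => if x = y ∘ Sum.swap then 1 else 0

/-- `V_i = 1/2 ∑_O V_{O_i} ⊗ O_{i+n}`, the sum over `O = I, X, Y, Z`. -/
noncomputable def sewnOp (H : Fin K → LocalHamiltonian pos R Λ 𝔡) (m : ℕ) (α : PauliModel n)
    (i : Fin n) : QOp (Fin n ⊕ Fin n) :=
  (1 / 2 : ℂ) • ∑ a, opTensor (modelOp H m α i a) (pauliAt i a)

/-- `S ∏_i exp (-i π/2 (V_i - I))`. -/
noncomputable def compiledOp (H : Fin K → LocalHamiltonian pos R Λ 𝔡) (m : ℕ)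
    (α : PauliModel n) : QOp (Fin n ⊕ Fin n) :=
  swapOp n * (List.ofFn fun i =>
    NormedSpace.exp ((-(Complex.I * (Real.pi : ℂ) / 2)) • (sewnOp H m α i - 1))).prod

/-- The multiples of Pauli strings whose sum is `V_i - I`. -/
noncomputable def sewnTerms (H : Fin K → LocalHamiltonian pos R Λ 𝔡) (m : ℕ) (α : PauliModel n)
    (i : Fin n) : List (QOp (Fin n ⊕ Fin n)) :=
  (-(1 / 2 : ℂ)) • (1 : QOp (Fin n ⊕ Fin n)) ::
    ([1, 2, 3] : List (Fin 4)).flatMap fun a => (linkedPaulis H i m).toList.map fun Q =>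
      ((α i a Q / 2 : ℝ) : ℂ) • opTensor (pauliString Q) (pauliAt i a)

/-- `S ∏_i T_i ^ r`, where `T_i` is the Trotter-Suzuki formula of order `p` for
`exp (-i π / (2 r) (V_i - I))`. -/
noncomputable def trotterizedOp (H : Fin K → LocalHamiltonian pos R Λ 𝔡) (m : ℕ)
    (α : PauliModel n) (p r : ℕ) : QOp (Fin n ⊕ Fin n) :=
  swapOp n * (List.ofFn fun i =>
    trotterSuzuki p (sewnTerms H m α i) (-(Complex.I * (Real.pi : ℂ) / (2 * (r : ℂ)))) ^ r).prod

end Dynamics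

/-- The threshold time `t* = 1 / (2 e K 𝔡)`. -/
noncomputable def thresholdTime (K 𝔡 : ℕ) : ℝ :=
  1 / (2 * Real.exp 1 * K * 𝔡)

/-- The order of truncation, up to a constant factor, at evolution time `t` and accuracy `δ`. -/
noncomputable def truncationOrder (K 𝔡 : ℕ) (t δ : ℝ) : ℝ :=
  if t < thresholdTime K 𝔡 then Real.log (1 / δ) / Real.log (thresholdTime K 𝔡 / t)
  else Real.exp (Real.pi * t * Real.exp 1 * K * 𝔡) *
    Real.log (Real.exp (Real.pi * t * Real.exp 1 * K * 𝔡) / δ)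

/-- The depth `log ^ D (n) [4 ^ (K Λ) e 𝔡] ^ M / ε ^ (1 / p)`. -/
noncomputable def depthRate (D K Λ 𝔡 p n : ℕ) (ε M : ℝ) : ℝ :=
  Real.log n ^ D * ((4 : ℝ) ^ (K * Λ) * Real.exp 1 * 𝔡) ^ M / ε ^ (1 / (p : ℝ))

/-! Locality of the evolved operators. Each factor of the evolution is cut into `N` equal short
steps, with `N` depending only on the parameters and on `T`. One step conjugates by `e ^ X`, and its
Taylor series consists of nested commutators. A commutator with a local Hamiltonian adds one
overlapping term to a cluster of `s` terms in at most `(1 + Λ s)(𝔡 + 1)` ways, so `l` nested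
commutators cost about `l!` times a `2 ^ s` penalty (`ClusterSum.iterate_lieBracket`). The `1 / l!`
of the series cancels the factorial and leaves a geometric series in the step size. The remainder
contains no power of `‖X‖`, since conjugation by a unitary is isometric
(`norm_exp_conj_sub_taylor_le`). Multiplying the truncation order by 4 from each step to the next
beats the penalty (`ClusterSum.exists_conjExpList_approx`). After the `K N` steps the clusters have
at most a constant times `ℓ` terms and the error is exponentially small in `ℓ`;
`truncation_error_le` matches this with `M(t)`. Hermitian parts then give real Pauli coefficients.

Sewing. For exact Heisenberg operators, `V_i` is the swap of qubit `i` with its partner, conjugated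
by `U ⊗ I`, because half the sum of `σ ⊗ σ` over the Pauli matrices is a swap. Hence `V_i` is an
involution, equals `exp (-i π/2 (V_i - I))`, and `S ∏ V_i = U ⊗ U†` (`swapOp_mul_prod_exactSewnOp`),
whose reduced channel is exactly conjugation by `U`. Exponentials of skew-adjoint elements are
1-Lipschitz and errors add up in products of unitaries, so errors `ε / n` in the model give an error
`O(ε)` in operator norm. Duality between trace norm and operator norm carries this over to the
diamond distance (`diamondDist_reducedChannel_le`).

Circuits. A product formula of any order is a product of Pauli rotations whose exponents add up to
the exact exponent, so a first-order estimate gives an error `O(1 / r)`. Every Pauli rotation is an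
exact product of linearly many two-qubit gates, obtained by conjugating its weight down. With the
gates executed one after another, the depth is at most a constant times `L ^ 3 (n / ε) ^ 3`, where
`L` bounds the number of linked Pauli strings. Counting connected clusters by walks gives `L = exp
(O(m))` (`card_linkedPaulis_le`). The power of `n / ε` is absorbed in the exponent: `log (n / ε)` is
at most a constant times `M(t)` when `t ≥ τ`, and otherwise it is covered by the maximum in the
second bound. -/

set_option linter.unusedSectionVars false

/-! ### Product operators and Pauli strings -/

section PauliAlgebra

variable {ι : Type} [Fintype ι]

/-- The tensor product of single-qubit operators. -/
def tensorString (M : ι → Matrix (Fin 2) (Fin 2) ℂ) : QOp ι :=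
  Matrix.of fun x y => ∏ q, M q (x q) (y q)

lemma pauliString_eq (P : ι → Fin 4) :
    pauliString P = tensorString fun q => pauliMatrix (P q) := rfl

lemma tensorString_conjTranspose (M : ι → Matrix (Fin 2) (Fin 2) ℂ) :
    (tensorString M).conjTranspose = tensorString fun q => (M q).conjTranspose := by
  ext x y
  simp [tensorString, Matrix.conjTranspose_apply, star_prod]

variable [DecidableEq ι]

lemma tensorString_mul (M N : ι → Matrix (Fin 2) (Fin 2) ℂ) :
    tensorString M * tensorString N = tensorString fun q => M q * N q := by
  ext x y
  simp only [tensorString, Matrix.mul_apply, Matrix.of_apply, ← Finset.prod_mul_distrib]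
  rw [Finset.prod_univ_sum]
  simp [Fintype.piFinset_univ]

lemma tensorString_one : tensorString (fun _ : ι => 1) = 1 := by
  ext x y
  simp only [tensorString, Matrix.of_apply, Matrix.one_apply]
  rw [Finset.prod_ite_zero]
  simp [funext_iff]

lemma trace_tensorString (M : ι → Matrix (Fin 2) (Fin 2) ℂ) :
    (tensorString M).trace = ∏ q, (M q).trace := by
  simp only [Matrix.trace, Matrix.diag, tensorString, Matrix.of_apply]
  rw [Finset.prod_univ_sum]
  simp [Fintype.piFinset_univ]

lemma pauliMatrix_conjTranspose (a : Fin 4) : (pauliMatrix a).conjTranspose = pauliMatrix a := by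
  fin_cases a <;> ext i j <;> fin_cases i <;> fin_cases j <;> simp [pauliMatrix]

lemma pauliMatrix_mul_self (a : Fin 4) : pauliMatrix a * pauliMatrix a = 1 := by
  fin_cases a <;> ext i j <;> fin_cases i <;> fin_cases j <;> simp [pauliMatrix]

lemma pauliMatrix_trace (a b : Fin 4) :
    (pauliMatrix a * pauliMatrix b).trace = if a = b then 2 else 0 := by
  fin_cases a <;> fin_cases b <;> simp [pauliMatrix, Matrix.trace] <;> norm_num

/-- Half the sum of `σ_a ⊗ σ_a` is the swap of two qubits. This underlies both the Pauli expansion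
of operators and the sewing of evolved Pauli matrices. -/
lemma pauliMatrix_completeness (i j k l : Fin 2) :
    ∑ a, pauliMatrix a i j * pauliMatrix a k l = if i = l ∧ j = k then 2 else 0 := by
  rw [Fin.sum_univ_four]
  fin_cases i <;> fin_cases j <;> fin_cases k <;> fin_cases l <;>
    simp [pauliMatrix] <;> norm_num

lemma pauliMatrix_anticomm {a b : Fin 4} (ha : a ≠ 0) (hb : b ≠ 0) (hab : a ≠ b) :
    pauliMatrix a * pauliMatrix b = -(pauliMatrix b * pauliMatrix a) := by
  fin_cases a <;> fin_cases b <;> simp at ha hb hab ⊢ <;>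
    ext i j <;> fin_cases i <;> fin_cases j <;> simp [pauliMatrix]

lemma pauliString_isHermitian (P : ι → Fin 4) : (pauliString P).IsHermitian := by
  rw [Matrix.IsHermitian, pauliString_eq, tensorString_conjTranspose]
  simp only [pauliMatrix_conjTranspose]

lemma pauliString_mul_self (P : ι → Fin 4) : pauliString P * pauliString P = 1 := by
  rw [pauliString_eq, tensorString_mul]
  simp only [pauliMatrix_mul_self, tensorString_one]

lemma pauliString_mem_unitary (P : ι → Fin 4) : pauliString P ∈ unitary (QOp ι) := by
  rw [Unitary.mem_iff, Matrix.star_eq_conjTranspose, pauliString_isHermitian P,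
    pauliString_mul_self]
  simp

lemma pauliString_zero : pauliString (0 : ι → Fin 4) = 1 := by
  rw [pauliString_eq, ← tensorString_one]
  rfl

lemma trace_pauliString_mul (P Q : ι → Fin 4) :
    (pauliString P * pauliString Q).trace = if P = Q then (2 : ℂ) ^ Fintype.card ι else 0 := by
  rw [pauliString_eq, pauliString_eq, tensorString_mul, trace_tensorString]
  simp only [pauliMatrix_trace]
  rw [Finset.prod_ite_zero]
  simp [funext_iff]

/-- The product over all qubits of the one-qubit relation says that `∑ P, P x y * P z w` is `2 ^
|ι|` times the indicator of `x = w` and `y = z`; contracting it with `A` gives the expansion. -/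
lemma pauliString_completeness (A : QOp ι) :
    A = ∑ P : ι → Fin 4,
      (((2 : ℂ) ^ Fintype.card ι)⁻¹ * (pauliString P * A).trace) • pauliString P := by
  have key : ∀ x y z w : ι → Fin 2, ∑ P : ι → Fin 4, pauliString P x y * pauliString P z w =
      if x = w ∧ y = z then (2 : ℂ) ^ Fintype.card ι else 0 := by
    intro x y z w
    simp only [pauliString, Matrix.of_apply, ← Finset.prod_mul_distrib]
    have := Finset.prod_univ_sum (fun _ : ι => (Finset.univ : Finset (Fin 4)))
      (fun q a => pauliMatrix a (x q) (y q) * pauliMatrix a (z q) (w q))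
    rw [Fintype.piFinset_univ] at this
    rw [← this]
    simp only [pauliMatrix_completeness]
    rw [Finset.prod_ite_zero]
    simp [funext_iff, forall_and]
  ext x y
  simp only [Matrix.sum_apply, Matrix.smul_apply, smul_eq_mul, Matrix.trace, Matrix.diag,
    Matrix.mul_apply, Finset.mul_sum, Finset.sum_mul]
  rw [Finset.sum_comm]
  have h : ∀ z w, ∑ P : ι → Fin 4, ((2 : ℂ) ^ Fintype.card ι)⁻¹ * (pauliString P z w * A w z)
      * pauliString P x y = if z = y ∧ w = x then A w z else 0 := by
    intro z w
    have : ∀ P : ι → Fin 4, ((2 : ℂ) ^ Fintype.card ι)⁻¹ * (pauliString P z w * A w z)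
      * pauliString P x y = ((2 : ℂ) ^ Fintype.card ι)⁻¹ * A w z *
        (pauliString P z w * pauliString P x y) := fun P => by ring
    simp only [this, ← Finset.mul_sum, key]
    split_ifs with h
    · field_simp
    · simp
  have h2 : ∀ z, ∑ P : ι → Fin 4, ∑ w, ((2 : ℂ) ^ Fintype.card ι)⁻¹ *
      (pauliString P z w * A w z) * pauliString P x y = if z = y then A x z else 0 := by
    intro z
    rw [Finset.sum_comm]
    simp only [h]
    by_cases hz : z = y <;> simp [hz]
  simp only [h2]
  simp

/-- The span of the Pauli strings supported in `X`. -/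
def pauliSpan (X : Finset ι) : Submodule ℂ (QOp ι) :=
  Submodule.span ℂ (pauliString '' {P | pauliSupport P ⊆ X})

lemma embedOp_tensorString (X : Finset ι) (M : X → Matrix (Fin 2) (Fin 2) ℂ) :
    embedOp X (tensorString M) = tensorString fun q => if h : q ∈ X then M ⟨q, h⟩ else 1 := by
  ext x y
  simp only [embedOp, tensorString, Matrix.of_apply]
  rw [← Finset.prod_mul_prod_compl X]
  have h1 : ∏ q ∈ X, (if h : q ∈ X then M ⟨q, h⟩ else 1) (x q) (y q) =
      ∏ q : X, M q (x q) (y q) := by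
    rw [← Finset.prod_coe_sort]
    refine Finset.prod_congr rfl fun q _ => ?_
    simp
  have h2 : ∏ q ∈ Xᶜ, (if h : q ∈ X then M ⟨q, h⟩ else 1) (x q) (y q) =
      if ∀ q, q ∉ X → x q = y q then 1 else 0 := by
    have : ∀ q ∈ Xᶜ, (if h : q ∈ X then M ⟨q, h⟩ else 1) (x q) (y q) =
        if x q = y q then (1 : ℂ) else 0 := by
      intro q hq
      rw [dif_neg (Finset.mem_compl.1 hq), Matrix.one_apply]
    rw [Finset.prod_congr rfl this, Finset.prod_ite_zero]
    simp
  rw [h1, h2]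
  split_ifs <;> simp

lemma embedOp_pauliString (X : Finset ι) (P : X → Fin 4) :
    embedOp X (pauliString P) = pauliString fun q => if h : q ∈ X then P ⟨q, h⟩ else 0 := by
  rw [pauliString_eq, embedOp_tensorString, pauliString_eq]
  congr 1
  funext q
  split_ifs <;> rfl

lemma embedOp_add (X : Finset ι) (A B : QOp X) :
    embedOp X (A + B) = embedOp X A + embedOp X B := by
  ext x y
  simp only [embedOp, Matrix.of_apply, Matrix.add_apply]
  split_ifs <;> simp

lemma embedOp_smul (X : Finset ι) (c : ℂ) (A : QOp X) : embedOp X (c • A) = c • embedOp X A := by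
  ext x y
  simp [embedOp]

lemma ActsOn.add {X : Finset ι} {A B : QOp ι} (hA : ActsOn X A) (hB : ActsOn X B) :
    ActsOn X (A + B) := by
  obtain ⟨A, rfl⟩ := hA
  obtain ⟨B, rfl⟩ := hB
  exact ⟨A + B, (embedOp_add X A B).symm⟩

lemma ActsOn.smul {X : Finset ι} {A : QOp ι} (c : ℂ) (hA : ActsOn X A) : ActsOn X (c • A) := by
  obtain ⟨A, rfl⟩ := hA
  exact ⟨c • A, (embedOp_smul X c A).symm⟩

lemma actsOn_tensorString {X : Finset ι} {M : ι → Matrix (Fin 2) (Fin 2) ℂ}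
    (h : ∀ q, q ∉ X → M q = 1) : ActsOn X (tensorString M) := by
  refine ⟨tensorString fun q => M q, ?_⟩
  rw [embedOp_tensorString]
  congr 1
  funext q
  split_ifs with hq
  · rfl
  · exact h q hq

lemma actsOn_zero (X : Finset ι) : ActsOn X (0 : QOp ι) := by
  simpa using (actsOn_tensorString (X := X) (M := fun _ => 1) fun _ _ => rfl).smul 0

lemma notMem_pauliSupport {P : ι → Fin 4} {q : ι} : q ∉ pauliSupport P ↔ P q = 0 := by
  simp [pauliSupport]

lemma actsOn_pauliString {X : Finset ι} {P : ι → Fin 4} (h : pauliSupport P ⊆ X) :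
    ActsOn X (pauliString P) := by
  refine actsOn_tensorString fun q hq => ?_
  rw [notMem_pauliSupport.1 fun hq' => hq (h hq')]
  rfl

/-- This makes locality a linear condition: products and commutation of local operators reduce by
span induction to Pauli strings, where they are checked qubit by qubit. -/
lemma actsOn_iff_mem_pauliSpan {X : Finset ι} {A : QOp ι} : ActsOn X A ↔ A ∈ pauliSpan X := by
  constructor
  · rintro ⟨B, rfl⟩
    rw [pauliString_completeness B]
    have : ∀ s : Finset (X → Fin 4), ∀ c : (X → Fin 4) → ℂ,
        embedOp X (∑ P ∈ s, c P • pauliString P) ∈ pauliSpan X := by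
      intro s c
      induction s using Finset.induction_on with
      | empty =>
        convert (pauliSpan X).zero_mem
        simpa using embedOp_smul X 0 0
      | insert P s hP ih =>
        rw [Finset.sum_insert hP, embedOp_add, embedOp_smul, embedOp_pauliString]
        refine Submodule.add_mem _ (Submodule.smul_mem _ _ (Submodule.subset_span ⟨_, ?_, rfl⟩)) ih
        intro q hq
        by_contra hX
        simp [pauliSupport, hX] at hq
    exact this _ _
  · intro h
    induction h using Submodule.span_induction with
    | mem A hA =>
      obtain ⟨P, hP, rfl⟩ := hA
      exact actsOn_pauliString hP
    | zero => exact actsOn_zero X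
    | add A B _ _ hA hB => exact hA.add hB
    | smul c A _ hA => exact hA.smul c

lemma ActsOn.mono {X Y : Finset ι} {A : QOp ι} (h : X ⊆ Y) (hA : ActsOn X A) : ActsOn Y A := by
  rw [actsOn_iff_mem_pauliSpan] at *
  exact Submodule.span_mono (Set.image_mono fun P (hP : pauliSupport P ⊆ X) => hP.trans h) hA

lemma ActsOn.mul {X : Finset ι} {A B : QOp ι} (hA : ActsOn X A) (hB : ActsOn X B) :
    ActsOn X (A * B) := by
  rw [actsOn_iff_mem_pauliSpan] at hA hB
  induction hA using Submodule.span_induction with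
  | mem A hA =>
    obtain ⟨P, hP, rfl⟩ := hA
    induction hB using Submodule.span_induction with
    | mem B hB =>
      obtain ⟨Q, hQ, rfl⟩ := hB
      rw [pauliString_eq, pauliString_eq, tensorString_mul]
      refine actsOn_tensorString fun q hq => ?_
      rw [notMem_pauliSupport.1 fun hq' => hq (hP hq'),
        notMem_pauliSupport.1 fun hq' => hq (hQ hq'), pauliMatrix_mul_self]
    | zero => simpa using actsOn_zero X
    | add B C _ _ hB hC =>
      rw [mul_add]
      exact hB.add hC
    | smul c B _ hB =>
      rw [mul_smul_comm]
      exact hB.smul c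
  | zero => simpa using actsOn_zero X
  | add A C _ _ hA hC =>
    rw [add_mul]
    exact hA.add hC
  | smul c A _ hA =>
    rw [smul_mul_assoc]
    exact hA.smul c

lemma ActsOn.sub {X : Finset ι} {A B : QOp ι} (hA : ActsOn X A) (hB : ActsOn X B) :
    ActsOn X (A - B) := by
  simpa [sub_eq_add_neg] using hA.add (hB.smul (-1))

lemma ActsOn.commute {X Y : Finset ι} {A B : QOp ι} (h : Disjoint X Y) (hA : ActsOn X A)
    (hB : ActsOn Y B) : A * B = B * A := by
  rw [actsOn_iff_mem_pauliSpan] at hA hB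
  induction hA using Submodule.span_induction with
  | mem A hA =>
    obtain ⟨P, hP, rfl⟩ := hA
    induction hB using Submodule.span_induction with
    | mem B hB =>
      obtain ⟨Q, hQ, rfl⟩ := hB
      rw [pauliString_eq, pauliString_eq, tensorString_mul, tensorString_mul]
      congr 1
      funext q
      by_cases hq : q ∈ X
      · have hq' : q ∉ Y := Finset.disjoint_left.1 h hq
        rw [notMem_pauliSupport.1 fun hQ' => hq' (hQ hQ')]
        simp [pauliMatrix]
      · rw [notMem_pauliSupport.1 fun hP' => hq (hP hP')]
        simp [pauliMatrix]
    | zero => simp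
    | add B C _ _ hB hC =>
      rw [mul_add, add_mul, hB,
        hC]
    | smul c B _ hB =>
      rw [mul_smul_comm, smul_mul_assoc, hB]
  | zero => simp
  | add A C _ _ hA hC =>
    rw [mul_add, add_mul, hA,
      hC]
  | smul c A _ hA =>
    rw [mul_smul_comm, smul_mul_assoc, hA]

lemma norm_entry_le (A : QOp ι) (x y : ι → Fin 2) : ‖A x y‖ ≤ ‖A‖ := by
  have h := Matrix.l2_opNorm_mulVec A (EuclideanSpace.single y 1)
  have h3 := PiLp.norm_apply_le ((EuclideanSpace.equiv (ι → Fin 2) ℂ).symm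
    (A.mulVec (EuclideanSpace.single y (1 : ℂ)))) x
  simp at h h3
  exact h3.trans h

lemma norm_trace_le (A : QOp ι) : ‖A.trace‖ ≤ 2 ^ Fintype.card ι * ‖A‖ := by
  refine (norm_sum_le _ _).trans ((Finset.sum_le_sum fun x _ => norm_entry_le A x x).trans ?_)
  simp

lemma norm_pauliString (P : ι → Fin 4) : ‖pauliString P‖ = 1 :=
  CStarRing.norm_of_mem_unitary (pauliString_mem_unitary P)

/-- The Pauli coefficients of an operator are bounded by its norm. -/
lemma norm_pauli_coeff_le (s : Finset (ι → Fin 4)) (c : (ι → Fin 4) → ℂ) {Q : ι → Fin 4}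
    (hQ : Q ∈ s) : ‖c Q‖ ≤ ‖∑ P ∈ s, c P • pauliString P‖ := by
  set A := ∑ P ∈ s, c P • pauliString P with hA
  have h : (pauliString Q * A).trace = 2 ^ Fintype.card ι * c Q := by
    rw [hA, Finset.mul_sum, Matrix.trace_sum]
    simp only [mul_smul_comm, Matrix.trace_smul, trace_pauliString_mul, smul_eq_mul]
    simp [hQ, mul_comm]
  have h2 := norm_trace_le (pauliString Q * A)
  rw [CStarRing.norm_mem_unitary_mul _ (pauliString_mem_unitary Q), h, norm_mul, norm_pow] at h2
  have : (0 : ℝ) < 2 ^ Fintype.card ι := by positivity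
  simpa [this] using h2

end PauliAlgebra

/-! ### Exponentials of skew-adjoint elements of a C⋆-algebra -/

section Exponentials

variable {𝔸 : Type*} [CStarAlgebra 𝔸]

lemma smul_mem_skewAdjoint_real {X : 𝔸} (hX : X ∈ skewAdjoint 𝔸) (s : ℝ) :
    s • X ∈ skewAdjoint 𝔸 := by
  rw [skewAdjoint.mem_iff] at *
  simp [star_smul, hX]

lemma exp_mem_unitary_of_skewAdjoint {X : 𝔸} (hX : X ∈ skewAdjoint 𝔸) :
    NormedSpace.exp X ∈ unitary 𝔸 :=
  let _ : NormedAlgebra ℚ 𝔸 := NormedAlgebra.restrictScalars ℚ ℂ 𝔸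
  NormedSpace.exp_mem_unitary_of_mem_skewAdjoint hX

lemma exp_smul_mem_unitary {X : 𝔸} (hX : X ∈ skewAdjoint 𝔸) (s : ℝ) :
    NormedSpace.exp (s • X) ∈ unitary 𝔸 :=
  exp_mem_unitary_of_skewAdjoint (smul_mem_skewAdjoint_real hX s)

lemma star_exp_of_mem_skewAdjoint {X : 𝔸} (hX : X ∈ skewAdjoint 𝔸) :
    star (NormedSpace.exp X) = NormedSpace.exp (-X) := by
  rw [NormedSpace.star_exp, skewAdjoint.mem_iff.1 hX]

lemma norm_unitary_mul_mul {U V : 𝔸} (hU : U ∈ unitary 𝔸) (hV : V ∈ unitary 𝔸) (A : 𝔸) :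
    ‖U * A * V‖ = ‖A‖ := by
  rw [CStarRing.norm_mul_mem_unitary _ hV, CStarRing.norm_mem_unitary_mul _ hU]

lemma hasDerivAt_exp_smul_real (X : 𝔸) (s : ℝ) :
    HasDerivAt (fun u : ℝ => NormedSpace.exp (u • X)) (NormedSpace.exp (s • X) * X) s :=
  hasDerivAt_exp_smul_const X s

lemma hasDerivAt_exp_smul_real' (X : 𝔸) (s : ℝ) :
    HasDerivAt (fun u : ℝ => NormedSpace.exp (u • X)) (X * NormedSpace.exp (s • X)) s :=
  hasDerivAt_exp_smul_const' X s

/-- Along the interpolation `e ^ (sX) e ^ ((1 - s)Y)` the derivative is `X - Y` between two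
unitaries, hence of constant norm. -/
lemma norm_exp_sub_exp_le {X Y : 𝔸} (hX : X ∈ skewAdjoint 𝔸) (hY : Y ∈ skewAdjoint 𝔸) :
    ‖NormedSpace.exp X - NormedSpace.exp Y‖ ≤ ‖X - Y‖ := by
  have key : ∀ s : ℝ, HasDerivAt
      (fun u : ℝ => NormedSpace.exp (u • X) * NormedSpace.exp ((1 - u) • Y))
      (NormedSpace.exp (s • X) * (X - Y) * NormedSpace.exp ((1 - s) • Y)) s := by
    intro s
    have h1 := hasDerivAt_exp_smul_real X s
    have h2 := (hasDerivAt_exp_smul_real' Y (1 - s)).scomp s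
      ((hasDerivAt_id s).const_sub 1)
    refine (h1.mul h2).congr_deriv ?_
    simp only [Function.comp]
    rw [neg_smul, one_smul, mul_sub, sub_mul, mul_neg]
    simp only [mul_assoc, sub_eq_add_neg]
  have := norm_image_sub_le_of_norm_deriv_le_segment_01' (C := ‖X - Y‖)
    (fun s _ => (key s).hasDerivWithinAt) (fun s _ => (norm_unitary_mul_mul
      (exp_smul_mem_unitary hX s) (exp_smul_mem_unitary hY (1 - s)) (X - Y)).le)
  simpa [NormedSpace.exp_zero] using this

lemma norm_exp_sub_one_le {X : 𝔸} (hX : X ∈ skewAdjoint 𝔸) :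
    ‖NormedSpace.exp X - 1‖ ≤ ‖X‖ := by
  simpa [NormedSpace.exp_zero] using norm_exp_sub_exp_le hX (skewAdjoint 𝔸).zero_mem

lemma norm_exp_sub_one_sub_le {X : 𝔸} (hX : X ∈ skewAdjoint 𝔸) :
    ‖NormedSpace.exp X - 1 - X‖ ≤ ‖X‖ ^ 2 := by
  have key : ∀ s : ℝ, HasDerivAt (fun u : ℝ => NormedSpace.exp (u • X) - u • X)
      ((NormedSpace.exp (s • X) - 1) * X) s := by
    intro s
    have := (hasDerivAt_exp_smul_real X s).sub ((hasDerivAt_id s).smul_const X)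
    refine this.congr_deriv ?_
    simp [sub_mul]
  have hb : ∀ s ∈ Set.Ico (0 : ℝ) 1, ‖(NormedSpace.exp (s • X) - 1) * X‖ ≤ ‖X‖ ^ 2 := by
    intro s hs
    refine (norm_mul_le _ _).trans ?_
    rw [sq]
    gcongr
    refine (norm_exp_sub_one_le (smul_mem_skewAdjoint_real hX s)).trans ?_
    rw [norm_smul, Real.norm_of_nonneg hs.1]
    exact mul_le_of_le_one_left (norm_nonneg _) hs.2.le
  have := norm_image_sub_le_of_norm_deriv_le_segment_01'
    (fun s _ => (key s).hasDerivWithinAt) hb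
  simp only [one_smul, zero_smul, NormedSpace.exp_zero, sub_zero] at this
  rwa [sub_right_comm]

lemma list_sum_mem_skewAdjoint {l : List 𝔸} (h : ∀ X ∈ l, X ∈ skewAdjoint 𝔸) :
    l.sum ∈ skewAdjoint 𝔸 :=
  AddSubgroup.list_sum_mem _ h

lemma list_norm_sum_le (l : List 𝔸) : ‖l.sum‖ ≤ (l.map norm).sum := by
  induction l with
  | nil => simp
  | cons a l ih => simpa using (norm_add_le _ _).trans (by gcongr)

lemma list_prod_exp_mem_unitary {l : List 𝔸} (h : ∀ X ∈ l, X ∈ skewAdjoint 𝔸) :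
    (l.map NormedSpace.exp).prod ∈ unitary 𝔸 := by
  refine Submonoid.list_prod_mem _ fun U hU => ?_
  obtain ⟨X, hX, rfl⟩ := List.mem_map.1 hU
  exact exp_mem_unitary_of_skewAdjoint (h X hX)

/-- Induction on the list. As the split-off factor is unitary, the old error enters unamplified, and
the bounds add up to `s ^ 2 + ‖X‖ ^ 2 + ‖X‖ s ≤ (‖X‖ + s) ^ 2`. -/
lemma norm_prod_exp_sub_one_sub_sum_le {l : List 𝔸} (h : ∀ X ∈ l, X ∈ skewAdjoint 𝔸) :
    ‖(l.map NormedSpace.exp).prod - 1 - l.sum‖ ≤ (l.map norm).sum ^ 2 := by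
  induction l with
  | nil => simp
  | cons X l ih =>
    have hX := h X (by simp)
    have hl : ∀ Y ∈ l, Y ∈ skewAdjoint 𝔸 := fun Y hY => h Y (by simp [hY])
    have ih := ih hl
    have hs := list_norm_sum_le l
    simp only [List.map_cons, List.prod_cons, List.sum_cons]
    set Q := (l.map NormedSpace.exp).prod
    set S := l.sum
    set s := (l.map norm).sum
    have e : NormedSpace.exp X * Q - 1 - (X + S) = NormedSpace.exp X * (Q - 1 - S)
        + (NormedSpace.exp X - 1 - X) + (NormedSpace.exp X - 1) * S := by noncomm_ring
    rw [e]
    have h1 : ‖NormedSpace.exp X * (Q - 1 - S)‖ ≤ s ^ 2 := by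
      rw [CStarRing.norm_mem_unitary_mul _
        (exp_mem_unitary_of_skewAdjoint hX)]
      exact ih
    have h2 := norm_exp_sub_one_sub_le hX
    have h3 : ‖(NormedSpace.exp X - 1) * S‖ ≤ ‖X‖ * s :=
      (norm_mul_le _ _).trans (by gcongr; exact norm_exp_sub_one_le hX)
    have h4 : 0 ≤ s := (norm_nonneg _).trans hs
    have := norm_add₃_le (a := NormedSpace.exp X * (Q - 1 - S))
      (b := NormedSpace.exp X - 1 - X) (c := (NormedSpace.exp X - 1) * S)
    nlinarith [norm_nonneg X, mul_nonneg (norm_nonneg X) h4]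

/-- A product of exponentials approximates the exponential of the sum to first order. -/
lemma norm_prod_exp_sub_exp_sum_le {l : List 𝔸} (h : ∀ X ∈ l, X ∈ skewAdjoint 𝔸) :
    ‖(l.map NormedSpace.exp).prod - NormedSpace.exp l.sum‖ ≤ 2 * (l.map norm).sum ^ 2 := by
  have h1 := norm_prod_exp_sub_one_sub_sum_le h
  have h2 := norm_exp_sub_one_sub_le (list_sum_mem_skewAdjoint h)
  have h3 : ‖l.sum‖ ^ 2 ≤ (l.map norm).sum ^ 2 := by
    gcongr; exact list_norm_sum_le l
  have e : (l.map NormedSpace.exp).prod - NormedSpace.exp l.sum =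
      ((l.map NormedSpace.exp).prod - 1 - l.sum) - (NormedSpace.exp l.sum - 1 - l.sum) := by abel
  rw [e]
  linarith [norm_sub_le ((l.map NormedSpace.exp).prod - 1 - l.sum)
    (NormedSpace.exp l.sum - 1 - l.sum)]

lemma norm_le_one_of_mem_unitary {U : 𝔸} (hU : U ∈ unitary 𝔸) : ‖U‖ ≤ 1 := by
  have h := CStarRing.norm_star_mul_self (x := U)
  rw [(Unitary.mem_iff.1 hU).1] at h
  have h1 : ‖(1 : 𝔸)‖ ≤ 1 := by
    have := CStarRing.norm_star_mul_self (x := (1 : 𝔸))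
    simp only [star_one, mul_one] at this
    by_contra! hc
    nlinarith
  nlinarith [norm_nonneg U]

/-- Telescoping: factors are exchanged one at a time, and the unitary factors around the exchanged
one do not change norms. -/
lemma norm_list_prod_sub_le {ι : Type*} (l : List ι) (f g : ι → 𝔸)
    (hf : ∀ i ∈ l, f i ∈ unitary 𝔸) (hg : ∀ i ∈ l, g i ∈ unitary 𝔸) {δ : ℝ}
    (h : ∀ i ∈ l, ‖f i - g i‖ ≤ δ) :
    ‖(l.map f).prod - (l.map g).prod‖ ≤ l.length * δ := by
  induction l with
  | nil => simp
  | cons i l ih =>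
    have ih := ih (fun j hj => hf j (by simp [hj])) (fun j hj => hg j (by simp [hj]))
      (fun j hj => h j (by simp [hj]))
    simp only [List.map_cons, List.prod_cons, List.length_cons]
    set P := (l.map f).prod
    set Q := (l.map g).prod with hQ
    have hQu : Q ∈ unitary 𝔸 := Submonoid.list_prod_mem _ fun U hU => by
      obtain ⟨j, hj, rfl⟩ := List.mem_map.1 hU
      exact hg j (by simp [hj])
    have e : f i * P - g i * Q = f i * (P - Q) + (f i - g i) * Q := by noncomm_ring
    rw [e]
    refine (norm_add_le _ _).trans ?_
    rw [CStarRing.norm_mem_unitary_mul _ (hf i (by simp)), CStarRing.norm_mul_mem_unitary _ hQu]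
    push_cast
    linarith [h i (by simp)]

lemma norm_pow_sub_pow_le {U V : 𝔸} (hU : U ∈ unitary 𝔸) (hV : V ∈ unitary 𝔸) (r : ℕ) :
    ‖U ^ r - V ^ r‖ ≤ r * ‖U - V‖ := by
  have := norm_list_prod_sub_le (List.range r) (fun _ => U) (fun _ => V) (fun _ _ => hU)
    (fun _ _ => hV) (δ := ‖U - V‖) (fun _ _ => le_rfl)
  simpa using this

/-- The commutator with `X`. -/
def lieBracket (X A : 𝔸) : 𝔸 := X * A - A * X

/-- The truncated Taylor series of `e ^ X A e ^ (-X)`. -/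
noncomputable def conjTaylor (X A : 𝔸) (L : ℕ) (s : ℝ) : 𝔸 :=
  ∑ l ∈ Finset.range (L + 1), (s ^ l / l.factorial : ℝ) • (lieBracket X)^[l] A

lemma hasDerivAt_exp_conj (X A : 𝔸) (s : ℝ) :
    HasDerivAt (fun u : ℝ => NormedSpace.exp (u • X) * A * NormedSpace.exp (-(u • X)))
      (NormedSpace.exp (s • X) * lieBracket X A * NormedSpace.exp (-(s • X))) s := by
  have h1 := (hasDerivAt_exp_smul_real X s).mul_const A
  have h2 := hasDerivAt_exp_smul_real' (-X) s
  simp only [smul_neg] at h2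
  refine (h1.mul h2).congr_deriv ?_
  simp only [lieBracket, sub_eq_add_neg, mul_add, add_mul, mul_assoc, neg_mul, mul_neg]

/-- Differentiation lowers the order by one and replaces `A` by `[X, A]`, just as it replaces `A` by
`[X, A]` in the exact conjugation. This is the recursion behind the remainder estimate. -/
lemma hasDerivAt_conjTaylor (X A : 𝔸) (L : ℕ) (s : ℝ) :
    HasDerivAt (conjTaylor X A (L + 1)) (conjTaylor X (lieBracket X A) L s) s := by
  unfold conjTaylor
  have : ∀ l ∈ Finset.range (L + 1 + 1), HasDerivAt
      (fun s : ℝ => (s ^ l / l.factorial : ℝ) • (lieBracket X)^[l] A)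
      ((l * s ^ (l - 1) / l.factorial : ℝ) • (lieBracket X)^[l] A) s := fun l _ =>
    ((hasDerivAt_pow l s).div_const _).smul_const _
  have := HasDerivAt.fun_sum this
  refine this.congr_deriv ?_
  rw [Finset.sum_range_succ' _ (L + 1)]
  simp only [Nat.cast_zero, zero_mul, zero_div, zero_smul, add_zero]
  refine Finset.sum_congr rfl fun l _ => ?_
  rw [Function.iterate_succ_apply]
  congr 1
  rw [Nat.factorial_succ]
  have : (l.factorial : ℝ) ≠ 0 := by positivity
  push_cast
  field_simp

/-- The remainder vanishes at 0 and its derivative is the remainder of one order less for `[X, A]`,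
so integration drives an induction on `L`. In the base case the derivative is a unitary conjugate of
`[X, A]`. -/
lemma norm_exp_conj_sub_taylor_le {X : 𝔸} (hX : X ∈ skewAdjoint 𝔸) (L : ℕ) :
    ∀ (A : 𝔸) (s : ℝ), s ∈ Set.Icc (0 : ℝ) 1 →
      ‖NormedSpace.exp (s • X) * A * NormedSpace.exp (-(s • X)) - conjTaylor X A L s‖ ≤
        ‖(lieBracket X)^[L + 1] A‖ * (s ^ (L + 1) / (L + 1).factorial) := by
  have hu : ∀ (s : ℝ) (B : 𝔸), ‖NormedSpace.exp (s • X) * B * NormedSpace.exp (-(s • X))‖ = ‖B‖ := by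
    intro s B
    refine norm_unitary_mul_mul (exp_smul_mem_unitary hX s) ?_ B
    rw [← neg_smul]; exact exp_smul_mem_unitary hX (-s)
  -- One integration: a bound `C s ^ q / q!` on the derivative becomes a bound `C s ^ (q + 1) / (q +
  -- 1)!` on the function.
  have main : ∀ (A : 𝔸) (C : ℝ) (q : ℕ) (F : ℝ → 𝔸) (G : ℝ → 𝔸), F 0 = 0 →
      (∀ s, HasDerivAt F (G s) s) →
      (∀ s ∈ Set.Icc (0 : ℝ) 1, ‖G s‖ ≤ C * (s ^ q / q.factorial)) →
      ∀ s ∈ Set.Icc (0 : ℝ) 1, ‖F s‖ ≤ C * (s ^ (q + 1) / (q + 1).factorial) := by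
    intro A C q F G hF0 hF hG s hs
    refine image_norm_le_of_norm_deriv_right_le_deriv_boundary
      (f' := G) (B := fun s => C * (s ^ (q + 1) / (q + 1).factorial))
      (B' := fun s => C * (s ^ q / q.factorial)) (a := 0) (b := 1)
      (fun s _ => (hF s).continuousAt.continuousWithinAt)
      (fun s _ => (hF s).hasDerivWithinAt) (by simp [hF0]) ?_
      (fun s hs => hG s ⟨hs.1, hs.2.le⟩) hs
    intro s
    refine (((hasDerivAt_pow (q + 1) s).div_const _).const_mul C).congr_deriv ?_
    rw [Nat.factorial_succ]
    have : (q.factorial : ℝ) ≠ 0 := by positivity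
    push_cast
    field_simp
  induction L with
  | zero =>
    intro A s hs
    have := main A ‖lieBracket X A‖ 0 _ _ (by simp [conjTaylor, NormedSpace.exp_zero])
      (fun s => (hasDerivAt_exp_conj X A s).sub (hasDerivAt_const s (conjTaylor X A 0 0)))
      (fun s _ => by simp [hu]) s hs
    simpa [conjTaylor] using this
  | succ L ih =>
    intro A s hs
    have := main A ‖(lieBracket X)^[L + 1] (lieBracket X A)‖ (L + 1) _ _
      (by
        have : conjTaylor X A (L + 1) 0 = A := by
          unfold conjTaylor
          rw [Finset.sum_eq_single 0] <;> simp +contextual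
        simp [this, NormedSpace.exp_zero])
      (fun s => (hasDerivAt_exp_conj X A s).sub (hasDerivAt_conjTaylor X A L s))
      (fun s hs => ih _ s hs) s hs
    exact this

/-- Taylor's theorem for `e ^ X A e ^ (-X)`, with a remainder that does not grow with `‖X‖`. -/
lemma norm_exp_conj_sub_conjTaylor_le {X : 𝔸} (hX : X ∈ skewAdjoint 𝔸) (A : 𝔸) (L : ℕ) :
    ‖NormedSpace.exp X * A * NormedSpace.exp (-X) - conjTaylor X A L 1‖ ≤
      ‖(lieBracket X)^[L + 1] A‖ / (L + 1).factorial := by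
  have := norm_exp_conj_sub_taylor_le hX L A 1 (by simp)
  simpa [div_eq_mul_inv] using this

end Exponentials

/-! ### Linked clusters -/

section Clusters

lemma overlapGraph_adj {V : Type} {n : ℕ} {s : V → Finset (Fin n)} {a b : V} :
    (overlapGraph s).Adj a b ↔ a ≠ b ∧ ¬ Disjoint (s a) (s b) := by
  rw [overlapGraph, SimpleGraph.fromRel_adj, disjoint_comm (a := s b), or_self]

lemma overlapGraph_reachable_map {V V' : Type} {n : ℕ} {s : V → Finset (Fin n)}
    {s' : V' → Finset (Fin n)} (f : V → V') (hf : Function.Injective f)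
    (h : ∀ v, s' (f v) = s v) {u v : V} (r : (overlapGraph s).Reachable u v) :
    (overlapGraph s').Reachable (f u) (f v) := by
  let F : overlapGraph s →g overlapGraph s' :=
    ⟨f, fun {a b} hab => by
      rw [overlapGraph_adj] at *
      exact ⟨hf.ne hab.1, by rw [h, h]; exact hab.2⟩⟩
  exact r.map F

variable {n D K : ℕ} {pos : Fin n → Fin D → ℤ} {R Λ 𝔡 : ℕ}
  (H : Fin K → LocalHamiltonian pos R Λ 𝔡) (i : Fin n)

lemma isLinkedCluster_empty : IsLinkedCluster H i ∅ := by
  unfold IsLinkedCluster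
  have : Subsingleton (Option (∅ : Finset (Σ k, Fin (H k).numTerms))) := by
    refine ⟨fun a b => ?_⟩
    rcases a with _ | ⟨a, ha⟩
    · rcases b with _ | ⟨b, hb⟩
      · rfl
      · simp at hb
    · simp at ha
  exact SimpleGraph.Connected.mk fun a b => by rw [Subsingleton.elim a b]

variable {H i}

/-- A term that meets the region shares a qubit with the root or with a member of the cluster, so it
gets an edge to an already connected vertex. -/
lemma IsLinkedCluster.insert_term {W : Finset (Σ k, Fin (H k).numTerms)} (hW : IsLinkedCluster H i W)
    {a : Σ k, Fin (H k).numTerms}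
    (ha : ¬ Disjoint ((H a.1).supp a.2) (clusterRegion H i W)) :
    IsLinkedCluster H i (insert a W) := by
  by_cases haW : a ∈ W
  · rwa [Finset.insert_eq_of_mem haW]
  unfold IsLinkedCluster at *
  let f : Option W → Option (insert a W : Finset _) :=
    Option.map fun b => ⟨b.1, Finset.mem_insert_of_mem b.2⟩
  have hf : Function.Injective f := Option.map_injective fun b c hbc =>
    Subtype.ext (Subtype.mk.inj hbc)
  set s' := fun o : Option (insert a W : Finset (Σ k, Fin (H k).numTerms)) =>
    o.elim {i} fun a => (H a.1.1).supp a.1.2 with hs'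
  have hr : ∀ b, (overlapGraph s').Reachable (f none) (f b) := fun b =>
    overlapGraph_reachable_map f hf (by rintro (_ | b) <;> rfl) (hW.preconnected none b)
  have hra : (overlapGraph s').Reachable (f none) (some ⟨a, Finset.mem_insert_self a W⟩) := by
    obtain ⟨q, hq1, hq2⟩ := Finset.not_disjoint_iff.1 ha
    rw [clusterRegion, Finset.mem_insert, Finset.mem_biUnion] at hq2
    rcases hq2 with rfl | ⟨b, hb, hqb⟩
    · refine SimpleGraph.Adj.reachable (overlapGraph_adj.2 ⟨by simp [f], ?_⟩)
      exact Finset.not_disjoint_iff.2 ⟨q, by simp [hs', f], hq1⟩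
    · refine (hr (some ⟨b, hb⟩)).trans (SimpleGraph.Adj.reachable (overlapGraph_adj.2 ⟨?_, ?_⟩))
      · intro h
        simp only [f, Option.map_some, Option.some.injEq, Subtype.mk.injEq] at h
        exact haW (h ▸ hb)
      · exact Finset.not_disjoint_iff.2 ⟨q, hqb, hq1⟩
  have hall : ∀ b, (overlapGraph s').Reachable (f none) b := by
    rintro (_ | ⟨b, hb⟩)
    · exact hr none
    · rcases Finset.mem_insert.1 hb with rfl | hb'
      · exact hra
      · exact hr (some ⟨b, hb'⟩)
  exact SimpleGraph.Connected.mk fun b c => (hall b).symm.trans (hall c)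

variable (H i)

lemma card_clusterRegion_le (W : Finset (Σ k, Fin (H k).numTerms)) :
    (clusterRegion H i W).card ≤ 1 + Λ * W.card := by
  have := Finset.card_biUnion_le_card_mul W (fun a => (H a.1).supp a.2) Λ
    fun a _ => (H a.1).card_supp_le a.2
  have h2 := Finset.card_insert_le i (W.biUnion fun a => (H a.1).supp a.2)
  unfold clusterRegion
  rw [mul_comm]
  omega

variable {H i} in
lemma clusterRegion_mono {W W' : Finset (Σ k, Fin (H k).numTerms)} (h : W ⊆ W') :
    clusterRegion H i W ⊆ clusterRegion H i W' :=
  Finset.insert_subset_insert _ (Finset.biUnion_subset_biUnion_of_subset_left _ h)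

lemma supp_subset_clusterRegion {W : Finset (Σ k, Fin (H k).numTerms)}
    {a : Σ k, Fin (H k).numTerms} (ha : a ∈ W) : (H a.1).supp a.2 ⊆ clusterRegion H i W :=
  (Finset.subset_biUnion_of_mem (fun a : Σ k, Fin (H k).numTerms => (H a.1).supp a.2) ha).trans
    (Finset.subset_insert _ _)

-- Terms through a common qubit overlap pairwise, so all of them are neighbours of any one of them,
-- apart from that term itself.
omit H i in
lemma LocalHamiltonian.card_filter_mem_supp_le (H : LocalHamiltonian pos R Λ 𝔡) (q : Fin n) :
    (Finset.univ.filter fun j => q ∈ H.supp j).card ≤ 𝔡 + 1 := by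
  rcases (Finset.univ.filter fun j => q ∈ H.supp j).eq_empty_or_nonempty with h | ⟨j, hj⟩
  · simp [h]
  have hj : q ∈ H.supp j := by simpa using hj
  have hsub : ((Finset.univ.filter fun j => q ∈ H.supp j : Finset _) : Set (Fin H.numTerms)) ⊆
      insert j ((overlapGraph H.supp).neighborSet j) := by
    intro k hk
    have hk : q ∈ H.supp k := by simpa using hk
    by_cases hkj : k = j
    · exact Or.inl hkj
    · exact Or.inr (overlapGraph_adj.2 ⟨Ne.symm hkj, Finset.not_disjoint_iff.2 ⟨q, hj, hk⟩⟩)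
  have h1 := Set.ncard_le_ncard hsub (Set.toFinite _)
  rw [Set.ncard_coe_finset] at h1
  exact h1.trans ((Set.ncard_insert_le _ _).trans (Nat.succ_le_succ (H.degree_le j)))

omit H i in
lemma LocalHamiltonian.card_filter_not_disjoint_le (H : LocalHamiltonian pos R Λ 𝔡)
    (Y : Finset (Fin n)) :
    (Finset.univ.filter fun j => ¬ Disjoint (H.supp j) Y).card ≤ Y.card * (𝔡 + 1) := by
  have : (Finset.univ.filter fun j => ¬ Disjoint (H.supp j) Y) ⊆
      Y.biUnion fun q => Finset.univ.filter fun j => q ∈ H.supp j := by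
    intro j hj
    obtain ⟨q, h1, h2⟩ := Finset.not_disjoint_iff.1 (Finset.mem_filter.1 hj).2
    exact Finset.mem_biUnion.2 ⟨q, h2, by simpa using h1⟩
  exact (Finset.card_le_card this).trans
    (Finset.card_biUnion_le_card_mul _ _ _ fun q _ => H.card_filter_mem_supp_le q)

/-- Sums of operators on clusters of at most `s` terms linked to `i`, of total norm at most `b`. -/
inductive ClusterSum (s : ℕ) : ℝ → QOp (Fin n) → Prop
  | single {b : ℝ} {B : QOp (Fin n)} (W : Finset (Σ k, Fin (H k).numTerms)) (card_le : W.card ≤ s)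
    (linked : IsLinkedCluster H i W) (actsOn : ActsOn (clusterRegion H i W) B)
    (norm_le : ‖B‖ ≤ b) : ClusterSum s b B
  | add {b b' : ℝ} {A B : QOp (Fin n)} (hA : ClusterSum s b A) (hB : ClusterSum s b' B) :
    ClusterSum s (b + b') (A + B)

variable {H i}

namespace ClusterSum

variable {s s' : ℕ} {b b' : ℝ} {A B : QOp (Fin n)}

lemma nonneg (h : ClusterSum H i s b A) : 0 ≤ b := by
  induction h with
  | single W _ _ _ h => exact (norm_nonneg _).trans h
  | add _ _ h1 h2 => exact add_nonneg h1 h2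

lemma mono (hs : s ≤ s') (h : ClusterSum H i s b A) : ClusterSum H i s' b A := by
  induction h with
  | single W h1 h2 h3 h4 => exact .single W (h1.trans hs) h2 h3 h4
  | add _ _ h1 h2 => exact .add h1 h2

lemma le (hb : b ≤ b') (h : ClusterSum H i s b A) : ClusterSum H i s b' A := by
  induction h generalizing b' with
  | single W h1 h2 h3 h4 => exact .single W h1 h2 h3 (h4.trans hb)
  | @add b₁ b₂ _ _ _ _ h1 h2 =>
    have := h1 (b' := b' - b₂) (by linarith)
    convert this.add (h2 le_rfl) using 1
    ring

lemma zero (hb : 0 ≤ b) : ClusterSum H i s b 0 :=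
  .single ∅ (Nat.zero_le _) (isLinkedCluster_empty H i) (actsOn_zero _) (by simpa using hb)

lemma smul (c : ℂ) (h : ClusterSum H i s b A) : ClusterSum H i s (‖c‖ * b) (c • A) := by
  induction h with
  | single W h1 h2 h3 h4 =>
    exact .single W h1 h2 (h3.smul c) (by rw [norm_smul]; gcongr)
  | add _ _ h1 h2 =>
    rw [mul_add, smul_add]
    exact h1.add h2

lemma sum {J : Type*} (t : Finset J) (β : J → ℝ) (B : J → QOp (Fin n))
    (h : ∀ j ∈ t, ClusterSum H i s (β j) (B j)) :
    ClusterSum H i s (∑ j ∈ t, β j) (∑ j ∈ t, B j) := by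
  classical
  induction t using Finset.induction_on with
  | empty => simpa using zero le_rfl
  | insert j t hj ih =>
    rw [Finset.sum_insert hj, Finset.sum_insert hj]
    exact (h j (by simp)).add (ih fun k hk => h k (by simp [hk]))

/-- A commutator with a local Hamiltonian adds one term to a cluster. -/
lemma lieBracket {k : Fin K} {c : ℂ} {δ : ℝ} (hc : ‖c‖ ≤ δ) (h : ClusterSum H i s b A) :
    ClusterSum H i (s + 1) (2 * δ * (𝔡 + 1) * (1 + Λ) * (s + 1) * b)
      (_root_.lieBracket (c • (H k).op) A) := by
  have hδ : 0 ≤ δ := (norm_nonneg c).trans hc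
  induction h with
  | @single b B W h1 h2 h3 h4 =>
    have hb : 0 ≤ b := (norm_nonneg _).trans h4
    set J := Finset.univ.filter fun j => ¬ Disjoint ((H k).supp j) (clusterRegion H i W)
    set F : Fin (H k).numTerms → QOp (Fin n) := fun j =>
      (c * (H k).coeff j) • ((H k).term j * B - B * (H k).term j) with hF
    -- Terms that miss the region commute with `B`; only overlapping ones survive in the commutator.
    have e : _root_.lieBracket (c • (H k).op) B = ∑ j ∈ J, F j := by
      have h0 : ∀ j ∈ Finset.univ, j ∉ J → F j = 0 := by
        intro j _ hj
        have hd : Disjoint ((H k).supp j) (clusterRegion H i W) := by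
          simpa [J] using hj
        simp [hF, ActsOn.commute hd ((H k).actsOn j) h3]
      rw [Finset.sum_subset (Finset.subset_univ J) h0]
      simp only [_root_.lieBracket, LocalHamiltonian.op, Finset.smul_sum, Finset.sum_mul,
        Finset.mul_sum, smul_smul, smul_mul_assoc, mul_smul_comm, ← Finset.sum_sub_distrib,
        ← smul_sub, hF]
    rw [e]
    have hj : ∀ j ∈ J, ClusterSum H i (s + 1) (2 * δ * b) (F j) := by
      intro j hj
      have hj : ¬ Disjoint ((H k).supp j) (clusterRegion H i W) := by simpa [J] using hj
      set a : Σ k, Fin (H k).numTerms := ⟨k, j⟩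
      refine .single (insert a W) ((Finset.card_insert_le _ _).trans (by omega))
        (h2.insert_term (a := a) hj) ?_ ?_
      · have ht : ActsOn (clusterRegion H i (insert a W)) ((H k).term j) :=
          ((H k).actsOn j).mono (supp_subset_clusterRegion H i (Finset.mem_insert_self a W))
        have hB := h3.mono (clusterRegion_mono (Finset.subset_insert a W))
        exact ((ht.mul hB).sub (hB.mul ht)).smul _
      · have hn := (H k).norm_le j
        have e1 : ‖(H k).term j * B - B * (H k).term j‖ ≤ 2 * b := by
          refine (norm_sub_le _ _).trans ?_
          have h5 := norm_mul_le ((H k).term j) B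
          have h6 := norm_mul_le B ((H k).term j)
          nlinarith [norm_nonneg B, norm_nonneg ((H k).term j)]
        have e2 : ‖c * ((H k).coeff j : ℂ)‖ ≤ δ := by
          rw [norm_mul, Complex.norm_real, Real.norm_eq_abs]
          calc ‖c‖ * |(H k).coeff j| ≤ δ * 1 := by
                gcongr; exact (H k).abs_coeff_le j
            _ = δ := mul_one δ
        calc ‖F j‖ = ‖c * ((H k).coeff j : ℂ)‖ * ‖(H k).term j * B - B * (H k).term j‖ :=
              norm_smul _ _
          _ ≤ δ * (2 * b) := by gcongr
          _ = 2 * δ * b := by ring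
    refine (sum J (fun _ => 2 * δ * b) F hj).le ?_
    rw [Finset.sum_const, nsmul_eq_mul]
    have hJ : (J.card : ℝ) ≤ (1 + Λ * s) * (𝔡 + 1) := by
      have := (H k).card_filter_not_disjoint_le (clusterRegion H i W)
      have h7 := card_clusterRegion_le H i W
      have h8 : J.card ≤ (1 + Λ * s) * (𝔡 + 1) :=
        this.trans (Nat.mul_le_mul_right _ (h7.trans (by gcongr)))
      exact_mod_cast h8
    -- With the bound in the form constant times `s + 1`, the factors of successive commutators
    -- multiply to a quotient of factorials.
    have h9 : (1 + Λ * s : ℝ) ≤ (1 + Λ) * (s + 1) := by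
      have : (0 : ℝ) ≤ Λ := by positivity
      have : (0 : ℝ) ≤ s := by positivity
      nlinarith
    calc (J.card : ℝ) * (2 * δ * b) ≤ ((1 + Λ) * (s + 1) * (𝔡 + 1)) * (2 * δ * b) := by
          refine mul_le_mul_of_nonneg_right (hJ.trans ?_) (by positivity)
          gcongr
      _ = _ := by ring
  | @add b₁ b₂ A₁ A₂ _ _ h1 h2 =>
    have e : _root_.lieBracket (c • (H k).op) (A₁ + A₂) =
        _root_.lieBracket (c • (H k).op) A₁ + _root_.lieBracket (c • (H k).op) A₂ := by
      simp only [_root_.lieBracket, mul_add, add_mul]; abel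
    rw [e, mul_add]
    exact h1.add h2

/-- The growth factors `s + 1, …, s + l` multiply to `(s + l)! / s!`, which is at most `2 ^ (s + l)
l!` by a binomial bound. The `l!` is there to cancel the Taylor coefficient; the price is `2 ^ s`,
exponential in the initial cluster size. -/
lemma iterate_lieBracket {k : Fin K} {c : ℂ} {δ : ℝ} (hc : ‖c‖ ≤ δ) (h : ClusterSum H i s b A)
    (l : ℕ) : ClusterSum H i (s + l)
      (b * (4 * δ * (𝔡 + 1) * (1 + Λ)) ^ l * 2 ^ s * l.factorial)
      ((_root_.lieBracket (c • (H k).op))^[l] A) := by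
  have hδ : 0 ≤ δ := (norm_nonneg c).trans hc
  have hb := h.nonneg
  have key : ClusterSum H i (s + l)
      (b * (2 * δ * (𝔡 + 1) * (1 + Λ)) ^ l * ((s + l).factorial / s.factorial))
      ((_root_.lieBracket (c • (H k).op))^[l] A) := by
    induction l with
    | zero => simpa [Nat.factorial_ne_zero] using h
    | succ l ih =>
      rw [Function.iterate_succ_apply']
      refine (ih.lieBracket hc).le (le_of_eq ?_)
      rw [← add_assoc, Nat.factorial_succ (s + l)]
      push_cast
      ring
  refine key.le ?_
  have h1 : ((s + l).factorial : ℝ) / s.factorial ≤ 2 ^ l * 2 ^ s * l.factorial := by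
    rw [div_le_iff₀ (by positivity)]
    have h2 := Nat.add_choose_mul_factorial_mul_factorial s l
    have h3 := Nat.choose_le_two_pow (s + l) l
    have h4 : ((s + l).factorial : ℝ) = (s + l).choose l * s.factorial * l.factorial := by
      exact_mod_cast h2.symm
    have h5 : ((s + l).choose l : ℝ) ≤ 2 ^ (s + l) := by exact_mod_cast h3
    rw [h4]
    calc ((s + l).choose l : ℝ) * s.factorial * l.factorial
        ≤ 2 ^ (s + l) * s.factorial * l.factorial := by gcongr
      _ = _ := by rw [pow_add]; ring
  calc b * (2 * δ * (𝔡 + 1) * (1 + Λ)) ^ l * ((s + l).factorial / s.factorial)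
      ≤ b * (2 * δ * (𝔡 + 1) * (1 + Λ)) ^ l * (2 ^ l * 2 ^ s * l.factorial) := by gcongr
    _ = b * (4 * δ * (𝔡 + 1) * (1 + Λ)) ^ l * 2 ^ s * l.factorial := by
      have : (4 * δ * (𝔡 + 1) * (1 + Λ) : ℝ) = 2 * δ * (𝔡 + 1) * (1 + Λ) * 2 := by ring
      rw [this, mul_pow _ (2 : ℝ)]
      ring

lemma norm_le (h : ClusterSum H i s b A) : ‖A‖ ≤ b := by
  induction h with
  | single W _ _ _ h => exact h
  | add _ _ h1 h2 => exact (norm_add_le _ _).trans (add_le_add h1 h2)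

/-- One short step of the evolution, truncated at order `L`. -/
lemma conjTaylor {k : Fin K} {c : ℂ} {δ x : ℝ} (hc : ‖c‖ ≤ δ)
    (hx : x = 4 * δ * (𝔡 + 1) * (1 + Λ)) (hx' : x ≤ 1 / 2)
    (hX : c • (H k).op ∈ skewAdjoint (QOp (Fin n))) (h : ClusterSum H i s b A) (L : ℕ) :
    ClusterSum H i (s + L) (b * 2 ^ (s + 1)) (_root_.conjTaylor (c • (H k).op) A L 1) ∧
    ‖NormedSpace.exp (c • (H k).op) * A * NormedSpace.exp (-(c • (H k).op)) -
      _root_.conjTaylor (c • (H k).op) A L 1‖ ≤ b * 2 ^ s * x ^ (L + 1) := by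
  have hδ : 0 ≤ δ := (norm_nonneg c).trans hc
  have hb := h.nonneg
  have hx0 : 0 ≤ x := by rw [hx]; positivity
  constructor
  · have h1 : ∀ l ∈ Finset.range (L + 1), ClusterSum H i (s + L) (b * 2 ^ s * x ^ l)
        (((1 : ℝ) ^ l / l.factorial : ℝ) • (_root_.lieBracket (c • (H k).op))^[l] A) := by
      intro l hl
      have h2 := ((h.iterate_lieBracket (k := k) hc l).mono
        (s' := s + L) (by have := Finset.mem_range.1 hl; omega)).smul
        (((1 : ℝ) ^ l / l.factorial : ℝ) : ℂ)
      rw [Complex.coe_smul] at h2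
      refine h2.le (le_of_eq ?_)
      rw [Complex.norm_real, Real.norm_of_nonneg (by positivity), ← hx]
      have : (l.factorial : ℝ) ≠ 0 := by positivity
      field_simp
      simp
    refine (sum _ _ _ h1).le ?_
    rw [← Finset.mul_sum, pow_succ, ← mul_assoc]
    gcongr
    -- A geometric series of ratio at most `1 / 2`, in a form that closes under induction.
    have h3 : ∀ L : ℕ, ∑ l ∈ Finset.range L, x ^ l ≤ 2 - 2 * x ^ L := by
      intro L
      induction L with
      | zero => simp
      | succ L ih =>
        rw [Finset.sum_range_succ, pow_succ]
        have : 0 ≤ x ^ L * (1 / 2 - x) := mul_nonneg (by positivity) (by linarith)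
        linarith
    exact (h3 _).trans (by linarith [show 0 ≤ x ^ (L + 1) by positivity])
  · refine (norm_exp_conj_sub_conjTaylor_le hX A L).trans ?_
    rw [div_le_iff₀ (by positivity)]
    refine ((h.iterate_lieBracket (k := k) hc (L + 1)).norm_le).trans (le_of_eq ?_)
    rw [← hx]
    ring

end ClusterSum

end Clusters

/-! ### Existence of learned models -/

section Approximation

/-- `A` conjugated with `e ^ X` for all `X` in a list, the head first. -/
noncomputable def conjExpList {𝔸 : Type*} [CStarAlgebra 𝔸] : List 𝔸 → 𝔸 → 𝔸
  | [], A => A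
  | X :: l, A => conjExpList l (NormedSpace.exp X * A * NormedSpace.exp (-X))

/-- Conjugation by unitaries is isometric, so the error of one truncated step is not amplified by
later steps. -/
lemma conjExpList_sub_norm {𝔸 : Type*} [CStarAlgebra 𝔸] {l : List 𝔸}
    (h : ∀ X ∈ l, X ∈ skewAdjoint 𝔸) (A B : 𝔸) :
    ‖conjExpList l A - conjExpList l B‖ = ‖A - B‖ := by
  induction l generalizing A B with
  | nil => rfl
  | cons X l ih =>
    have hX := h X (by simp)
    rw [conjExpList, conjExpList, ih fun Y hY => h Y (by simp [hY]), ← sub_mul, ← mul_sub]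
    exact norm_unitary_mul_mul (exp_mem_unitary_of_skewAdjoint hX)
      (exp_mem_unitary_of_skewAdjoint (neg_mem hX)) _

/-- The leftmost factor of `U` is innermost in `U† A U`, which is why the head of the list acts
first. -/
lemma conjExpList_eq {𝔸 : Type*} [CStarAlgebra 𝔸] {l : List 𝔸}
    (h : ∀ X ∈ l, X ∈ skewAdjoint 𝔸) (A : 𝔸) :
    conjExpList l A = star (l.map fun X => NormedSpace.exp (-X)).prod * A *
      (l.map fun X => NormedSpace.exp (-X)).prod := by
  induction l generalizing A with
  | nil => simp [conjExpList]
  | cons X l ih =>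
    rw [conjExpList, ih fun Y hY => h Y (by simp [hY])]
    have hX := star_exp_of_mem_skewAdjoint (neg_mem (h X (by simp)))
    rw [neg_neg] at hX
    simp only [List.map_cons, List.prod_cons, star_mul, hX, mul_assoc]

variable {n D K : ℕ} {pos : Fin n → Fin D → ℤ} {R Λ 𝔡 : ℕ}
  {H : Fin K → LocalHamiltonian pos R Λ 𝔡} {i : Fin n}

lemma LocalHamiltonian.op_isHermitian (H : LocalHamiltonian pos R Λ 𝔡) : H.op.IsHermitian := by
  rw [Matrix.IsHermitian, LocalHamiltonian.op, Matrix.conjTranspose_sum]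
  refine Finset.sum_congr rfl fun j _ => ?_
  rw [Matrix.conjTranspose_smul, (H.isHermitian j).eq]
  simp

lemma I_smul_mem_skewAdjoint {ι : Type} [Fintype ι] [DecidableEq ι] {A : QOp ι}
    (hA : A.IsHermitian) (c : ℝ) : (Complex.I * (c : ℂ)) • A ∈ skewAdjoint (QOp ι) := by
  rw [skewAdjoint.mem_iff, Matrix.star_eq_conjTranspose, Matrix.conjTranspose_smul, hA.eq]
  simp

/-- Here `j` counts the steps already made, and the next one is truncated at order `4 ^ j * ℓ`. The
invariant `3 * s + ℓ ≤ 4 ^ j * ℓ` sums the geometric series of earlier orders, so the cluster size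
never exceeds the current order. The weight bound on `b` then survives the factor `2 ^ (s + 1)` of
each step. Step `j` errs by at most `2 ^ j * (4 * x) ^ (ℓ + 1)`, and these errors sum to the
difference of powers of 2 in the conclusion. -/
lemma ClusterSum.exists_conjExpList_approx {δ x : ℝ} (hx : x = 4 * δ * (𝔡 + 1) * (1 + Λ))
    (hx' : 4 * x ≤ 1) (ℓ : ℕ) (l : List (QOp (Fin n)))
    (hl : ∀ X ∈ l, X ∈ skewAdjoint (QOp (Fin n)) ∧
      ∃ (k : Fin K) (c : ℂ), ‖c‖ ≤ δ ∧ X = c • (H k).op) :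
    ∀ (j s : ℕ) (b : ℝ) (A : QOp (Fin n)), ClusterSum H i s b A → 3 * s + ℓ ≤ 4 ^ j * ℓ →
      b ≤ 2 ^ (j + 4 ^ j * ℓ) → ∃ (b' : ℝ) (V : QOp (Fin n)),
        ClusterSum H i (4 ^ (j + l.length) * ℓ) b' V ∧
        ‖conjExpList l A - V‖ ≤ (2 ^ (j + l.length) - 2 ^ j) * (4 * x) ^ (ℓ + 1) := by
  induction l with
  | nil =>
    intro j s b A hA hs _
    exact ⟨b, A, hA.mono (by simp; omega), by simp [conjExpList]⟩
  | cons X l ih =>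
    intro j s b A hA hs hb
    obtain ⟨hX, k, c, hc, rfl⟩ := hl X (by simp)
    have hδ : 0 ≤ δ := (norm_nonneg c).trans hc
    have hx0 : 0 ≤ x := by rw [hx]; positivity
    have hs4 : s ≤ 4 ^ j * ℓ := by omega
    obtain ⟨h1, h2⟩ := hA.conjTaylor hc hx (by linarith) hX (4 ^ j * ℓ)
    obtain ⟨b', V, hV, hV'⟩ := ih (fun Y hY => hl Y (by simp [hY])) (j + 1) _ _ _ h1
      (by rw [pow_succ]; ring_nf; ring_nf at hs; omega)
      (by
        calc b * 2 ^ (s + 1) ≤ 2 ^ (j + 4 ^ j * ℓ) * 2 ^ (4 ^ j * ℓ + 1) := by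
              gcongr; norm_num
          _ = 2 ^ (j + 4 ^ j * ℓ + (4 ^ j * ℓ + 1)) := by rw [← pow_add]
          _ ≤ 2 ^ (j + 1 + 4 ^ (j + 1) * ℓ) := by
              refine pow_le_pow_right₀ (by norm_num) ?_
              rw [pow_succ]; ring_nf; omega)
    have e : j + (c • (H k).op :: l).length = j + 1 + l.length := by
      simp; omega
    rw [e]
    refine ⟨b', V, hV, ?_⟩
    rw [conjExpList]
    refine (norm_sub_le_norm_sub_add_norm_sub _
      (conjExpList l (_root_.conjTaylor (c • (H k).op) A (4 ^ j * ℓ) 1)) _).trans ?_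
    rw [conjExpList_sub_norm fun Y hY => (hl Y (by simp [hY])).1]
    -- The weight and the penalty `2 ^ s` each contribute at most `2 ^ (4 ^ j * ℓ)`; together they
    -- turn `x` into `4 * x`.
    have h3 : b * 2 ^ s * x ^ (4 ^ j * ℓ + 1) ≤ 2 ^ j * (4 * x) ^ (ℓ + 1) := by
      calc b * 2 ^ s * x ^ (4 ^ j * ℓ + 1)
          ≤ 2 ^ (j + 4 ^ j * ℓ) * 2 ^ (4 ^ j * ℓ) * x ^ (4 ^ j * ℓ + 1) := by
            gcongr; norm_num
        _ = 2 ^ j * ((4 * x) ^ (4 ^ j * ℓ) * x) := by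
            rw [pow_add, pow_succ x, mul_pow, show (4 : ℝ) = 2 * 2 by norm_num, mul_pow (2 : ℝ)]
            ring
        _ ≤ 2 ^ j * ((4 * x) ^ ℓ * (4 * x)) := by
            gcongr 2 ^ j * (?_ * ?_)
            · exact pow_le_pow_of_le_one (by positivity) hx'
                (Nat.le_mul_of_pos_left _ (by positivity))
            · linarith
        _ = _ := by rw [pow_succ (4 * x)]
    calc _ ≤ 2 ^ j * (4 * x) ^ (ℓ + 1) +
          (2 ^ (j + 1 + l.length) - 2 ^ (j + 1)) * (4 * x) ^ (ℓ + 1) :=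
          add_le_add (h2.trans h3) hV'
      _ = _ := by ring

/-- The exponents of `N` equal short steps for each of the factors of the evolution. -/
noncomputable def stepExponents (H : Fin K → LocalHamiltonian pos R Λ 𝔡) (t : Fin K → ℝ) (N : ℕ) :
    List (QOp (Fin n)) :=
  (List.finRange K).flatMap fun k =>
    List.replicate N ((Complex.I * ((t k / N : ℝ) : ℂ)) • (H k).op)

lemma length_stepExponents (t : Fin K → ℝ) (N : ℕ) : (stepExponents H t N).length = K * N := by
  simp [stepExponents, List.length_flatMap]

lemma mem_stepExponents {t : Fin K → ℝ} {N : ℕ} {δ : ℝ} (hδ : ∀ k, |t k| / N ≤ δ)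
    {X : QOp (Fin n)} (hX : X ∈ stepExponents H t N) : X ∈ skewAdjoint (QOp (Fin n)) ∧
      ∃ (k : Fin K) (c : ℂ), ‖c‖ ≤ δ ∧ X = c • (H k).op := by
  obtain ⟨k, _, hk⟩ := List.mem_flatMap.1 hX
  rw [List.eq_of_mem_replicate hk]
  refine ⟨I_smul_mem_skewAdjoint (H k).op_isHermitian _, k, _, ?_, rfl⟩
  rw [norm_mul, Complex.norm_I, one_mul, Complex.norm_real, Real.norm_eq_abs, abs_div, Nat.abs_cast]
  exact hδ k

lemma evolution_eq_stepExponents (t : Fin K → ℝ) {N : ℕ} (hN : 0 < N) :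
    evolution H t = ((stepExponents H t N).map fun X => NormedSpace.exp (-X)).prod := by
  let _ : NormedAlgebra ℚ (QOp (Fin n)) := NormedAlgebra.restrictScalars ℚ ℂ _
  rw [evolution, stepExponents, List.map_flatMap, List.flatMap_def, List.prod_flatten,
    List.map_map, List.ofFn_eq_map]
  congr 1
  refine List.map_congr_left fun k _ => ?_
  simp only [Function.comp, List.map_replicate, List.prod_replicate]
  rw [← NormedSpace.exp_nsmul, ← Nat.cast_smul_eq_nsmul ℂ, ← neg_smul, smul_smul]
  congr 2
  have : (N : ℂ) ≠ 0 := by exact_mod_cast hN.ne'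
  push_cast
  field_simp

lemma heisenberg_eq_conjExpList (t : Fin K → ℝ) {N : ℕ} (hN : 0 < N) (A : QOp (Fin n)) :
    heisenberg H t A = conjExpList (stepExponents H t N) A := by
  rw [conjExpList_eq fun X hX => (mem_stepExponents (δ := ∑ k, |t k| / N)
    (fun k => Finset.single_le_sum (f := fun k => |t k| / N) (fun k _ => by positivity)
      (Finset.mem_univ k)) hX).1, ← evolution_eq_stepExponents t hN]
  rfl

lemma pauliAt_isHermitian (i : Fin n) (a : Fin 4) : (pauliAt i a).IsHermitian :=
  pauliString_isHermitian _

lemma pauliSupport_single (i : Fin n) (a : Fin 4) :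
    pauliSupport (Pi.single i a : Fin n → Fin 4) ⊆ {i} := by
  intro q hq
  by_contra h
  rw [Finset.mem_singleton] at h
  simp [pauliSupport, h] at hq

lemma clusterSum_pauliAt (i : Fin n) (a : Fin 4) : ClusterSum H i 0 1 (pauliAt i a) := by
  refine .single ∅ (by simp) (isLinkedCluster_empty H i) (actsOn_pauliString ?_)
    (norm_pauliString _).le
  simpa [clusterRegion] using pauliSupport_single i a

/-- Approximation of the evolved Pauli matrices by sums over small linked clusters. -/
lemma exists_clusterSum_heisenberg (t : Fin K → ℝ) {N : ℕ} (hN : 0 < N) {δ x : ℝ}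
    (hδ : ∀ k, |t k| / N ≤ δ) (hx : x = 4 * δ * (𝔡 + 1) * (1 + Λ)) (hx0 : 0 ≤ x)
    (hx' : 4 * x ≤ 1) (i : Fin n) (a : Fin 4) (ℓ : ℕ) :
    ∃ (b : ℝ) (V : QOp (Fin n)), ClusterSum H i (4 ^ (K * N) * ℓ) b V ∧
      ‖heisenberg H t (pauliAt i a) - V‖ ≤ 2 ^ (K * N) * (4 * x) ^ (ℓ + 1) := by
  obtain ⟨b, V, hV, hV'⟩ := ClusterSum.exists_conjExpList_approx (H := H) (i := i) hx hx' ℓ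
    (stepExponents H t N) (fun X hX => mem_stepExponents hδ hX) 0 0 1 _
    (clusterSum_pauliAt i a) (by simp) (by simpa using one_le_pow₀ one_le_two)
  rw [length_stepExponents, zero_add] at hV hV'
  refine ⟨b, V, hV, ?_⟩
  rw [heisenberg_eq_conjExpList t hN]
  refine hV'.trans ?_
  gcongr
  linarith

/-- A cap on the total number of terms of a cluster is stronger than the same cap for each
Hamiltonian. -/
lemma ClusterSum.mem_span {s m : ℕ} (hs : s ≤ m) {b : ℝ} {A : QOp (Fin n)}
    (h : ClusterSum H i s b A) :
    A ∈ Submodule.span ℂ (pauliString '' (linkedPaulis H i m : Set (Fin n → Fin 4))) := by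
  induction h with
  | single W h1 h2 h3 _ =>
    refine Submodule.span_mono (Set.image_mono fun P hP => ?_) (actsOn_iff_mem_pauliSpan.1 h3)
    simp only [Finset.mem_coe, linkedPaulis, Finset.mem_filter]
    exact ⟨Finset.mem_univ _, W, fun k => (Finset.card_filter_le _ _).trans (h1.trans hs), h2, hP⟩
  | add _ _ h1 h2 => exact add_mem h1 h2

/-- Passing to the Hermitian part of `V` does not increase its distance to a Hermitian `A`, and on
Pauli coefficients it amounts to taking real parts. -/
lemma ClusterSum.exists_real_coeff {m : ℕ} {b : ℝ} {V A : QOp (Fin n)} (hA : A.IsHermitian)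
    (h : ClusterSum H i m b V) : ∃ α : (Fin n → Fin 4) → ℝ,
      ‖∑ Q ∈ linkedPaulis H i m, (α Q : ℂ) • pauliString Q - A‖ ≤ ‖A - V‖ := by
  have hV := h.mem_span le_rfl
  obtain ⟨c, hc⟩ := (Submodule.mem_span_image_finset_iff_exists_fun' ℂ).1 hV
  refine ⟨fun Q => (c Q).re, ?_⟩
  have e : ∑ Q ∈ linkedPaulis H i m, ((c Q).re : ℂ) • pauliString Q =
      (1 / 2 : ℂ) • (V + V.conjTranspose) := by
    rw [← hc, Matrix.conjTranspose_sum, ← Finset.sum_add_distrib, Finset.smul_sum]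
    refine Finset.sum_congr rfl fun Q _ => ?_
    rw [Matrix.conjTranspose_smul, (pauliString_isHermitian Q).eq, ← add_smul, smul_smul,
      Complex.re_eq_add_conj]
    congr 1
    simp only [RCLike.star_def]
    ring
  rw [e]
  have e2 : (1 / 2 : ℂ) • (V + V.conjTranspose) - A =
      (1 / 2 : ℂ) • ((V - A) + (V - A).conjTranspose) := by
    rw [Matrix.conjTranspose_sub, hA.eq]
    have : A = (1 / 2 : ℂ) • (A + A) := by
      rw [← two_smul ℂ A, smul_smul]; norm_num
    nth_rw 1 [this]
    rw [← smul_sub]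
    congr 1
    abel
  rw [e2, norm_smul, norm_sub_rev A V]
  have h1 := norm_add_le (V - A) (V - A).conjTranspose
  rw [Matrix.l2_opNorm_conjTranspose] at h1
  rw [show ‖(1 / 2 : ℂ)‖ = 1 / 2 by norm_num]
  linarith

lemma exists_isLearnedModel (t : Fin K → ℝ) {N : ℕ} (hN : 0 < N) {δ x : ℝ}
    (hδ : ∀ k, |t k| / N ≤ δ) (hx : x = 4 * δ * (𝔡 + 1) * (1 + Λ)) (hx0 : 0 ≤ x)
    (hx' : 4 * x ≤ 1) {ℓ m : ℕ} (hm : 4 ^ (K * N) * ℓ ≤ m) :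
    ∃ α : PauliModel n, IsLearnedModel H t m (2 ^ (K * N) * (4 * x) ^ (ℓ + 1)) α := by
  have : ∀ (i : Fin n) (a : Fin 4), ∃ α : (Fin n → Fin 4) → ℝ,
      ‖∑ Q ∈ linkedPaulis H i m, (α Q : ℂ) • pauliString Q - heisenberg H t (pauliAt i a)‖ ≤
        2 ^ (K * N) * (4 * x) ^ (ℓ + 1) := by
    intro i a
    obtain ⟨b, V, hV, hV'⟩ := exists_clusterSum_heisenberg (H := H) t hN hδ hx hx0 hx' i a ℓ
    have hH : (heisenberg H t (pauliAt i a)).IsHermitian :=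
      Matrix.isHermitian_conjTranspose_mul_mul _ (pauliAt_isHermitian i a)
    obtain ⟨α, hα⟩ := (hV.mono hm).exists_real_coeff hH
    exact ⟨α, hα.trans hV'⟩
  choose α hα using this
  refine ⟨α, fun i a ha => ?_⟩
  rw [modelOp, if_neg ha]
  exact hα i a

end Approximation

/-! ### Tensor products of registers -/

section Registers

open scoped Kronecker

variable {α β γ : Type} [Fintype α] [DecidableEq α] [Fintype β] [DecidableEq β]
  [Fintype γ] [DecidableEq γ]

lemma opTensor_eq_kronecker (A : QOp α) (B : QOp β) : opTensor A B =
    (A ⊗ₖ B).submatrix (Equiv.sumArrowEquivProdArrow α β (Fin 2))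
      (Equiv.sumArrowEquivProdArrow α β (Fin 2)) := rfl

lemma opTensor_mul (A C : QOp α) (B E : QOp β) :
    opTensor A B * opTensor C E = opTensor (A * C) (B * E) := by
  rw [opTensor_eq_kronecker, opTensor_eq_kronecker, opTensor_eq_kronecker,
    Matrix.submatrix_mul_equiv, Matrix.mul_kronecker_mul]

lemma opTensor_one : opTensor (1 : QOp α) (1 : QOp β) = 1 := by
  rw [opTensor_eq_kronecker, Matrix.one_kronecker_one, Matrix.submatrix_one_equiv]

lemma opTensor_conjTranspose (A : QOp α) (B : QOp β) :
    (opTensor A B).conjTranspose = opTensor A.conjTranspose B.conjTranspose := by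
  ext x y
  simp [opTensor, Matrix.conjTranspose_apply]

lemma trace_opTensor (A : QOp α) (B : QOp β) : (opTensor A B).trace = A.trace * B.trace := by
  rw [← Matrix.trace_kronecker, opTensor_eq_kronecker]
  exact Equiv.sum_comp (Equiv.sumArrowEquivProdArrow α β (Fin 2))
    (fun x => (A ⊗ₖ B) x x)

lemma opTensor_add_left (A B : QOp α) (C : QOp β) :
    opTensor (A + B) C = opTensor A C + opTensor B C := by
  ext x y; simp [opTensor, add_mul]

lemma opTensor_sub_left (A B : QOp α) (C : QOp β) :
    opTensor (A - B) C = opTensor A C - opTensor B C := by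
  ext x y; simp [opTensor, sub_mul]

lemma opTensor_smul_left (c : ℂ) (A : QOp α) (C : QOp β) :
    opTensor (c • A) C = c • opTensor A C := by
  ext x y; simp [opTensor, mul_assoc]

lemma opTensor_smul_right (c : ℂ) (A : QOp α) (C : QOp β) :
    opTensor A (c • C) = c • opTensor A C := by
  ext x y; simp [opTensor]; ring

lemma opTensor_sum_left {J : Type*} (s : Finset J) (A : J → QOp α) (C : QOp β) :
    opTensor (∑ j ∈ s, A j) C = ∑ j ∈ s, opTensor (A j) C := by
  ext x y; simp [opTensor, Matrix.sum_apply, Finset.sum_mul]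

lemma opTensor_pauliString (P : α → Fin 4) (Q : β → Fin 4) :
    opTensor (pauliString P) (pauliString Q) = pauliString (Sum.elim P Q) := by
  ext x y
  simp [opTensor, pauliString]

/-- `A ↦ A ⊗ I`. -/
noncomputable def tensorOneHom (α β : Type) [Fintype α] [DecidableEq α] [Fintype β]
    [DecidableEq β] : QOp α →⋆ₐ[ℂ] QOp (α ⊕ β) where
  toFun A := opTensor A 1
  map_one' := opTensor_one
  map_mul' A B := by rw [opTensor_mul, one_mul]
  map_zero' := by ext x y; simp [opTensor]
  map_add' A B := opTensor_add_left A B 1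
  commutes' c := by
    rw [Algebra.algebraMap_eq_smul_one, Algebra.algebraMap_eq_smul_one, opTensor_smul_left,
      opTensor_one]
  map_star' A := by
    rw [Matrix.star_eq_conjTranspose, Matrix.star_eq_conjTranspose, opTensor_conjTranspose,
      Matrix.conjTranspose_one]

/-- Star homomorphisms of C⋆-algebras are contractive. This is what the bundled homomorphisms of
this section provide. -/
lemma norm_opTensor_one_le (A : QOp α) : ‖opTensor A (1 : QOp β)‖ ≤ ‖A‖ :=
  NonUnitalStarAlgHom.norm_apply_le (tensorOneHom α β) A

/-- Renaming the qubits of a register. -/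
def relabelHom (e : α ≃ β) : QOp α →⋆ₐ[ℂ] QOp β where
  toFun A := A.submatrix (Equiv.arrowCongr e.symm (Equiv.refl (Fin 2)))
    (Equiv.arrowCongr e.symm (Equiv.refl (Fin 2)))
  map_one' := Matrix.submatrix_one_equiv _
  map_mul' A B := (Matrix.submatrix_mul_equiv A B _ _ _).symm
  map_zero' := rfl
  map_add' A B := rfl
  commutes' c := by
    rw [Algebra.algebraMap_eq_smul_one, Algebra.algebraMap_eq_smul_one]
    change c • Matrix.submatrix (1 : QOp α) _ _ = _
    rw [Matrix.submatrix_one_equiv]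
  map_star' A := rfl

lemma relabelHom_apply (e : α ≃ β) (A : QOp α) (x y : β → Fin 2) :
    relabelHom e A x y = A (x ∘ e) (y ∘ e) := rfl

lemma trace_relabelHom (e : α ≃ β) (A : QOp α) : (relabelHom e A).trace = A.trace :=
  Equiv.sum_comp (Equiv.arrowCongr e.symm (Equiv.refl (Fin 2))) (fun x => A x x)

lemma posSemidef_relabelHom (e : α ≃ β) {A : QOp α} (hA : A.PosSemidef) :
    (relabelHom e A).PosSemidef := hA.submatrix _

lemma posSemidef_opTensor_one {A : QOp α} (hA : A.PosSemidef) :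
    (opTensor A (1 : QOp β)).PosSemidef := by
  rw [opTensor_eq_kronecker]
  exact (hA.kronecker Matrix.PosSemidef.one).submatrix _

/-- Matrix units of the joint register are products of matrix units, so additive statements need
only be checked on product operators. -/
lemma opTensor_induction {p : QOp (α ⊕ β) → Prop} (h : ∀ A B, p (opTensor A B))
    (hadd : ∀ A B, p A → p B → p (A + B)) (A : QOp (α ⊕ β)) : p A := by
  refine Matrix.induction_on' A ?_ hadd fun x y c => ?_
  · convert h 0 0
    ext x y; simp [opTensor]
  · convert h (Matrix.single (x ∘ Sum.inl) (y ∘ Sum.inl) c)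
      (Matrix.single (x ∘ Sum.inr) (y ∘ Sum.inr) 1)
    ext u v
    simp only [opTensor, Matrix.of_apply, Matrix.single_apply]
    have : ∀ f g : α ⊕ β → Fin 2, f = g ↔ f ∘ Sum.inl = g ∘ Sum.inl ∧ f ∘ Sum.inr = g ∘ Sum.inr :=
      fun f g => by
        constructor
        · rintro rfl; exact ⟨rfl, rfl⟩
        · rintro ⟨h1, h2⟩
          funext q
          rcases q with q | q
          · exact congrFun h1 q
          · exact congrFun h2 q
    simp only [this x u, this y v]
    split_ifs <;> simp_all

/-- Insert a third register on which `A` acts as the identity. -/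
noncomputable def insertHom (α β γ : Type) [Fintype α] [DecidableEq α] [Fintype β]
    [DecidableEq β] [Fintype γ] [DecidableEq γ] : QOp (α ⊕ γ) →⋆ₐ[ℂ] QOp ((α ⊕ β) ⊕ γ) :=
  (relabelHom (((Equiv.sumAssoc α γ β).trans ((Equiv.refl α).sumCongr (Equiv.sumComm γ β))).trans
    (Equiv.sumAssoc α β γ).symm)).comp (tensorOneHom (α ⊕ γ) β)

lemma insertHom_opTensor (A : QOp α) (C : QOp γ) :
    insertHom α β γ (opTensor A C) = opTensor (opTensor A 1) C := by
  ext x y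
  simp only [insertHom, StarAlgHom.comp_apply, relabelHom_apply]
  change A _ _ * C _ _ * (1 : QOp β) _ _ = A _ _ * (1 : QOp β) _ _ * C _ _
  rw [mul_right_comm]
  rfl

lemma trace_insertHom (A : QOp (α ⊕ γ)) :
    (insertHom α β γ A).trace = A.trace * 2 ^ Fintype.card β := by
  rw [insertHom, StarAlgHom.comp_apply, trace_relabelHom]
  change (opTensor A 1).trace = _
  rw [trace_opTensor, Matrix.trace_one]
  simp

lemma posSemidef_insertHom {A : QOp (α ⊕ γ)} (hA : A.PosSemidef) :
    (insertHom α β γ A).PosSemidef :=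
  posSemidef_relabelHom _ (posSemidef_opTensor_one hA)

lemma partialTrace_opTensor (A : QOp α) (B : QOp β) :
    partialTrace (opTensor A B) = B.trace • A := by
  ext x y
  simp only [partialTrace, LinearMap.coe_mk, AddHom.coe_mk, Matrix.of_apply, opTensor,
    Matrix.smul_apply, Matrix.trace, Matrix.diag, smul_eq_mul, Finset.sum_mul]
  refine Finset.sum_congr rfl fun z _ => ?_
  simp [mul_comm]

lemma trace_mul_partialTrace (Y : QOp α) (Z : QOp (α ⊕ β)) :
    (Y * partialTrace Z).trace = (opTensor Y (1 : QOp β) * Z).trace := by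
  induction Z using opTensor_induction with
  | h A B =>
    rw [partialTrace_opTensor, opTensor_mul, trace_opTensor, one_mul, mul_smul_comm, Matrix.trace_smul,
      smul_eq_mul, mul_comm]
  | hadd A B hA hB => simp only [map_add, mul_add, Matrix.trace_add, hA, hB]

lemma extendMap_add (Φ : QOp α →ₗ[ℂ] QOp α) (ρ σ : QOp (α ⊕ β)) :
    extendMap Φ (ρ + σ) = extendMap Φ ρ + extendMap Φ σ := by
  ext x y
  simp only [extendMap, Matrix.of_apply, Matrix.add_apply]
  rw [← Matrix.add_apply, ← map_add]
  rfl

lemma extendMap_opTensor (Φ : QOp α →ₗ[ℂ] QOp α) (A : QOp α) (C : QOp β) :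
    extendMap Φ (opTensor A C) = opTensor (Φ A) C := by
  ext x y
  have : (Matrix.of fun u v => opTensor A C (Sum.elim u (x ∘ Sum.inr)) (Sum.elim v (y ∘ Sum.inr)))
      = C (x ∘ Sum.inr) (y ∘ Sum.inr) • A := by
    ext u v
    simp [opTensor, mul_comm]
  rw [extendMap, Matrix.of_apply, this, map_smul, opTensor, Matrix.of_apply, Matrix.smul_apply,
    smul_eq_mul, mul_comm]

/-- The dual form of the extended channel: the partial trace becomes an identity factor in the
observable, and the ancilla a mixed factor in the state, inside one trace over three registers. -/
lemma trace_mul_extendMap_reducedChannel {n : ℕ} (W : QOp (Fin n ⊕ Fin n))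
    (Y ρ : QOp (Fin n ⊕ Fin n)) :
    (Y * extendMap (reducedChannel W) ρ).trace = (insertHom (Fin n) (Fin n) (Fin n) Y *
      (opTensor W (1 : QOp (Fin n)) * (((2 : ℂ) ^ n)⁻¹ • insertHom (Fin n) (Fin n) (Fin n) ρ) *
        (opTensor W (1 : QOp (Fin n))).conjTranspose)).trace := by
  induction Y using opTensor_induction with
  | hadd A B hA hB => simp only [map_add, add_mul, Matrix.trace_add, hA, hB]
  | h Y₁ Y₂ =>
    induction ρ using opTensor_induction with
    | hadd A B hA hB =>
      simp only [map_add, mul_add, smul_add, add_mul, Matrix.trace_add, hA, hB, extendMap_add]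
    | h A C =>
      rw [extendMap_opTensor, opTensor_mul, trace_opTensor, reducedChannel, LinearMap.comp_apply,
        trace_mul_partialTrace, insertHom_opTensor, insertHom_opTensor, opTensor_conjTranspose,
        Matrix.conjTranspose_one, ← opTensor_smul_left, opTensor_mul, opTensor_mul, opTensor_mul,
        trace_opTensor, one_mul, mul_one]
      congr 3
      simp only [conjChannel, addMixed, LinearMap.comp_apply, LinearMap.mulLeft_apply,
        LinearMap.mulRight_apply, LinearMap.coe_mk, AddHom.coe_mk, opTensor_smul_right,
        Fintype.card_fin, mul_assoc]

/-! ### Trace norm and diamond distance -/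

/-- In an eigenbasis of `ρ` the trace is a sum of diagonal entries of a unitary conjugate of `A`,
weighted by the nonnegative eigenvalues. -/
lemma norm_trace_mul_le {ρ : QOp α} (hρ : ρ.PosSemidef) (A : QOp α) :
    ‖(A * ρ).trace‖ ≤ ‖A‖ * ρ.trace.re := by
  have hh := hρ.isHermitian
  set V : QOp α := hh.eigenvectorUnitary.1 with hV
  have hVu : V ∈ unitary (QOp α) := hh.eigenvectorUnitary.2
  have hs : ρ = V * Matrix.diagonal (fun x => (hh.eigenvalues x : ℂ)) * V.conjTranspose := by
    conv_lhs => rw [hh.spectral_theorem]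
    rfl
  have h1 : (A * ρ).trace = ∑ x, (V.conjTranspose * A * V) x x * (hh.eigenvalues x : ℂ) := by
    have : (A * ρ).trace = (V.conjTranspose * A * V *
        Matrix.diagonal (fun x => (hh.eigenvalues x : ℂ))).trace := by
      conv_lhs => rw [hs]
      rw [← mul_assoc, Matrix.trace_mul_comm]
      simp only [mul_assoc]
    rw [this]
    simp [Matrix.trace]
  have h2 : ρ.trace.re = ∑ x, hh.eigenvalues x := by
    rw [hh.trace_eq_sum_eigenvalues]
    simp
  rw [h1, h2, Finset.mul_sum]
  refine (norm_sum_le _ _).trans (Finset.sum_le_sum fun x _ => ?_)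
  have h3 := hρ.eigenvalues_nonneg x
  rw [norm_mul, Complex.norm_real, Real.norm_of_nonneg h3]
  gcongr
  refine (norm_entry_le _ _ _).trans (le_of_eq ?_)
  exact norm_unitary_mul_mul (Unitary.star_mem hVu) hVu A

/-- Duality of trace norm and operator norm. The witness is the adjoint of the polar part of `X`,
namely the pseudo-inverse of `|X|` times `X†`. -/
lemma exists_traceNorm_eq (X : QOp α) :
    ∃ Y : QOp α, ‖Y‖ ≤ 1 ∧ (traceNorm X : ℂ) = (Y * X).trace := by
  have hh := Matrix.isHermitian_conjTranspose_mul_self X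
  have hp := Matrix.posSemidef_conjTranspose_mul_self X
  set V : QOp α := hh.eigenvectorUnitary.1 with hV
  have hVu : V ∈ unitary (QOp α) := hh.eigenvectorUnitary.2
  have hVV : V.conjTranspose * V = 1 := (Unitary.mem_iff.1 hVu).1
  have hs : X.conjTranspose * X =
      V * Matrix.diagonal (fun x => (hh.eigenvalues x : ℂ)) * V.conjTranspose := by
    conv_lhs => rw [hh.spectral_theorem]
    rfl
  set D := Matrix.diagonal (fun x => (hh.eigenvalues x : ℂ)) with hD
  -- As the inverse of 0 is 0, this is the pseudo-inverse of `|X|` in the eigenbasis and singular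
  -- `X` need no separate treatment.
  set F : QOp α := Matrix.diagonal (fun x => (((√(hh.eigenvalues x))⁻¹ : ℝ) : ℂ)) with hF
  have hFs : F.conjTranspose = F := by
    rw [hF, Matrix.diagonal_conjTranspose]
    congr 1
    funext x
    simp
  have hev : ∀ x, 0 ≤ hh.eigenvalues x := hp.eigenvalues_nonneg
  refine ⟨V * F * V.conjTranspose * X.conjTranspose, ?_, ?_⟩
  · have h1 : ‖V * F * V.conjTranspose * X.conjTranspose‖ ^ 2 ≤ 1 := by
      rw [sq, ← CStarRing.norm_self_mul_star, Matrix.star_eq_conjTranspose]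
      have e : V * F * V.conjTranspose * X.conjTranspose *
          (V * F * V.conjTranspose * X.conjTranspose).conjTranspose =
          V * (F * D * F) * V.conjTranspose := by
        simp only [Matrix.conjTranspose_mul, Matrix.conjTranspose_conjTranspose, hFs]
        calc _ = V * F * V.conjTranspose * (X.conjTranspose * X) * (V * F * V.conjTranspose) := by
              simp only [mul_assoc]
          _ = V * F * (V.conjTranspose * V) * D * (V.conjTranspose * V) * F * V.conjTranspose := by
              rw [hs]; simp only [mul_assoc]
          _ = _ := by rw [hVV]; simp only [mul_one, mul_assoc]
      rw [e, ← Matrix.star_eq_conjTranspose, norm_unitary_mul_mul hVu (Unitary.star_mem hVu), hF, hD, Matrix.diagonal_mul_diagonal,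
        Matrix.diagonal_mul_diagonal, Matrix.l2_opNorm_diagonal]
      refine (pi_norm_le_iff_of_nonneg zero_le_one).2 fun x => ?_
      rw [← Complex.ofReal_mul, ← Complex.ofReal_mul, Complex.norm_real]
      rcases (hev x).eq_or_lt with h0 | h0
      · simp [← h0]
      · have h5 : √(hh.eigenvalues x) ≠ 0 := by positivity
        have : (√(hh.eigenvalues x))⁻¹ * hh.eigenvalues x * (√(hh.eigenvalues x))⁻¹ = 1 := by
          nth_rw 2 [← Real.mul_self_sqrt (hev x)]
          field_simp
        rw [this]
        simp
    nlinarith [norm_nonneg (V * F * V.conjTranspose * X.conjTranspose)]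
  · have e : V * F * V.conjTranspose * X.conjTranspose * X = V * (F * D) * V.conjTranspose := by
      calc _ = V * F * V.conjTranspose * (X.conjTranspose * X) := by simp only [mul_assoc]
        _ = V * F * (V.conjTranspose * V) * D * V.conjTranspose := by
            rw [hs]; simp only [mul_assoc]
        _ = _ := by rw [hVV]; simp only [mul_one, mul_assoc]
    rw [e, Matrix.trace_mul_comm, ← mul_assoc, hVV, one_mul, hF, hD, Matrix.diagonal_mul_diagonal,
      Matrix.trace_diagonal, traceNorm]
    push_cast
    refine Finset.sum_congr rfl fun x _ => ?_
    rw [← Complex.ofReal_inv, ← Complex.ofReal_mul]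
    congr 1
    rcases (hev x).eq_or_lt with h0 | h0
    · simp [← h0]
    · have h5 : √(hh.eigenvalues x) ≠ 0 := by positivity
      rw [eq_inv_mul_iff_mul_eq₀ h5, Real.mul_self_sqrt (hev x)]

lemma trace_mul_conj (E w σ : QOp α) :
    (E * (w * σ * w.conjTranspose)).trace = (w.conjTranspose * E * w * σ).trace := by
  rw [← mul_assoc, Matrix.trace_mul_comm]
  simp only [mul_assoc]

lemma norm_conj_sub_conj_le {E w w₀ : QOp α} {δ : ℝ} (hE : ‖E‖ ≤ 1) (hw : ‖w‖ ≤ 1)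
    (hw₀ : ‖w₀‖ ≤ 1) (h : ‖w - w₀‖ ≤ δ) :
    ‖w.conjTranspose * E * w - w₀.conjTranspose * E * w₀‖ ≤ 2 * δ := by
  have e : w.conjTranspose * E * w - w₀.conjTranspose * E * w₀ =
      w.conjTranspose * E * (w - w₀) + (w - w₀).conjTranspose * E * w₀ := by
    rw [Matrix.conjTranspose_sub]; noncomm_ring
  rw [e]
  have hw' : ‖w.conjTranspose‖ ≤ 1 := by rwa [Matrix.l2_opNorm_conjTranspose]
  have h' : ‖(w - w₀).conjTranspose‖ ≤ δ := by rwa [Matrix.l2_opNorm_conjTranspose]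
  have hδ : 0 ≤ δ := (norm_nonneg _).trans h
  have b1 : ‖w.conjTranspose * E * (w - w₀)‖ ≤ 1 * 1 * δ :=
    norm_mul_le_of_le (norm_mul_le_of_le hw' hE) h
  have b2 : ‖(w - w₀).conjTranspose * E * w₀‖ ≤ δ * 1 * 1 :=
    norm_mul_le_of_le (norm_mul_le_of_le h' hE) hw₀
  exact (norm_add_le _ _).trans (by linarith)

/-- A contraction that attains the trace norm serves as an observable. In the Heisenberg picture the
two channels differ by `w† E w - w₀† E w₀`, of norm at most twice the distance of the operators,
evaluated in a state of the three registers. -/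
lemma diamondDist_reducedChannel_le {n : ℕ} {W W₀ : QOp (Fin n ⊕ Fin n)} (hW : ‖W‖ ≤ 1)
    (hW₀ : ‖W₀‖ ≤ 1) : diamondDist (reducedChannel W) (reducedChannel W₀) ≤
      ENNReal.ofReal (2 * ‖W - W₀‖) := by
  refine iSup₂_le fun ρ hρ => ENNReal.ofReal_le_ofReal ?_
  obtain ⟨Y, hY, hYt⟩ := exists_traceNorm_eq
    (extendMap (reducedChannel W) ρ - extendMap (reducedChannel W₀) ρ)
  set E := insertHom (Fin n) (Fin n) (Fin n) Y
  set σ := ((2 : ℂ) ^ n)⁻¹ • insertHom (Fin n) (Fin n) (Fin n) ρ with hσ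
  set w := opTensor W (1 : QOp (Fin n)) with hw
  set w₀ := opTensor W₀ (1 : QOp (Fin n)) with hw₀
  have hE : ‖E‖ ≤ 1 := (NonUnitalStarAlgHom.norm_apply_le _ _).trans hY
  have h1 : ‖w‖ ≤ 1 := (norm_opTensor_one_le W).trans hW
  have h2 : ‖w₀‖ ≤ 1 := (norm_opTensor_one_le W₀).trans hW₀
  have h3 : ‖w - w₀‖ ≤ ‖W - W₀‖ := by
    rw [hw, hw₀, ← opTensor_sub_left]
    exact norm_opTensor_one_le _
  have hσp : σ.PosSemidef := (posSemidef_insertHom hρ.1).smul (by positivity)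
  have hσt : σ.trace = 1 := by
    rw [hσ, Matrix.trace_smul, trace_insertHom, hρ.2, Fintype.card_fin, one_mul, smul_eq_mul]
    exact inv_mul_cancel₀ (by positivity)
  have e : (traceNorm (extendMap (reducedChannel W) ρ - extendMap (reducedChannel W₀) ρ) : ℂ) =
      ((w.conjTranspose * E * w - w₀.conjTranspose * E * w₀) * σ).trace := by
    rw [hYt, mul_sub, Matrix.trace_sub, trace_mul_extendMap_reducedChannel,
      trace_mul_extendMap_reducedChannel, sub_mul, Matrix.trace_sub, trace_mul_conj,
      trace_mul_conj]
  have h4 := norm_trace_mul_le hσp (w.conjTranspose * E * w - w₀.conjTranspose * E * w₀)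
  rw [← e, hσt, Complex.norm_real, Complex.one_re, mul_one] at h4
  refine (le_abs_self _).trans (h4.trans ?_)
  exact norm_conj_sub_conj_le hE h1 h2 h3

end Registers

/-! ### Permutations of qubits -/

section Sewing

variable {ι : Type} [Fintype ι] [DecidableEq ι]

/-- The operator that permutes the qubits by `σ`. -/
def permOp (σ : Equiv.Perm ι) : QOp ι :=
  Matrix.of fun x y => if x ∘ σ = y then 1 else 0

lemma permOp_mul_apply (σ : Equiv.Perm ι) (A : QOp ι) (x y : ι → Fin 2) :
    (permOp σ * A) x y = A (x ∘ σ) y := by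
  simp [permOp, Matrix.mul_apply]

lemma permOp_mul (σ τ : Equiv.Perm ι) : permOp σ * permOp τ = permOp (σ * τ) := by
  ext x y
  rw [permOp_mul_apply]
  rfl

lemma permOp_one : permOp (1 : Equiv.Perm ι) = 1 := by
  ext x y
  simp [permOp, Matrix.one_apply]

lemma permOp_list_prod {J : Type*} (l : List J) (σ : J → Equiv.Perm ι) :
    (l.map fun j => permOp (σ j)).prod = permOp (l.map σ).prod := by
  induction l with
  | nil => simp [permOp_one]
  | cons j l ih => simp [ih, permOp_mul]

lemma permOp_conjTranspose (σ : Equiv.Perm ι) : (permOp σ).conjTranspose = permOp σ⁻¹ := by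
  ext x y
  have : y ∘ σ = x ↔ x ∘ (σ⁻¹ : Equiv.Perm ι) = y := by
    constructor
    · rintro rfl; funext q; simp
    · rintro rfl; funext q; simp
  simp only [permOp, Matrix.conjTranspose_apply, Matrix.of_apply, this]
  split_ifs <;> simp

lemma permOp_mem_unitary (σ : Equiv.Perm ι) : permOp σ ∈ unitary (QOp ι) := by
  rw [Unitary.mem_iff, Matrix.star_eq_conjTranspose, permOp_conjTranspose, permOp_mul, permOp_mul]
  simp [permOp_one]

/-- The exchange of qubit `i` of the first register with qubit `i` of the second. -/
def qubitSwap {n : ℕ} (i : Fin n) : Equiv.Perm (Fin n ⊕ Fin n) :=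
  Equiv.swap (Sum.inl i) (Sum.inr i)

lemma qubitSwap_list_prod {n : ℕ} {l : List (Fin n)} (hl : l.Nodup) (i : Fin n) :
    (l.map qubitSwap).prod (Sum.inl i) = (if i ∈ l then Sum.inr i else Sum.inl i) ∧
    (l.map qubitSwap).prod (Sum.inr i) = (if i ∈ l then Sum.inl i else Sum.inr i) := by
  induction l with
  | nil => simp
  | cons j l ih =>
    obtain ⟨hj, hl⟩ := List.nodup_cons.1 hl
    obtain ⟨h1, h2⟩ := ih hl
    simp only [List.map_cons, List.prod_cons, Equiv.Perm.mul_apply, h1, h2]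
    by_cases hi : i ∈ l
    · have hij : i ≠ j := fun h => hj (h ▸ hi)
      simp [hi, qubitSwap, Equiv.swap_apply_def, hij]
    · by_cases hij : i = j
      · subst hij; simp [hi, qubitSwap]
      · simp [hi, qubitSwap, Equiv.swap_apply_def, hij]

lemma swapOp_eq_permOp (n : ℕ) : swapOp n = permOp (Equiv.sumComm (Fin n) (Fin n)) := by
  ext x y
  have : x = y ∘ Sum.swap ↔ x ∘ Sum.swap = y := by
    constructor
    · rintro rfl; funext q; simp
    · rintro rfl; funext q; simp
  simp [swapOp, permOp, this]

lemma swapOp_eq_prod (n : ℕ) :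
    swapOp n = (List.ofFn fun i : Fin n => permOp (qubitSwap i)).prod := by
  rw [swapOp_eq_permOp, List.ofFn_eq_map, permOp_list_prod]
  congr 1
  ext q : 1
  rcases q with i | i
  · simp [(qubitSwap_list_prod (List.nodup_finRange n) i).1]
  · simp [(qubitSwap_list_prod (List.nodup_finRange n) i).2]

lemma swapOp_mem_unitary (n : ℕ) : swapOp n ∈ unitary (QOp (Fin n ⊕ Fin n)) := by
  rw [swapOp_eq_permOp]
  exact permOp_mem_unitary _

lemma swapOp_mul_mul_swapOp {n : ℕ} (A B : QOp (Fin n)) :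
    swapOp n * opTensor A B * swapOp n = opTensor B A := by
  ext x y
  rw [swapOp_eq_permOp, mul_assoc, permOp_mul_apply, ← swapOp_eq_permOp]
  simp only [Matrix.mul_apply, swapOp, Matrix.of_apply, mul_ite, mul_one, mul_zero,
    Finset.sum_ite_eq', Finset.mem_univ, if_true, opTensor]
  rw [mul_comm]
  rfl

lemma pauliAt_apply (i : ι) (a : Fin 4) (x y : ι → Fin 2) :
    pauliAt i a x y = if ∀ q, q ≠ i → x q = y q then pauliMatrix a (x i) (y i) else 0 := by
  simp only [pauliAt, pauliString, Matrix.of_apply]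
  rw [Fintype.prod_eq_mul_prod_compl i]
  have : ∀ q ∈ ({i}ᶜ : Finset ι), pauliMatrix ((Pi.single i a : ι → Fin 4) q) (x q) (y q) =
      if x q = y q then (1 : ℂ) else 0 := by
    intro q hq
    have hq : q ≠ i := by simpa using hq
    rw [Pi.single_eq_of_ne hq, ← Matrix.one_apply]
    rfl
  rw [Finset.prod_congr rfl this, Finset.prod_ite_zero]
  simp

/-- The Pauli completeness relation on the pair of qubits `i`; all other qubits contribute Kronecker
deltas. -/
lemma sum_opTensor_pauliAt {n : ℕ} (i : Fin n) :
    (1 / 2 : ℂ) • ∑ a, opTensor (pauliAt i a) (pauliAt i a) = permOp (qubitSwap i) := by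
  ext x y
  simp only [Matrix.smul_apply, Matrix.sum_apply, opTensor, Matrix.of_apply, pauliAt_apply,
    Function.comp, smul_eq_mul, permOp]
  by_cases h1 : ∀ q, q ≠ i → x (Sum.inl q) = y (Sum.inl q)
  · by_cases h2 : ∀ q, q ≠ i → x (Sum.inr q) = y (Sum.inr q)
    · have e : ∑ a, (if ∀ q, q ≠ i → x (Sum.inl q) = y (Sum.inl q) then
          pauliMatrix a (x (Sum.inl i)) (y (Sum.inl i)) else 0) *
          (if ∀ q, q ≠ i → x (Sum.inr q) = y (Sum.inr q) then
          pauliMatrix a (x (Sum.inr i)) (y (Sum.inr i)) else 0) =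
          if x (Sum.inl i) = y (Sum.inr i) ∧ y (Sum.inl i) = x (Sum.inr i) then 2 else 0 := by
        rw [← pauliMatrix_completeness]
        exact Finset.sum_congr rfl fun a _ => by rw [if_pos h1, if_pos h2]
      rw [e]
      have : x ∘ qubitSwap i = y ↔
          x (Sum.inl i) = y (Sum.inr i) ∧ y (Sum.inl i) = x (Sum.inr i) := by
        constructor
        · rintro rfl
          simp [qubitSwap]
        · rintro ⟨h3, h4⟩
          funext q
          rcases q with q | q
          · by_cases hq : q = i
            · subst hq; simp [qubitSwap, h4]
            · simp [qubitSwap, Equiv.swap_apply_def, hq, h1 q hq]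
          · by_cases hq : q = i
            · subst hq; simp [qubitSwap, h3]
            · simp [qubitSwap, Equiv.swap_apply_def, hq, h2 q hq]
      simp only [this]
      split_ifs <;> norm_num
    · rw [if_neg]
      · simp [h2]
      · rintro rfl
        refine h2 fun q hq => ?_
        simp [qubitSwap, Equiv.swap_apply_def, hq]
  · rw [if_neg]
    · simp [h1]
    · rintro rfl
      refine h1 fun q hq => ?_
      simp [qubitSwap, Equiv.swap_apply_def, hq]

/-- All positive powers of `Q` equal `Q`, so the series is that of `e ^ c` times `Q`, except for the
zeroth term, which is corrected by `1 - Q`. -/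
lemma exp_smul_idempotent {Q : QOp ι} (hQ : Q * Q = Q) (c : ℂ) :
    NormedSpace.exp (c • Q) = 1 + (Complex.exp c - 1) • Q := by
  have h1 := NormedSpace.exp_series_hasSum_exp' (𝕂 := ℂ) (c • Q)
  have h2 := (NormedSpace.exp_series_hasSum_exp' (𝕂 := ℂ) c).smul_const Q
  have h3 := h2.add (hasSum_ite_eq 0 (1 - Q))
  have hpow : ∀ k : ℕ, Q ^ (k + 1) = Q := by
    intro k
    induction k with
    | zero => simp
    | succ k ih => rw [pow_succ, ih, hQ]
  have e : (fun k : ℕ => ((k.factorial : ℂ)⁻¹ • c ^ k) • Q + if k = 0 then 1 - Q else 0) =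
      fun k : ℕ => (k.factorial : ℂ)⁻¹ • (c • Q) ^ k := by
    funext k
    rcases k with _ | k
    · simp
    · rw [smul_pow, hpow]
      simp [smul_smul]
  rw [e] at h3
  rw [h1.unique h3, ← Complex.exp_eq_exp_ℂ, sub_smul, one_smul]
  abel

/-- The exponent is `i π` times the projection `(1 - V) / 2`, and `e ^ (i π) = -1` turns the
exponential into a reflection. -/
lemma exp_smul_involution {V : QOp ι} (hV : V * V = 1) :
    NormedSpace.exp ((-(Complex.I * (Real.pi : ℂ) / 2)) • (V - 1)) = V := by
  have hQ : ((1 / 2 : ℂ) • (1 - V)) * ((1 / 2 : ℂ) • (1 - V)) = (1 / 2 : ℂ) • (1 - V) := by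
    rw [smul_mul_smul_comm]
    have : (1 - V) * (1 - V) = (2 : ℂ) • (1 - V) := by
      rw [two_smul, sub_mul, mul_sub, mul_sub, hV]
      simp only [one_mul, mul_one]
      abel
    rw [this, smul_smul]
    norm_num
  have e : (-(Complex.I * (Real.pi : ℂ) / 2)) • (V - 1) =
      ((Real.pi : ℂ) * Complex.I) • ((1 / 2 : ℂ) • (1 - V)) := by
    rw [smul_smul, ← neg_sub V 1, smul_neg, ← neg_smul]
    congr 1
    ring
  rw [e, exp_smul_idempotent hQ, Complex.exp_pi_mul_I, smul_smul, ← sub_eq_zero]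
  norm_num

variable {n D K : ℕ} {pos : Fin n → Fin D → ℤ} {R Λ 𝔡 : ℕ}
  {H : Fin K → LocalHamiltonian pos R Λ 𝔡}

lemma evolution_mem_unitary (t : Fin K → ℝ) : evolution H t ∈ unitary (QOp (Fin n)) := by
  refine Submonoid.list_prod_mem _ fun U hU => ?_
  obtain ⟨k, rfl⟩ := (List.mem_ofFn' _ _).1 hU
  have := I_smul_mem_skewAdjoint (H k).op_isHermitian (-t k)
  refine exp_mem_unitary_of_skewAdjoint ?_
  convert this using 2
  push_cast
  ring

/-- The operator `V_i` for exact Heisenberg-evolved Pauli matrices. -/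
noncomputable def exactSewnOp (H : Fin K → LocalHamiltonian pos R Λ 𝔡) (t : Fin K → ℝ)
    (i : Fin n) : QOp (Fin n ⊕ Fin n) :=
  (1 / 2 : ℂ) • ∑ a, opTensor (heisenberg H t (pauliAt i a)) (pauliAt i a)

/-- The evolution acts on the first register only, so it factors out of the sum over Pauli matrices
and leaves a qubit swap. -/
lemma exactSewnOp_eq (t : Fin K → ℝ) (i : Fin n) : exactSewnOp H t i =
    opTensor (evolution H t).conjTranspose 1 * permOp (qubitSwap i) *
      opTensor (evolution H t) 1 := by
  rw [exactSewnOp, ← sum_opTensor_pauliAt, mul_smul_comm, smul_mul_assoc, Finset.mul_sum,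
    Finset.sum_mul]
  congr 1
  refine Finset.sum_congr rfl fun a _ => ?_
  rw [opTensor_mul, opTensor_mul, one_mul, mul_one]
  rfl

lemma opTensor_evolution_mul_conjTranspose (t : Fin K → ℝ) :
    opTensor (evolution H t) (1 : QOp (Fin n)) * opTensor (evolution H t).conjTranspose 1 = 1 := by
  rw [opTensor_mul, one_mul, ← opTensor_one]
  congr 1
  exact (Unitary.mem_iff.1 (evolution_mem_unitary t)).2

lemma exactSewnOp_mul_self (t : Fin K → ℝ) (i : Fin n) :
    exactSewnOp H t i * exactSewnOp H t i = 1 := by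
  have h := opTensor_evolution_mul_conjTranspose (H := H) t
  have h2 := mul_eq_one_comm.1 h
  have h3 : permOp (qubitSwap i) * permOp (qubitSwap i) = 1 := by
    rw [permOp_mul, qubitSwap, Equiv.swap_mul_self, permOp_one]
  rw [exactSewnOp_eq]
  calc _ = opTensor (evolution H t).conjTranspose 1 * permOp (qubitSwap i) *
        (opTensor (evolution H t) 1 * opTensor (evolution H t).conjTranspose 1) *
        permOp (qubitSwap i) * opTensor (evolution H t) 1 := by simp only [mul_assoc]
    _ = opTensor (evolution H t).conjTranspose 1 * (permOp (qubitSwap i) *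
        permOp (qubitSwap i)) * opTensor (evolution H t) 1 := by rw [h, mul_one]; simp only [mul_assoc]
    _ = 1 := by rw [h3, mul_one, h2]

lemma exactSewnOp_isHermitian (t : Fin K → ℝ) (i : Fin n) :
    (exactSewnOp H t i).IsHermitian := by
  rw [exactSewnOp_eq, Matrix.IsHermitian]
  simp only [Matrix.conjTranspose_mul, opTensor_conjTranspose, Matrix.conjTranspose_conjTranspose,
    Matrix.conjTranspose_one, permOp_conjTranspose, qubitSwap, Equiv.swap_inv, mul_assoc]

lemma list_prod_map_conj {M : Type*} [Monoid M] {J : Type*} {a b : M} (hab : b * a = 1)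
    (hba : a * b = 1) (l : List J) (f : J → M) :
    (l.map fun j => a * f j * b).prod = a * (l.map f).prod * b := by
  induction l with
  | nil => simp [hba]
  | cons j l ih =>
    rw [List.map_cons, List.prod_cons, ih, List.map_cons, List.prod_cons]
    calc _ = a * f j * (b * a) * (l.map f).prod * b := by simp only [mul_assoc]
      _ = _ := by rw [hab, mul_one]; simp only [mul_assoc]

/-- Sewing the exactly evolved Pauli matrices yields `U ⊗ U†`. -/
lemma swapOp_mul_prod_exactSewnOp (t : Fin K → ℝ) :
    swapOp n * ((List.finRange n).map fun i => exactSewnOp H t i).prod =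
      opTensor (evolution H t) (evolution H t).conjTranspose := by
  have h := opTensor_evolution_mul_conjTranspose (H := H) t
  simp only [exactSewnOp_eq]
  -- The inner conjugations cancel and the qubit swaps multiply to `S`. What remains is `S (U† ⊗ I)
  -- S (U ⊗ I)`, and `S` moves `U†` to the second register.
  rw [list_prod_map_conj h (mul_eq_one_comm.1 h), ← List.ofFn_eq_map, ← swapOp_eq_prod,
    ← mul_assoc, ← mul_assoc, swapOp_mul_mul_swapOp, opTensor_mul, one_mul, mul_one]

/-- The maximally mixed state of the second register is invariant under `U†`, and it is traced out
afterwards. -/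
lemma reducedChannel_opTensor {U : QOp (Fin n)} (hU : U ∈ unitary (QOp (Fin n))) :
    reducedChannel (opTensor U U.conjTranspose) = conjChannel U := by
  ext1 ρ
  have h1 : U.conjTranspose * U = 1 := (Unitary.mem_iff.1 hU).1
  simp only [reducedChannel, LinearMap.comp_apply, conjChannel, addMixed, LinearMap.mulLeft_apply,
    LinearMap.mulRight_apply, LinearMap.coe_mk, AddHom.coe_mk, opTensor_conjTranspose,
    opTensor_mul, Matrix.conjTranspose_conjTranspose, smul_mul_assoc, mul_smul_comm, one_mul, h1]
  rw [opTensor_smul_right, map_smul, partialTrace_opTensor, Matrix.trace_one, smul_smul]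
  simp

lemma diamondDist_reducedChannel_conjChannel_le {U : QOp (Fin n)} (hU : U ∈ unitary (QOp (Fin n)))
    {W : QOp (Fin n ⊕ Fin n)} (hW : W ∈ unitary (QOp (Fin n ⊕ Fin n))) {δ : ℝ}
    (h : ‖W - opTensor U U.conjTranspose‖ ≤ δ) :
    diamondDist (reducedChannel W) (conjChannel U) ≤ ENNReal.ofReal (2 * δ) := by
  rw [← reducedChannel_opTensor hU]
  refine (diamondDist_reducedChannel_le (norm_le_one_of_mem_unitary hW) ?_).trans
    (ENNReal.ofReal_le_ofReal (by gcongr))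
  refine norm_le_one_of_mem_unitary (Unitary.mem_iff.2 ?_)
  have h1 : U.conjTranspose * U = 1 := (Unitary.mem_iff.1 hU).1
  have h2 : U * U.conjTranspose = 1 := (Unitary.mem_iff.1 hU).2
  rw [Matrix.star_eq_conjTranspose, opTensor_conjTranspose, opTensor_mul, opTensor_mul,
    Matrix.conjTranspose_conjTranspose, h1, h2, opTensor_one]
  simp

lemma heisenberg_pauliAt_zero (t : Fin K → ℝ) (i : Fin n) :
    heisenberg H t (pauliAt i 0) = 1 := by
  have h1 : (evolution H t).conjTranspose * evolution H t = 1 :=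
    (Unitary.mem_iff.1 (evolution_mem_unitary t)).1
  rw [pauliAt, Pi.single_zero, pauliString_zero, heisenberg, mul_one, h1]

lemma modelOp_isHermitian (m : ℕ) (α : PauliModel n) (i : Fin n) (a : Fin 4) :
    (modelOp H m α i a).IsHermitian := by
  rw [modelOp]
  split_ifs
  · exact Matrix.isHermitian_one
  · rw [Matrix.IsHermitian, Matrix.conjTranspose_sum]
    refine Finset.sum_congr rfl fun Q _ => ?_
    rw [Matrix.conjTranspose_smul, (pauliString_isHermitian Q).eq]
    simp

lemma sewnOp_isHermitian (m : ℕ) (α : PauliModel n) (i : Fin n) :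
    (sewnOp H m α i).IsHermitian := by
  rw [sewnOp, Matrix.IsHermitian, Matrix.conjTranspose_smul, Matrix.conjTranspose_sum]
  congr 1
  · simp
  · refine Finset.sum_congr rfl fun a _ => ?_
    rw [opTensor_conjTranspose, (modelOp_isHermitian m α i a).eq, (pauliAt_isHermitian i a).eq]

lemma norm_opTensor_pauliString_le (A : QOp (Fin n)) (P : Fin n → Fin 4) :
    ‖opTensor A (pauliString P)‖ ≤ ‖A‖ := by
  have : opTensor A (pauliString P) = opTensor A 1 * opTensor 1 (pauliString P) := by
    rw [opTensor_mul, one_mul, mul_one]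
  rw [this, ← pauliString_zero, opTensor_pauliString]
  refine (norm_mul_le _ _).trans ?_
  rw [norm_pauliString, mul_one, pauliString_zero]
  exact norm_opTensor_one_le A

/-- The identity component is exact; the other three contribute `δ` each, with the prefactor `1 /
2`. -/
lemma norm_sewnOp_sub_le {t : Fin K → ℝ} {m : ℕ} {δ : ℝ} {α : PauliModel n}
    (h : IsLearnedModel H t m δ α) (i : Fin n) :
    ‖sewnOp H m α i - exactSewnOp H t i‖ ≤ 3 / 2 * δ := by
  rw [sewnOp, exactSewnOp, ← smul_sub, ← Finset.sum_sub_distrib, norm_smul, Fin.sum_univ_four]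
  simp only [← opTensor_sub_left]
  have h0 : modelOp H m α i 0 - heisenberg H t (pauliAt i 0) = 0 := by
    rw [heisenberg_pauliAt_zero, modelOp, if_pos rfl, sub_self]
  have hz : opTensor (0 : QOp (Fin n)) (pauliAt i 0) = 0 := by ext x y; simp [opTensor]
  have hb : ∀ a : Fin 4, a ≠ 0 → ‖opTensor (modelOp H m α i a - heisenberg H t (pauliAt i a))
      (pauliAt i a)‖ ≤ δ := fun a ha => (norm_opTensor_pauliString_le _ _).trans (h i a ha)
  rw [h0, hz, zero_add, show ‖(1 / 2 : ℂ)‖ = 1 / 2 by norm_num]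
  have := (norm_add₃_le).trans (add_le_add_three (hb 1 (by simp)) (hb 2 (by simp)) (hb 3 (by simp)))
  linarith

/-- The exponent of the factor `i` of the compiled operator. -/
noncomputable def sewnExponent (V : QOp (Fin n ⊕ Fin n)) : QOp (Fin n ⊕ Fin n) :=
  (-(Complex.I * (Real.pi : ℂ) / 2)) • (V - 1)

lemma sewnExponent_mem_skewAdjoint {V : QOp (Fin n ⊕ Fin n)} (hV : V.IsHermitian) :
    sewnExponent V ∈ skewAdjoint (QOp (Fin n ⊕ Fin n)) := by
  have := I_smul_mem_skewAdjoint (hV.sub Matrix.isHermitian_one) (-(Real.pi / 2))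
  rw [sewnExponent]
  convert this using 2
  push_cast
  ring

lemma norm_sewnExponent_sub (V W : QOp (Fin n ⊕ Fin n)) :
    ‖sewnExponent V - sewnExponent W‖ ≤ 2 * ‖V - W‖ := by
  rw [sewnExponent, sewnExponent, ← smul_sub, sub_sub_sub_cancel_right, norm_smul]
  gcongr
  rw [norm_neg, norm_div, norm_mul, Complex.norm_I, one_mul, Complex.norm_real,
    Real.norm_of_nonneg Real.pi_pos.le]
  norm_num
  linarith [Real.pi_le_four]

/-- A product of unitaries close to the factors of the compiled operator is close to `U ⊗ U†`. -/
lemma norm_swapOp_mul_prod_sub_le {t : Fin K → ℝ} {m : ℕ} {δ η : ℝ} {α : PauliModel n}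
    (h : IsLearnedModel H t m δ α) (F : Fin n → QOp (Fin n ⊕ Fin n))
    (hF : ∀ i, F i ∈ unitary (QOp (Fin n ⊕ Fin n)))
    (hFη : ∀ i, ‖F i - NormedSpace.exp (sewnExponent (sewnOp H m α i))‖ ≤ η) :
    ‖swapOp n * (List.ofFn F).prod - opTensor (evolution H t) (evolution H t).conjTranspose‖ ≤
      n * (3 * δ + η) := by
  rw [← swapOp_mul_prod_exactSewnOp, ← mul_sub,
    CStarRing.norm_mem_unitary_mul _ (swapOp_mem_unitary n), List.ofFn_eq_map]
  -- An exact factor is the exponential of its own exponent, so factors can be compared through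
  -- exponents; bounding `π / 2` by 2 gives the error `3 * δ`.
  have hex : ∀ i, NormedSpace.exp (sewnExponent (exactSewnOp H t i)) = exactSewnOp H t i :=
    fun i => exp_smul_involution (exactSewnOp_mul_self t i)
  have hs : ∀ i, sewnExponent (exactSewnOp H t i) ∈ skewAdjoint (QOp (Fin n ⊕ Fin n)) :=
    fun i => sewnExponent_mem_skewAdjoint (exactSewnOp_isHermitian t i)
  have := norm_list_prod_sub_le (List.finRange n) F (exactSewnOp H t) (fun i _ => hF i)
    (fun i _ => hex i ▸ exp_mem_unitary_of_skewAdjoint (hs i)) (δ := 3 * δ + η) fun i _ => by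
      rw [← hex i]
      have h1 := norm_exp_sub_exp_le
        (sewnExponent_mem_skewAdjoint (sewnOp_isHermitian (H := H) m α i)) (hs i)
      have h2 := norm_sewnExponent_sub (sewnOp H m α i) (exactSewnOp H t i)
      have h3 := norm_sewnOp_sub_le h i
      have h4 := norm_sub_le_norm_sub_add_norm_sub (F i)
        (NormedSpace.exp (sewnExponent (sewnOp H m α i)))
        (NormedSpace.exp (sewnExponent (exactSewnOp H t i)))
      linarith [hFη i]
  simpa using this

lemma swapOp_mul_prod_mem_unitary {F : Fin n → QOp (Fin n ⊕ Fin n)}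
    (hF : ∀ i, F i ∈ unitary (QOp (Fin n ⊕ Fin n))) :
    swapOp n * (List.ofFn F).prod ∈ unitary (QOp (Fin n ⊕ Fin n)) := by
  refine mul_mem (swapOp_mem_unitary n) (Submonoid.list_prod_mem _ fun U hU => ?_)
  obtain ⟨i, rfl⟩ := (List.mem_ofFn' _ _).1 hU
  exact hF i

lemma compiledOp_eq (m : ℕ) (α : PauliModel n) : compiledOp H m α = swapOp n *
    (List.ofFn fun i => NormedSpace.exp (sewnExponent (sewnOp H m α i))).prod := rfl

lemma exp_sewnExponent_mem_unitary (m : ℕ) (α : PauliModel n) (i : Fin n) :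
    NormedSpace.exp (sewnExponent (sewnOp H m α i)) ∈ unitary (QOp (Fin n ⊕ Fin n)) :=
  exp_mem_unitary_of_skewAdjoint (sewnExponent_mem_skewAdjoint (sewnOp_isHermitian m α i))

lemma compiledOp_mem_unitary (m : ℕ) (α : PauliModel n) :
    compiledOp H m α ∈ unitary (QOp (Fin n ⊕ Fin n)) := by
  rw [compiledOp_eq]
  exact swapOp_mul_prod_mem_unitary fun i => exp_sewnExponent_mem_unitary m α i

end Sewing

/-! ### Exact gate decompositions -/

section Gates

variable {ι : Type} [Fintype ι] [DecidableEq ι]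

/-- `U` is a product of at most `N` gates. -/
def IsGateProduct (N : ℕ) (U : QOp ι) : Prop :=
  ∃ l : List (QGate ι), l.length ≤ N ∧ (l.map fun g => g.op).prod = U

lemma IsGateProduct.one (N : ℕ) : IsGateProduct N (1 : QOp ι) := ⟨[], by simp, by simp⟩

lemma IsGateProduct.mono {M N : ℕ} (h : M ≤ N) {U : QOp ι} (hU : IsGateProduct M U) :
    IsGateProduct N U := by
  obtain ⟨l, h1, h2⟩ := hU
  exact ⟨l, h1.trans h, h2⟩

lemma IsGateProduct.mul {M N : ℕ} {U V : QOp ι} (hU : IsGateProduct M U) (hV : IsGateProduct N V) :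
    IsGateProduct (M + N) (U * V) := by
  obtain ⟨l, h1, rfl⟩ := hU
  obtain ⟨l', h2, rfl⟩ := hV
  exact ⟨l ++ l', by simp; omega, by simp⟩

lemma IsGateProduct.list_prod {N : ℕ} {l : List (QOp ι)} (h : ∀ U ∈ l, IsGateProduct N U) :
    IsGateProduct (l.length * N) l.prod := by
  induction l with
  | nil => exact .one _
  | cons U l ih =>
    rw [List.prod_cons, List.length_cons, add_mul, one_mul, add_comm]
    exact (h U (by simp)).mul (ih fun V hV => h V (by simp [hV]))

lemma IsGateProduct.pow {N : ℕ} {U : QOp ι} (h : IsGateProduct N U) (r : ℕ) :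
    IsGateProduct (r * N) (U ^ r) := by
  have := IsGateProduct.list_prod (l := List.replicate r U) (N := N)
    fun V hV => List.eq_of_mem_replicate hV ▸ h
  simpa using this

lemma isGateProduct_of_actsOn {X : Finset ι} (hX : X.card ≤ 2) {U : QOp ι} (h : ActsOn X U)
    (hU : U ∈ unitary (QOp ι)) : IsGateProduct 1 U :=
  ⟨[⟨X, hX, U, hU, h⟩], by simp, by simp⟩

/-- Each gate is put in a layer of its own, so depth is bounded by gate count. -/
lemma IsGateProduct.exists_circuit {N : ℕ} {U : QOp ι} (h : IsGateProduct N U) :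
    ∃ c : QCircuit ι, c.toOp = U ∧ c.depth ≤ N := by
  obtain ⟨l, h1, rfl⟩ := h
  refine ⟨⟨l.map fun g => ⟨[g], List.pairwise_singleton _ _⟩⟩, ?_, by simpa [QCircuit.depth]⟩
  simp [QCircuit.toOp, Function.comp_def]

/-- Used to see that the exponential of a Pauli string acts on no more qubits than the string
itself. -/
lemma exists_exp_smul_involution {V : QOp ι} (hV : V * V = 1) (c : ℂ) :
    ∃ a b : ℂ, NormedSpace.exp (c • V) = a • 1 + b • V := by
  let _ : NormedAlgebra ℚ (QOp ι) := NormedAlgebra.restrictScalars ℚ ℂ _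
  have hQ : ((1 / 2 : ℂ) • (1 + V)) * ((1 / 2 : ℂ) • (1 + V)) = (1 / 2 : ℂ) • (1 + V) := by
    rw [smul_mul_smul_comm]
    have : (1 + V) * (1 + V) = (2 : ℂ) • (1 + V) := by
      rw [two_smul, add_mul, mul_add, mul_add, hV]
      simp only [one_mul, mul_one]
      abel
    rw [this, smul_smul]
    norm_num
  have e : c • V = (2 * c) • ((1 / 2 : ℂ) • (1 + V)) + (-c) • (1 : QOp ι) := by
    rw [smul_smul, smul_add, neg_smul]
    have : 2 * c * (1 / 2) = c := by ring
    rw [this]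
    abel
  have hc : Commute ((2 * c) • ((1 / 2 : ℂ) • (1 + V))) ((-c) • (1 : QOp ι)) :=
    (Commute.one_right _).smul_right _
  rw [e, NormedSpace.exp_add_of_commute hc, exp_smul_idempotent hQ,
    exp_smul_idempotent (mul_one (1 : QOp ι))]
  refine ⟨(1 + (Complex.exp (2 * c) - 1) * (1 / 2)) * (1 + (Complex.exp (-c) - 1)),
    (Complex.exp (2 * c) - 1) * (1 / 2) * (1 + (Complex.exp (-c) - 1)), ?_⟩
  have e2 : (1 : QOp ι) + (Complex.exp (-c) - 1) • (1 : QOp ι) =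
      (1 + (Complex.exp (-c) - 1)) • (1 : QOp ι) := by rw [add_smul, one_smul]
  rw [e2, mul_smul_comm, mul_one, smul_smul, smul_add]
  module

lemma actsOn_one (X : Finset ι) : ActsOn X (1 : QOp ι) := by
  rw [← pauliString_zero]
  exact actsOn_pauliString (by simp [pauliSupport])

lemma tensorString_eq_neg {M N : ι → Matrix (Fin 2) (Fin 2) ℂ} (i : ι) (hi : M i = -N i)
    (h : ∀ q, q ≠ i → M q = N q) : tensorString M = -tensorString N := by
  ext x y
  simp only [tensorString, Matrix.of_apply, Matrix.neg_apply]
  rw [Fintype.prod_eq_mul_prod_compl i, Fintype.prod_eq_mul_prod_compl i, hi, Matrix.neg_apply,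
    neg_mul]
  congr 2
  refine Finset.prod_congr rfl fun q hq => ?_
  rw [h q (by simpa using hq)]

/-- Two anticommuting Hermitian involutions are conjugate by a rotation generated by their
product. -/
lemma rotation_conj {P P' : QOp ι} (hP : P.IsHermitian) (hP' : P'.IsHermitian) (h1 : P * P = 1)
    (h2 : P' * P' = 1) (h : P * P' = -(P' * P)) :
    ∃ c : ℂ, (c • (1 + P * P')) * (c • (1 + P * P')).conjTranspose = 1 ∧
      (c • (1 + P * P')) * P' * (c • (1 + P * P')).conjTranspose = P := by
  have hc : (((√2)⁻¹ : ℝ) : ℂ) * (((√2)⁻¹ : ℝ) : ℂ) = 1 / 2 := by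
    rw [← Complex.ofReal_mul, ← mul_inv, Real.mul_self_sqrt (by norm_num)]
    norm_num
  have hJ : (P * P').conjTranspose = -(P * P') := by
    rw [Matrix.conjTranspose_mul, hP.eq, hP'.eq, h, neg_neg]
  have hJJ : (P * P') * (P * P') = -1 := by
    calc P * P' * (P * P') = -(P' * P) * (P * P') := by rw [← h]
      _ = -(P' * (P * P) * P') := by noncomm_ring
      _ = -1 := by rw [h1, mul_one, h2]
  have hJP : P * P' * P' = P := by rw [mul_assoc, h2, mul_one]
  have hPJ : P' * (P * P') = -P := by
    rw [h, mul_neg, ← mul_assoc, h2, one_mul]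
  have hst : ((((√2)⁻¹ : ℝ) : ℂ) • (1 + P * P')).conjTranspose =
      (((√2)⁻¹ : ℝ) : ℂ) • (1 - P * P') := by
    rw [Matrix.conjTranspose_smul, Matrix.conjTranspose_add, hJ, Matrix.conjTranspose_one,
      ← sub_eq_add_neg]
    simp
  refine ⟨(((√2)⁻¹ : ℝ) : ℂ), ?_, ?_⟩
  · rw [hst, smul_mul_smul_comm, hc]
    have : (1 + P * P') * (1 - P * P') = (2 : ℂ) • (1 : QOp ι) := by
      calc (1 + P * P') * (1 - P * P') = 1 - (P * P') * (P * P') := by noncomm_ring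
        _ = _ := by rw [hJJ, two_smul, sub_neg_eq_add]
    rw [this, smul_smul]
    norm_num
  · rw [hst, smul_mul_assoc, smul_mul_smul_comm, hc]
    have : (1 + P * P') * P' * (1 - P * P') = (2 : ℂ) • P := by
      calc (1 + P * P') * P' * (1 - P * P') =
          P' + P * P' * P' - P' * (P * P') - P * P' * (P' * (P * P')) := by noncomm_ring
        _ = P' + P + P + P * P' * P := by rw [hJP, hPJ]; noncomm_ring
        _ = P' + P + P - P' * (P * P) := by rw [h]; noncomm_ring
        _ = (2 : ℂ) • P := by rw [h1, two_smul]; noncomm_ring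
    rw [this, smul_smul]
    norm_num

lemma exp_conj_unitary {G A : QOp ι} (hG : G * G.conjTranspose = 1) :
    NormedSpace.exp (G * A * G.conjTranspose) = G * NormedSpace.exp A * G.conjTranspose := by
  let _ : NormedAlgebra ℚ (QOp ι) := NormedAlgebra.restrictScalars ℚ ℂ _
  exact NormedSpace.exp_units_conj (⟨G, G.conjTranspose, hG, mul_eq_one_comm.1 hG⟩ : (QOp ι)ˣ) A

/-- A Pauli rotation of weight `w` is a product of `2 w + 1` gates. -/
lemma isGateProduct_exp_pauliString (θ : ℝ) (w : ℕ) : ∀ P : ι → Fin 4, (pauliSupport P).card ≤ w →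
    IsGateProduct (2 * w + 1) (NormedSpace.exp ((Complex.I * (θ : ℂ)) • pauliString P)) := by
  have base : ∀ P : ι → Fin 4, (pauliSupport P).card ≤ 2 →
      IsGateProduct 1 (NormedSpace.exp ((Complex.I * (θ : ℂ)) • pauliString P)) := by
    intro P hP
    refine isGateProduct_of_actsOn hP ?_ (exp_mem_unitary_of_skewAdjoint
      (I_smul_mem_skewAdjoint (pauliString_isHermitian P) θ))
    obtain ⟨a, b, hab⟩ := exists_exp_smul_involution (pauliString_mul_self P) (Complex.I * (θ : ℂ))
    rw [hab]
    exact ((actsOn_one _).smul a).add ((actsOn_pauliString subset_rfl).smul b)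
  induction w with
  | zero => exact fun P hP => (base P (by omega)).mono (by omega)
  | succ w ih =>
    intro P hP
    by_cases h2 : (pauliSupport P).card ≤ 2
    · exact (base P h2).mono (by omega)
    obtain ⟨q₁, hq₁, q₂, hq₂, hne⟩ := Finset.one_lt_card.1 (show 1 < (pauliSupport P).card by omega)
    have hq₂0 : P q₂ ≠ 0 := by simpa [pauliSupport] using hq₂
    -- Two different nontrivial Pauli matrices at `q₂` make the strings `P` and `P'` anticommute.
    obtain ⟨b, hb0, hb⟩ : ∃ b : Fin 4, b ≠ 0 ∧ P q₂ ≠ b := by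
      by_cases h1 : P q₂ = 1
      · exact ⟨2, by simp, by simp [h1]⟩
      · exact ⟨1, by simp, h1⟩
    -- `P'` has lost the qubit `q₁` and agrees with `P` off `q₁` and `q₂`. Hence `P P'`, and with it
    -- the rotation that conjugates `P'` into `P`, is a gate on these two qubits.
    set P' : ι → Fin 4 := Function.update (Function.update P q₁ 0) q₂ b with hP'
    have hP'q₂ : P' q₂ = b := by simp [hP']
    have hP'q₁ : P' q₁ = 0 := by simp [hP', hne]
    have hP'q : ∀ q, q ≠ q₁ → q ≠ q₂ → P' q = P q := fun q h1 h2 => by simp [hP', h1, h2]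
    have hcard : (pauliSupport P').card ≤ w := by
      have : pauliSupport P' ⊆ (pauliSupport P).erase q₁ := by
        intro q hq
        have hq : P' q ≠ 0 := by simpa [pauliSupport] using hq
        have h1 : q ≠ q₁ := fun h => hq (h ▸ hP'q₁)
        refine Finset.mem_erase.2 ⟨h1, ?_⟩
        by_cases h3 : q = q₂
        · exact h3 ▸ hq₂
        · simpa [pauliSupport, ← hP'q q h1 h3] using hq
      have := Finset.card_le_card this
      rw [Finset.card_erase_of_mem hq₁] at this
      omega
    have hanti : pauliString P * pauliString P' = -(pauliString P' * pauliString P) := by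
      rw [pauliString_eq, pauliString_eq, tensorString_mul, tensorString_mul]
      refine tensorString_eq_neg q₂ ?_ fun q hq => ?_
      · simp only [hP'q₂]
        exact pauliMatrix_anticomm hq₂0 hb0 hb
      · by_cases h1 : q = q₁
        · subst h1
          simp only [hP'q₁]
          simp [pauliMatrix]
        · simp only [hP'q q h1 hq]
    have hJ : ActsOn {q₁, q₂} (pauliString P * pauliString P') := by
      rw [pauliString_eq, pauliString_eq, tensorString_mul]
      refine actsOn_tensorString fun q hq => ?_
      simp only [Finset.mem_insert, Finset.mem_singleton, not_or] at hq
      rw [hP'q q hq.1 hq.2, pauliMatrix_mul_self]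
    obtain ⟨c, hG, hGP⟩ := rotation_conj (pauliString_isHermitian P) (pauliString_isHermitian P')
      (pauliString_mul_self P) (pauliString_mul_self P') hanti
    set G := c • (1 + pauliString P * pauliString P') with hGdef
    have hGu : G ∈ unitary (QOp ι) := Unitary.mem_iff.2 ⟨mul_eq_one_comm.1 hG, hG⟩
    have hGa : ActsOn {q₁, q₂} G := ((actsOn_one _).add hJ).smul c
    have hGs : ActsOn {q₁, q₂} G.conjTranspose := by
      have e : G.conjTranspose = (starRingEnd ℂ c) • (1 - pauliString P * pauliString P') := by
        rw [hGdef, Matrix.conjTranspose_smul, Matrix.conjTranspose_add, Matrix.conjTranspose_mul,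
          (pauliString_isHermitian P).eq, (pauliString_isHermitian P').eq, Matrix.conjTranspose_one,
          hanti, sub_neg_eq_add]
        rfl
      rw [e]
      exact ((actsOn_one _).sub hJ).smul _
    have hc2 : ({q₁, q₂} : Finset ι).card ≤ 2 := Finset.card_le_two
    rw [← hGP, ← smul_mul_assoc, ← mul_smul_comm, exp_conj_unitary hG]
    refine IsGateProduct.mono (by omega) (((isGateProduct_of_actsOn hc2 hGa hGu).mul
      (ih P' hcard)).mul (isGateProduct_of_actsOn hc2 hGs (Unitary.star_mem hGu)))

lemma isGateProduct_swapOp (n : ℕ) : IsGateProduct n (swapOp n) := by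
  have h : ∀ U ∈ (List.ofFn fun i : Fin n => permOp (qubitSwap i)), IsGateProduct 1 U := by
    intro U hU
    obtain ⟨i, rfl⟩ := (List.mem_ofFn' _ _).1 hU
    refine isGateProduct_of_actsOn (X := {Sum.inl i, Sum.inr i}) Finset.card_le_two ?_
      (permOp_mem_unitary _)
    simp only [← sum_opTensor_pauliAt]
    refine ActsOn.smul _ (actsOn_iff_mem_pauliSpan.2 (Submodule.sum_mem _ fun a _ =>
      actsOn_iff_mem_pauliSpan.1 ?_))
    rw [pauliAt, opTensor_pauliString]
    refine actsOn_pauliString fun q hq => ?_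
    rcases q with q | q
    · by_cases hqi : q = i
      · simp [hqi]
      · simp [pauliSupport, hqi] at hq
    · by_cases hqi : q = i
      · simp [hqi]
      · simp [pauliSupport, hqi] at hq
  have := IsGateProduct.list_prod h
  rwa [← swapOp_eq_prod, List.length_ofFn, mul_one] at this

end Gates

/-! ### Product formulas -/

section ProductFormulas

/-- `S` is a product of `N |A|` exponentials of real multiples of the `τ B`, `B ∈ A`, whose
exponents add up to `w τ ∑ B`. -/
def HasFactors {ι : Type} [Fintype ι] [DecidableEq ι] (w κ : ℝ) (N : ℕ) (A : List (QOp ι)) (τ : ℂ)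
    (S : QOp ι) : Prop :=
  ∃ L : List (QOp ι), (L.map NormedSpace.exp).prod = S ∧ L.sum = ((w : ℂ) * τ) • A.sum ∧
    (L.map norm).sum ≤ κ * (‖τ‖ * (A.map norm).sum) ∧ L.length = N * A.length ∧
    ∀ X ∈ L, ∃ x : ℝ, ∃ B ∈ A, X = ((x : ℂ) * τ) • B

variable {ι : Type} [Fintype ι] [DecidableEq ι] {w w' κ κ' : ℝ} {N N' : ℕ} {A : List (QOp ι)}
  {τ : ℂ} {S S' : QOp ι}

lemma HasFactors.mul (h : HasFactors w κ N A τ S) (h' : HasFactors w' κ' N' A τ S') :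
    HasFactors (w + w') (κ + κ') (N + N') A τ (S * S') := by
  obtain ⟨L, h1, h2, h3, h4, h5⟩ := h
  obtain ⟨L', h1', h2', h3', h4', h5'⟩ := h'
  refine ⟨L ++ L', by simp [h1, h1'], ?_, ?_, by simp [h4, h4', add_mul], ?_⟩
  · rw [List.sum_append, h2, h2', ← add_smul]
    push_cast
    ring_nf
  · rw [List.map_append, List.sum_append, add_mul]
    exact add_le_add h3 h3'
  · intro X hX
    rcases List.mem_append.1 hX with hX | hX
    exacts [h5 X hX, h5' X hX]

lemma HasFactors.scale (u : ℝ) (h : HasFactors w κ N A ((u : ℂ) * τ) S) :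
    HasFactors (w * u) (κ * |u|) N A τ S := by
  obtain ⟨L, h1, h2, h3, h4, h5⟩ := h
  refine ⟨L, h1, ?_, ?_, h4, ?_⟩
  · rw [h2]
    push_cast
    ring_nf
  · rw [norm_mul, Complex.norm_real, Real.norm_eq_abs] at h3
    exact h3.trans (le_of_eq (by ring))
  · intro X hX
    obtain ⟨x, B, hB, rfl⟩ := h5 X hX
    exact ⟨x * u, B, hB, by push_cast; ring_nf⟩

lemma hasFactors_lieTrotter (A : List (QOp ι)) (τ : ℂ) :
    HasFactors 1 1 1 A τ (lieTrotter A τ) := by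
  refine ⟨A.map (τ • ·), by simp [lieTrotter, Function.comp_def], ?_, ?_, by simp, ?_⟩
  · rw [Complex.ofReal_one, one_mul, List.smul_sum]
  · rw [one_mul, List.map_map]
    refine le_of_eq ?_
    simp only [Function.comp_def, norm_smul]
    rw [List.sum_map_mul_left]
  · intro X hX
    obtain ⟨B, hB, rfl⟩ := List.mem_map.1 hX
    exact ⟨1, B, hB, by simp⟩

lemma HasFactors.of_reverse (h : HasFactors w κ N A.reverse τ S) : HasFactors w κ N A τ S := by
  obtain ⟨L, h1, h2, h3, h4, h5⟩ := h
  refine ⟨L, h1, by rwa [List.sum_reverse] at h2, ?_, by rwa [List.length_reverse] at h4, ?_⟩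
  · rwa [List.map_reverse, List.sum_reverse] at h3
  · intro X hX
    obtain ⟨x, B, hB, h⟩ := h5 X hX
    exact ⟨x, B, List.mem_reverse.1 hB, h⟩

/-- The time fractions of Suzuki's recursion add up to `4 u + (1 - 4 u) = 1`; nothing else about `u`
matters here. The constants depend on `k` alone. -/
lemma exists_hasFactors_suzukiEven (k : ℕ) : ∃ (κ : ℝ) (N : ℕ), ∀ (ι : Type) [Fintype ι]
    [DecidableEq ι] (A : List (QOp ι)) (τ : ℂ), HasFactors 1 κ N A τ (suzukiEven A k τ) := by
  induction k with
  | zero =>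
    refine ⟨1 * |1 / 2| + 1 * |1 / 2|, 1 + 1, fun ι _ _ A τ => ?_⟩
    have e : τ / 2 = ((1 / 2 : ℝ) : ℂ) * τ := by push_cast; ring
    have h1 := HasFactors.scale (τ := τ) (1 / 2) (hasFactors_lieTrotter A _)
    have h2 := HasFactors.scale (τ := τ) (1 / 2)
      ((hasFactors_lieTrotter A.reverse _).of_reverse)
    have := h1.mul h2
    rw [suzukiEven, e]
    convert this using 1
    norm_num
  | succ k ih =>
    obtain ⟨κ, N, ih⟩ := ih
    set u : ℝ := 1 / (4 - (4 : ℝ) ^ (1 / (2 * (k : ℝ) + 3))) with hu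
    refine ⟨κ * |u| + κ * |u| + κ * |1 - 4 * u| + (κ * |u| + κ * |u|), N + N + N + (N + N),
      fun ι _ _ A τ => ?_⟩
    have h1 := HasFactors.scale (τ := τ) u (ih ι A _)
    have h2 := HasFactors.scale (τ := τ) (1 - 4 * u) (ih ι A _)
    have := ((h1.mul h1).mul h2).mul (h1.mul h1)
    rw [suzukiEven]
    simp only [← hu]
    rw [sq]
    convert this using 1
    · ring
    · push_cast
      rfl

lemma exists_hasFactors_trotterSuzuki (p : ℕ) : ∃ (κ : ℝ) (N : ℕ), ∀ (ι : Type) [Fintype ι]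
    [DecidableEq ι] (A : List (QOp ι)) (τ : ℂ), HasFactors 1 κ N A τ (trotterSuzuki p A τ) := by
  by_cases hp : p = 1
  · refine ⟨1, 1, fun ι _ _ A τ => ?_⟩
    rw [trotterSuzuki, if_pos hp]
    exact hasFactors_lieTrotter A τ
  · obtain ⟨κ, N, h⟩ := exists_hasFactors_suzukiEven ((p + 1) / 2 - 1)
    refine ⟨κ, N, fun ι _ _ A τ => ?_⟩
    rw [trotterSuzuki, if_neg hp]
    exact h ι A τ

/-- `A` consists of real multiples of Pauli strings. -/
def IsPauliList (A : List (QOp ι)) : Prop :=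
  ∀ B ∈ A, ∃ (c : ℝ) (P : ι → Fin 4), B = (c : ℂ) • pauliString P

lemma HasFactors.isGateProduct (h : HasFactors w κ N A (Complex.I * (w' : ℂ)) S)
    (hA : IsPauliList A) :
    IsGateProduct (N * A.length * (2 * Fintype.card ι + 1)) S := by
  obtain ⟨L, rfl, -, -, h4, h5⟩ := h
  rw [← h4, ← List.length_map (f := NormedSpace.exp)]
  refine IsGateProduct.list_prod fun U hU => ?_
  obtain ⟨X, hX, rfl⟩ := List.mem_map.1 hU
  obtain ⟨x, B, hB, rfl⟩ := h5 X hX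
  obtain ⟨c, P, rfl⟩ := hA B hB
  have := isGateProduct_exp_pauliString (x * w' * c) (Fintype.card ι) P (Finset.card_le_univ _)
  convert this using 2
  rw [smul_smul]
  push_cast
  ring_nf

lemma HasFactors.mem_skewAdjoint {L : List (QOp ι)} (hA : IsPauliList A)
    (h : ∀ X ∈ L, ∃ x : ℝ, ∃ B ∈ A, X = ((x : ℂ) * (Complex.I * (w' : ℂ))) • B) :
    ∀ X ∈ L, X ∈ skewAdjoint (QOp ι) := by
  intro X hX
  obtain ⟨x, B, hB, rfl⟩ := h X hX
  obtain ⟨c, P, rfl⟩ := hA B hB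
  have := I_smul_mem_skewAdjoint (pauliString_isHermitian P) (x * w' * c)
  convert this using 1
  rw [smul_smul]
  push_cast
  ring_nf

lemma HasFactors.mem_unitary (h : HasFactors w κ N A (Complex.I * (w' : ℂ)) S)
    (hA : IsPauliList A) : S ∈ unitary (QOp ι) := by
  obtain ⟨L, rfl, -, -, -, h5⟩ := h
  exact list_prod_exp_mem_unitary (HasFactors.mem_skewAdjoint hA h5)

/-- The exponents add up to the exact one, so the first-order estimate covers formulas of every
order. It suffices because the number of repetitions may be polynomial in `n / ε`. -/
lemma HasFactors.norm_sub_exp_le (h : HasFactors 1 κ N A (Complex.I * (w' : ℂ)) S)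
    (hA : IsPauliList A) :
    ‖S - NormedSpace.exp ((Complex.I * (w' : ℂ)) • A.sum)‖ ≤
      2 * (κ * (|w'| * (A.map norm).sum)) ^ 2 := by
  obtain ⟨L, rfl, h2, h3, -, h5⟩ := h
  have := norm_prod_exp_sub_exp_sum_le (HasFactors.mem_skewAdjoint hA h5)
  rw [h2, Complex.ofReal_one, one_mul] at this
  refine this.trans ?_
  rw [norm_mul, Complex.norm_I, one_mul, Complex.norm_real, Real.norm_eq_abs] at h3
  have h0 : 0 ≤ (L.map norm).sum := List.sum_nonneg (by
    intro x hx
    obtain ⟨X, _, rfl⟩ := List.mem_map.1 hx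
    exact norm_nonneg X)
  gcongr

end ProductFormulas

/-! ### Compilation of learned models -/

section Compilation

variable {n D K : ℕ} {pos : Fin n → Fin D → ℤ} {R Λ 𝔡 : ℕ}
  {H : Fin K → LocalHamiltonian pos R Λ 𝔡}

lemma isPauliList_sewnTerms (m : ℕ) (α : PauliModel n) (i : Fin n) :
    IsPauliList (sewnTerms H m α i) := by
  intro B hB
  rw [sewnTerms, List.mem_cons] at hB
  rcases hB with rfl | hB
  · exact ⟨-(1 / 2), 0, by rw [pauliString_zero]; push_cast; rfl⟩
  · obtain ⟨a, _, hB⟩ := List.mem_flatMap.1 hB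
    obtain ⟨Q, _, rfl⟩ := List.mem_map.1 hB
    exact ⟨α i a Q / 2, Sum.elim Q (Pi.single i a), by rw [pauliAt, opTensor_pauliString]⟩

lemma length_sewnTerms (m : ℕ) (α : PauliModel n) (i : Fin n) :
    (sewnTerms H m α i).length = 1 + 3 * (linkedPaulis H i m).card := by
  simp [sewnTerms]
  ring

lemma sum_sewnTerms (m : ℕ) (α : PauliModel n) (i : Fin n) :
    (sewnTerms H m α i).sum = sewnOp H m α i - 1 := by
  have key : ∀ a : Fin 4, a ≠ 0 → ∑ Q ∈ linkedPaulis H i m, ((α i a Q / 2 : ℝ) : ℂ) •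
      opTensor (pauliString Q) (pauliAt i a) =
      (1 / 2 : ℂ) • opTensor (modelOp H m α i a) (pauliAt i a) := by
    intro a ha
    rw [modelOp, if_neg ha, opTensor_sum_left, Finset.smul_sum]
    refine Finset.sum_congr rfl fun Q _ => ?_
    rw [opTensor_smul_left, smul_smul]
    push_cast
    ring_nf
  have h0 : opTensor (modelOp H m α i 0) (pauliAt i 0) = 1 := by
    rw [modelOp, if_pos rfl, pauliAt, Pi.single_zero, pauliString_zero, opTensor_one]
  simp only [sewnTerms, List.sum_cons, List.flatMap_cons, List.flatMap_nil, List.append_nil,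
    List.sum_append, Finset.sum_map_toList]
  rw [key 1 (by simp), key 2 (by simp), key 3 (by simp), sewnOp, Fin.sum_univ_four, h0]
  module

/-- The learned operator has norm at most `1 + δ`, and its norm bounds its Pauli coefficients. -/
lemma norm_coeff_le {t : Fin K → ℝ} {m : ℕ} {δ : ℝ} (hδ : δ ≤ 1) {α : PauliModel n}
    (h : IsLearnedModel H t m δ α) (i : Fin n) {a : Fin 4} (ha : a ≠ 0) {Q : Fin n → Fin 4}
    (hQ : Q ∈ linkedPaulis H i m) : |α i a Q| ≤ 2 := by
  have h1 := norm_pauli_coeff_le (linkedPaulis H i m) (fun Q => (α i a Q : ℂ)) hQ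
  have h2 := h i a ha
  have h3 : ‖heisenberg H t (pauliAt i a)‖ = 1 := by
    have hU := evolution_mem_unitary (H := H) t
    rw [heisenberg, ← Matrix.star_eq_conjTranspose,
      norm_unitary_mul_mul (Unitary.star_mem hU) hU]
    exact norm_pauliString _
  rw [modelOp, if_neg ha] at h2
  have h4 := norm_le_norm_add_norm_sub (heisenberg H t (pauliAt i a))
    (∑ Q ∈ linkedPaulis H i m, (α i a Q : ℂ) • pauliString Q)
  rw [norm_sub_rev] at h2
  rw [Complex.norm_real, Real.norm_eq_abs] at h1
  linarith

lemma sum_norm_sewnTerms_le {t : Fin K → ℝ} {m : ℕ} {δ : ℝ} (hδ : δ ≤ 1) {α : PauliModel n}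
    (h : IsLearnedModel H t m δ α) (i : Fin n) :
    ((sewnTerms H m α i).map norm).sum ≤ 1 / 2 + 3 * (linkedPaulis H i m).card := by
  have key : ∀ a : Fin 4, a ≠ 0 → ∑ Q ∈ linkedPaulis H i m, ‖((α i a Q / 2 : ℝ) : ℂ) •
      opTensor (pauliString Q) (pauliAt i a)‖ ≤ (linkedPaulis H i m).card := by
    intro a ha
    refine (Finset.sum_le_card_nsmul _ _ 1 fun Q hQ => ?_).trans (by simp)
    rw [pauliAt, opTensor_pauliString, norm_smul, norm_pauliString, mul_one, Complex.norm_real,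
      Real.norm_eq_abs, abs_div, abs_two]
    linarith [norm_coeff_le hδ h i ha hQ]
  have h0 : ‖(-(1 / 2 : ℂ)) • (1 : QOp (Fin n ⊕ Fin n))‖ = 1 / 2 := by
    rw [← pauliString_zero, norm_smul, norm_pauliString]
    norm_num
  simp only [sewnTerms, List.map_cons, List.sum_cons, List.flatMap_cons, List.flatMap_nil,
    List.append_nil, List.map_append, List.sum_append, List.map_map]
  rw [h0]
  have e : ∀ a : Fin 4, ((linkedPaulis H i m).toList.map (norm ∘ fun Q =>
      ((α i a Q / 2 : ℝ) : ℂ) • opTensor (pauliString Q) (pauliAt i a))).sum =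
      ∑ Q ∈ linkedPaulis H i m, ‖((α i a Q / 2 : ℝ) : ℂ) •
        opTensor (pauliString Q) (pauliAt i a)‖ := fun a => Finset.sum_map_toList _ _
  rw [e, e, e]
  linarith [key 1 (by simp), key 2 (by simp), key 3 (by simp)]

/-- The product formulas, repeated `r` times, give a circuit of the claimed accuracy. -/
lemma trotterizedOp_spec {p N : ℕ} {κ : ℝ}
    (hp : ∀ (ι : Type) [Fintype ι] [DecidableEq ι] (A : List (QOp ι)) (τ : ℂ),
      HasFactors 1 κ N A τ (trotterSuzuki p A τ))
    {t : Fin K → ℝ} {m : ℕ} {δ : ℝ} (hδ : δ ≤ 1) {α : PauliModel n}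
    (h : IsLearnedModel H t m δ α) {L : ℕ} (hL : ∀ i, (linkedPaulis H i m).card ≤ L) {r : ℕ}
    (hr : 1 ≤ r) :
    trotterizedOp H m α p r ∈ unitary (QOp (Fin n ⊕ Fin n)) ∧
    ‖trotterizedOp H m α p r - opTensor (evolution H t) (evolution H t).conjTranspose‖ ≤
      n * (3 * δ + 8 * κ ^ 2 * (1 / 2 + 3 * L) ^ 2 / r) ∧
    IsGateProduct (n + n * (r * (N * (1 + 3 * L) * (2 * (n + n) + 1))))
      (trotterizedOp H m α p r) := by
  let _ : NormedAlgebra ℚ (QOp (Fin n ⊕ Fin n)) := NormedAlgebra.restrictScalars ℚ ℂ _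
  have hr0 : (0 : ℝ) < r := by exact_mod_cast hr
  have hτ : -(Complex.I * (Real.pi : ℂ) / (2 * (r : ℂ))) =
      Complex.I * ((-(Real.pi / (2 * r)) : ℝ) : ℂ) := by
    push_cast; ring
  have hf : ∀ i, HasFactors 1 κ N (sewnTerms H m α i)
      (Complex.I * ((-(Real.pi / (2 * r)) : ℝ) : ℂ)) (trotterSuzuki p (sewnTerms H m α i)
        (-(Complex.I * (Real.pi : ℂ) / (2 * (r : ℂ))))) := fun i => hτ ▸ hp _ _ _
  have hA : ∀ i, IsPauliList (sewnTerms H m α i) := fun i => isPauliList_sewnTerms m α i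
  have hu : ∀ i, trotterSuzuki p (sewnTerms H m α i)
      (-(Complex.I * (Real.pi : ℂ) / (2 * (r : ℂ)))) ^ r ∈ unitary (QOp (Fin n ⊕ Fin n)) :=
    fun i => pow_mem ((hf i).mem_unitary (hA i)) r
  refine ⟨swapOp_mul_prod_mem_unitary hu, norm_swapOp_mul_prod_sub_le h _ hu fun i => ?_, ?_⟩
  · have h1 := (hf i).norm_sub_exp_le (hA i)
    have he : NormedSpace.exp (sewnExponent (sewnOp H m α i)) = NormedSpace.exp
        ((Complex.I * ((-(Real.pi / (2 * r)) : ℝ) : ℂ)) • (sewnTerms H m α i).sum) ^ r := by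
      rw [← NormedSpace.exp_nsmul, ← Nat.cast_smul_eq_nsmul ℂ, sum_sewnTerms, smul_smul,
        sewnExponent]
      congr 2
      have : (r : ℂ) ≠ 0 := by exact_mod_cast hr0.ne'
      push_cast
      field_simp
    have hs : (Complex.I * ((-(Real.pi / (2 * r)) : ℝ) : ℂ)) • (sewnTerms H m α i).sum ∈
        skewAdjoint (QOp (Fin n ⊕ Fin n)) := by
      rw [sum_sewnTerms]
      exact I_smul_mem_skewAdjoint ((sewnOp_isHermitian m α i).sub Matrix.isHermitian_one) _
    rw [he]
    refine (norm_pow_sub_pow_le ((hf i).mem_unitary (hA i))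
      (exp_mem_unitary_of_skewAdjoint hs) r).trans ?_
    have h2 : ((sewnTerms H m α i).map norm).sum ≤ 1 / 2 + 3 * L := by
      refine (sum_norm_sewnTerms_le hδ h i).trans ?_
      have : ((linkedPaulis H i m).card : ℝ) ≤ L := by exact_mod_cast hL i
      linarith
    have h3 : 0 ≤ ((sewnTerms H m α i).map norm).sum := List.sum_nonneg (by
      intro x hx
      obtain ⟨X, _, rfl⟩ := List.mem_map.1 hx
      exact norm_nonneg X)
    -- One repetition errs quadratically in `1 / r`, so the `r` repetitions together err by a
    -- multiple of `1 / r`.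
    have h4 : |(-(Real.pi / (2 * r)) : ℝ)| ≤ 2 / r := by
      rw [abs_neg, abs_of_pos (by positivity), div_le_div_iff₀ (by positivity) hr0]
      nlinarith [Real.pi_le_four]
    calc (r : ℝ) * _ ≤ r * (2 * (κ * (|(-(Real.pi / (2 * r)) : ℝ)| *
          ((sewnTerms H m α i).map norm).sum)) ^ 2) := by gcongr
      _ = r * (2 * (κ ^ 2 * (|(-(Real.pi / (2 * r)) : ℝ)| *
          ((sewnTerms H m α i).map norm).sum) ^ 2)) := by ring
      _ ≤ r * (2 * (κ ^ 2 * (2 / r * (1 / 2 + 3 * L)) ^ 2)) := by gcongr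
      _ = 8 * κ ^ 2 * (1 / 2 + 3 * L) ^ 2 / r := by
        field_simp
        ring
  · refine (isGateProduct_swapOp n).mul ?_
    have h1 : ∀ U ∈ (List.ofFn fun i => trotterSuzuki p (sewnTerms H m α i)
        (-(Complex.I * (Real.pi : ℂ) / (2 * (r : ℂ)))) ^ r),
        IsGateProduct (r * (N * (1 + 3 * L) * (2 * (n + n) + 1))) U := by
      intro U hU
      obtain ⟨i, rfl⟩ := (List.mem_ofFn' _ _).1 hU
      refine IsGateProduct.pow (IsGateProduct.mono ?_ ((hf i).isGateProduct (hA i))) r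
      rw [length_sewnTerms, Fintype.card_sum, Fintype.card_fin]
      gcongr
      exact hL i
    have := IsGateProduct.list_prod h1
    rwa [List.length_ofFn] at this

end Compilation

/-! ### Counting linked clusters -/

section Counting

/-- The sets of vertices visited by walks of `k` steps from `v`, for a neighbourhood function. -/
def visits {V : Type} [DecidableEq V] (nbr : V → Finset V) : ℕ → V → Finset (Finset V)
  | 0, v => {{v}}
  | k + 1, v => (nbr v).biUnion fun w => (visits nbr k w).image (insert v)

variable {V : Type} [DecidableEq V] {nbr : V → Finset V}

lemma card_visits_le {Δ : ℕ} (hΔ : ∀ v, (nbr v).card ≤ Δ) (k : ℕ) (v : V) :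
    (visits nbr k v).card ≤ Δ ^ k := by
  induction k generalizing v with
  | zero => simp [visits]
  | succ k ih =>
    rw [visits, pow_succ']
    refine (Finset.card_biUnion_le_card_mul _ _ (Δ ^ k) fun w _ =>
      Finset.card_image_le.trans (ih w)).trans ?_
    gcongr
    exact hΔ v

lemma mem_visits_succ {k : ℕ} {v w : V} {S : Finset V} (hw : w ∈ nbr v) (hS : S ∈ visits nbr k w) :
    insert v S ∈ visits nbr (k + 1) v :=
  Finset.mem_biUnion.2 ⟨w, hw, Finset.mem_image_of_mem _ hS⟩

lemma self_mem_of_mem_visits {k : ℕ} {v : V} {S : Finset V} (hS : S ∈ visits nbr k v) : v ∈ S := by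
  cases k with
  | zero => rw [visits, Finset.mem_singleton] at hS; simp [hS]
  | succ k =>
    obtain ⟨w, _, h⟩ := Finset.mem_biUnion.1 hS
    obtain ⟨S', _, rfl⟩ := Finset.mem_image.1 h
    exact Finset.mem_insert_self _ _

/-- Since every vertex is its own neighbour, walks can idle; this pads them to a common length. -/
lemma visits_subset_add (hself : ∀ v, v ∈ nbr v) {k : ℕ} {v : V} {S : Finset V}
    (hS : S ∈ visits nbr k v) (l : ℕ) : S ∈ visits nbr (k + l) v := by
  induction l with
  | zero => exact hS
  | succ l ih =>
    have := mem_visits_succ (hself v) ih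
    rwa [Finset.insert_eq_of_mem (self_mem_of_mem_visits hS)] at this

/-- A walk can be extended by a detour to a neighbour of a visited vertex. -/
lemma insert_mem_visits (hsymm : ∀ v w, w ∈ nbr v → v ∈ nbr w) {u w : V} (hw : w ∈ nbr u) :
    ∀ {k : ℕ} {v : V} {S : Finset V}, S ∈ visits nbr k v → u ∈ S →
      insert w S ∈ visits nbr (k + 2) v := by
  intro k
  have detour : ∀ {k : ℕ} {S : Finset V}, S ∈ visits nbr k u →
      insert w S ∈ visits nbr (k + 2) u := by
    intro k S hS
    have := mem_visits_succ hw (mem_visits_succ (hsymm _ _ hw) hS)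
    rwa [Finset.insert_comm, Finset.insert_eq_of_mem (self_mem_of_mem_visits hS)] at this
  induction k with
  | zero =>
    intro v S hS hu
    have hS' := hS
    rw [visits, Finset.mem_singleton] at hS'
    subst hS'
    rw [Finset.mem_singleton] at hu
    subst hu
    exact detour hS
  | succ k ih =>
    intro v S hS hu
    by_cases huv : u = v
    · subst huv; exact detour hS
    obtain ⟨x, hx, h⟩ := Finset.mem_biUnion.1 hS
    obtain ⟨S', hS', rfl⟩ := Finset.mem_image.1 h
    have hu' : u ∈ S' := (Finset.mem_insert.1 hu).resolve_left huv
    rw [Finset.insert_comm]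
    exact mem_visits_succ hx (ih hS' hu')

/-- A set that can be grown from `v` along neighbours is visited by a walk of twice its size. -/
lemma mem_visits_of_growing (hself : ∀ v, v ∈ nbr v) (hsymm : ∀ v w, w ∈ nbr v → v ∈ nbr w)
    {F : Finset V} {v : V} (hv : v ∈ F)
    (hF : ∀ S ⊆ F, v ∈ S → S ≠ F → ∃ u ∈ S, ∃ w ∈ F, w ∉ S ∧ w ∈ nbr u) {j : ℕ}
    (hj : F.card ≤ j + 1) : F ∈ visits nbr (2 * j) v := by
  have key : ∀ j : ℕ, ∃ S ∈ visits nbr (2 * j) v, S ⊆ F ∧ (S = F ∨ j + 1 ≤ S.card) := by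
    intro j
    induction j with
    | zero => exact ⟨{v}, by simp [visits], by simpa using hv, Or.inr (by simp)⟩
    | succ j ih =>
      obtain ⟨S, hS, hSF, h⟩ := ih
      by_cases hSeq : S = F
      · exact ⟨S, visits_subset_add hself hS 2, hSF, Or.inl hSeq⟩
      · obtain ⟨u, hu, w, hwF, hwS, hw⟩ := hF S hSF (self_mem_of_mem_visits hS) hSeq
        refine ⟨insert w S, insert_mem_visits hsymm hw hS hu, Finset.insert_subset hwF hSF,
          Or.inr ?_⟩
        rw [Finset.card_insert_of_notMem hwS]
        have := h.resolve_left hSeq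
        omega
  obtain ⟨S, hS, hSF, h⟩ := key j
  rcases h with h | h
  · exact h ▸ hS
  · rw [← Finset.eq_of_subset_of_card_le hSF (hj.trans h)]
    exact hS

variable {n D K : ℕ} {pos : Fin n → Fin D → ℤ} {R Λ 𝔡 : ℕ}
  (H : Fin K → LocalHamiltonian pos R Λ 𝔡) (i : Fin n)

/-- The qubits of a term, or `{i}` for the root. -/
def vertexSupp (o : Option (Σ k, Fin (H k).numTerms)) : Finset (Fin n) :=
  o.elim {i} fun a => (H a.1).supp a.2

/-- The terms (and the root) that overlap a given one, including itself. -/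
def overlapNbr (o : Option (Σ k, Fin (H k).numTerms)) :
    Finset (Option (Σ k, Fin (H k).numTerms)) :=
  insert o (Finset.univ.filter fun o' => ¬ Disjoint (vertexSupp H i o) (vertexSupp H i o'))

lemma card_vertexSupp_le (o : Option (Σ k, Fin (H k).numTerms)) :
    (vertexSupp H i o).card ≤ Λ + 1 := by
  rcases o with _ | a
  · simp [vertexSupp]
  · exact ((H a.1).card_supp_le a.2).trans (Nat.le_succ _)

/-- Each of at most `Λ + 1` qubits lies in at most `𝔡 + 1` terms of each Hamiltonian; the extra 2
accounts for the root and for `o` itself. -/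
lemma card_overlapNbr_le (o : Option (Σ k, Fin (H k).numTerms)) :
    (overlapNbr H i o).card ≤ K * ((Λ + 1) * (𝔡 + 1)) + 2 := by
  set Y := vertexSupp H i o with hY
  have hsub : (Finset.univ.filter fun o' => ¬ Disjoint Y (vertexSupp H i o')) ⊆
      insert none ((Finset.univ : Finset (Fin K)).biUnion fun k =>
        (Finset.univ.filter fun j => ¬ Disjoint ((H k).supp j) Y).image
          fun j => some (⟨k, j⟩ : Σ k, Fin (H k).numTerms)) := by
    intro o' ho'
    rcases o' with _ | ⟨k, j⟩
    · simp
    · refine Finset.mem_insert_of_mem (Finset.mem_biUnion.2 ⟨k, Finset.mem_univ _,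
        Finset.mem_image.2 ⟨j, ?_, rfl⟩⟩)
      rw [Finset.mem_filter] at ho' ⊢
      exact ⟨Finset.mem_univ _, fun h => ho'.2 h.symm⟩
  have h1 := Finset.card_le_card hsub
  have h2 : ((Finset.univ : Finset (Fin K)).biUnion fun k =>
        (Finset.univ.filter fun j => ¬ Disjoint ((H k).supp j) Y).image
          fun j => some (⟨k, j⟩ : Σ k, Fin (H k).numTerms)).card ≤
      K * ((Λ + 1) * (𝔡 + 1)) := by
    have := Finset.card_biUnion_le_card_mul (Finset.univ : Finset (Fin K)) (fun k =>
        (Finset.univ.filter fun j => ¬ Disjoint ((H k).supp j) Y).image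
          fun j => some (⟨k, j⟩ : Σ k, Fin (H k).numTerms)) ((Λ + 1) * (𝔡 + 1)) fun k _ =>
      Finset.card_image_le.trans (((H k).card_filter_not_disjoint_le Y).trans
        (Nat.mul_le_mul_right _ (card_vertexSupp_le H i o)))
    simpa using this
  have h3 := Finset.card_insert_le none ((Finset.univ : Finset (Fin K)).biUnion fun k =>
        (Finset.univ.filter fun j => ¬ Disjoint ((H k).supp j) Y).image
          fun j => some (⟨k, j⟩ : Σ k, Fin (H k).numTerms))
  have h4 := Finset.card_insert_le o
    (Finset.univ.filter fun o' => ¬ Disjoint Y (vertexSupp H i o'))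
  rw [overlapNbr, ← hY]
  omega

lemma mem_overlapNbr_symm (o o' : Option (Σ k, Fin (H k).numTerms))
    (h : o' ∈ overlapNbr H i o) : o ∈ overlapNbr H i o' := by
  rw [overlapNbr, Finset.mem_insert, Finset.mem_filter] at *
  rcases h with rfl | h
  · exact Or.inl rfl
  · exact Or.inr ⟨Finset.mem_univ _, fun h' => h.2 h'.symm⟩

variable {H i}

/-- The vertices of a linked cluster, including the root. -/
def clusterVertices (W : Finset (Σ k, Fin (H k).numTerms)) :
    Finset (Option (Σ k, Fin (H k).numTerms)) :=
  insert none (W.image some)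

/-- Encodes a cluster by a walk from the root, so that counting connected clusters becomes counting
walks. -/
lemma IsLinkedCluster.mem_visits {W : Finset (Σ k, Fin (H k).numTerms)}
    (hW : IsLinkedCluster H i W) {j : ℕ} (hj : W.card ≤ j) :
    clusterVertices W ∈ visits (overlapNbr H i) (2 * j) none := by
  refine mem_visits_of_growing (fun v => Finset.mem_insert_self _ _) (mem_overlapNbr_symm H i)
    (Finset.mem_insert_self _ _) ?_ ?_
  · intro S hSF hS0 hne
    let f : Option W → Option (Σ k, Fin (H k).numTerms) := Option.map Subtype.val
    have hsupp : ∀ o : Option W, vertexSupp H i (f o) =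
        o.elim {i} fun a => (H a.1.1).supp a.1.2 := by rintro (_ | a) <;> rfl
    obtain ⟨o, hoF, hoS⟩ : ∃ o ∈ clusterVertices W, o ∉ S := by
      by_contra! hc
      exact hne (hSF.antisymm hc)
    have hfo : ∃ o', f o' = o := by
      rcases Finset.mem_insert.1 hoF with rfl | ho
      · exact ⟨none, rfl⟩
      · obtain ⟨a, ha, rfl⟩ := Finset.mem_image.1 ho
        exact ⟨some ⟨a, ha⟩, rfl⟩
    obtain ⟨o', rfl⟩ := hfo
    obtain ⟨walk⟩ := hW.preconnected none o'
    -- A path from the root to a missing vertex leaves `S` along some edge, whose endpoint extends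
    -- `S`.
    obtain ⟨d, -, hd1, hd2⟩ := walk.exists_boundary_dart {o | f o ∈ S} hS0 hoS
    refine ⟨f d.fst, hd1, f d.snd, ?_, hd2, ?_⟩
    · rcases d.snd with _ | a
      · exact Finset.mem_insert_self _ _
      · exact Finset.mem_insert_of_mem (Finset.mem_image_of_mem _ a.2)
    · refine Finset.mem_insert_of_mem (Finset.mem_filter.2 ⟨Finset.mem_univ _, ?_⟩)
      rw [hsupp, hsupp]
      exact (overlapGraph_adj.1 d.adj).2
  · exact (Finset.card_insert_le _ _).trans (Nat.succ_le_succ (Finset.card_image_le.trans hj))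

lemma clusterRegion_eq_biUnion (W : Finset (Σ k, Fin (H k).numTerms)) :
    clusterRegion H i W = (clusterVertices W).biUnion (vertexSupp H i) := by
  rw [clusterVertices, Finset.biUnion_insert, Finset.image_biUnion]
  rfl

lemma card_filter_pauliSupport_subset_le (X : Finset (Fin n)) :
    (Finset.univ.filter fun P : Fin n → Fin 4 => pauliSupport P ⊆ X).card ≤ 4 ^ X.card := by
  have : (Finset.univ.filter fun P : Fin n → Fin 4 => pauliSupport P ⊆ X) ⊆
      Fintype.piFinset fun q => if q ∈ X then Finset.univ else {0} := by
    intro P hP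
    rw [Fintype.mem_piFinset]
    intro q
    split_ifs with hq
    · simp
    · rw [Finset.mem_singleton]
      exact notMem_pauliSupport.1 fun h => hq ((Finset.mem_filter.1 hP).2 h)
  refine (Finset.card_le_card this).trans (le_of_eq ?_)
  rw [Fintype.card_piFinset]
  simp only [apply_ite Finset.card, Finset.card_univ, Fintype.card_fin, Finset.card_singleton]
  rw [Finset.prod_ite]
  simp

variable (H i)

/-- The number of linked Pauli strings grows exponentially with the order. -/
lemma card_linkedPaulis_le (m : ℕ) : (linkedPaulis H i m).card ≤
    (K * ((Λ + 1) * (𝔡 + 1)) + 2) ^ (2 * (K * m)) * 4 ^ (1 + Λ * (K * m)) := by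
  have hsub : linkedPaulis H i m ⊆ ((visits (overlapNbr H i) (2 * (K * m)) none).filter
      fun S => (S.biUnion (vertexSupp H i)).card ≤ 1 + Λ * (K * m)).biUnion fun S =>
      Finset.univ.filter fun P => pauliSupport P ⊆ S.biUnion (vertexSupp H i) := by
    intro P hP
    simp only [linkedPaulis, Finset.mem_filter] at hP
    obtain ⟨-, W, hWm, hW, hPW⟩ := hP
    have hcard : W.card ≤ K * m := by
      rw [Finset.card_eq_sum_card_fiberwise (f := Sigma.fst) (t := Finset.univ)
        fun a _ => Finset.mem_coe.2 (Finset.mem_univ _)]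
      refine (Finset.sum_le_card_nsmul _ _ m fun k _ => ?_).trans (by simp)
      convert hWm k
    refine Finset.mem_biUnion.2 ⟨clusterVertices W, Finset.mem_filter.2
      ⟨hW.mem_visits hcard, ?_⟩, Finset.mem_filter.2 ⟨Finset.mem_univ _, ?_⟩⟩
    · rw [← clusterRegion_eq_biUnion]
      exact (card_clusterRegion_le H i W).trans (by gcongr)
    · rwa [← clusterRegion_eq_biUnion]
  refine (Finset.card_le_card hsub).trans ?_
  refine (Finset.card_biUnion_le_card_mul _ _ (4 ^ (1 + Λ * (K * m))) fun S hS =>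
    (card_filter_pauliSupport_subset_le _).trans
      (Nat.pow_le_pow_right (by norm_num) (Finset.mem_filter.1 hS).2)).trans ?_
  gcongr
  exact (Finset.card_filter_le _ _).trans (card_visits_le (card_overlapNbr_le H i) _ _)

end Counting

/-! ### Constants -/

section Constants

lemma thresholdTime_pos {K 𝔡 : ℕ} (hK : 1 ≤ K) (h𝔡 : 1 ≤ 𝔡) : 0 < thresholdTime K 𝔡 := by
  have : (0 : ℝ) < K := by exact_mod_cast hK
  have : (0 : ℝ) < 𝔡 := by exact_mod_cast h𝔡
  unfold thresholdTime
  positivity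

/-- Above the threshold both exponential factors in the definition are at least 1. -/
lemma log_le_truncationOrder {K 𝔡 : ℕ} {t X : ℝ} (ht : 0 ≤ t)
    (h : thresholdTime K 𝔡 ≤ t) {y : ℝ} (hy : 0 < y) (hy1 : y ≤ 1) (hX : X = 1 / y) :
    Real.log X ≤ truncationOrder K 𝔡 t y := by
  subst hX
  rw [truncationOrder, if_neg (not_lt.2 h)]
  set e := Real.exp (Real.pi * t * Real.exp 1 * K * 𝔡)
  have he : 1 ≤ e := Real.one_le_exp (by positivity)
  have h1 : 1 ≤ 1 / y := by rw [le_div_iff₀ hy]; linarith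
  have h2 : Real.log (1 / y) ≤ Real.log (e / y) := Real.log_le_log (by positivity) (by gcongr)
  have h3 : 0 ≤ Real.log (1 / y) := Real.log_nonneg h1
  nlinarith

lemma truncationOrder_mul_log {K 𝔡 : ℕ} {t y : ℝ} (ht : 0 < t) (h : t < thresholdTime K 𝔡) :
    truncationOrder K 𝔡 t y * Real.log (thresholdTime K 𝔡 / t) = Real.log (1 / y) := by
  rw [truncationOrder, if_pos h, div_mul_cancel₀]
  exact (Real.log_pos (by rw [lt_div_iff₀ ht]; linarith)).ne'

lemma truncationOrder_nonneg {K 𝔡 : ℕ} {t y : ℝ} (ht : 0 ≤ t) (hy : 0 < y) (hy1 : y ≤ 1) :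
    0 ≤ truncationOrder K 𝔡 t y := by
  have h1 : 1 ≤ 1 / y := by rw [le_div_iff₀ hy]; linarith
  by_cases h : t < thresholdTime K 𝔡
  · rw [truncationOrder, if_pos h]
    refine div_nonneg (Real.log_nonneg h1) ?_
    rcases ht.eq_or_lt with rfl | ht
    · simp
    · exact Real.log_nonneg (by rw [le_div_iff₀ ht]; linarith)
  · exact (Real.log_nonneg h1).trans (log_le_truncationOrder ht (not_lt.1 h) hy hy1 rfl)

/-- The truncation order suffices for the accuracy of the approximation by clusters. -/
lemma truncation_error_le {K 𝔡 : ℕ} {t y θ : ℝ} (ht : 0 ≤ t)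
    (hK : 0 < thresholdTime K 𝔡) (hy : 0 < y) (hy2 : y ≤ 1 / 2) (hθ : 0 ≤ θ)
    (hθ1 : θ ≤ t / thresholdTime K 𝔡) (hθ2 : θ ≤ 1 / 2) {J ℓ : ℕ}
    (hℓ : 2 * (J + 1) * truncationOrder K 𝔡 t y ≤ ℓ + 1) :
    2 ^ J * θ ^ (ℓ + 1) ≤ y := by
  -- This covers `t = 0`, where the truncation order is 0 and `ℓ` may vanish: the exponent `ℓ + 1`
  -- still makes the error zero.
  rcases hθ.eq_or_lt with rfl | hθ0
  · simpa using hy.le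
  have ht0 : 0 < t := by
    by_contra hc
    have : t = 0 := le_antisymm (not_lt.1 hc) ht
    rw [this, zero_div] at hθ1
    linarith
  set M := truncationOrder K 𝔡 t y with hM
  have hM0 : 0 ≤ M := truncationOrder_nonneg ht hy (by linarith)
  -- Below the threshold `s = t / t*` gives `log (1 / y) = -log s * M`. Above it, `s = 1 / 2` works
  -- because `2 * log 2 ≥ 1`, which is the reason for the factor 2.
  obtain ⟨s, hs0, hs1, hθs, hs⟩ : ∃ s : ℝ, 0 < s ∧ s ≤ 1 ∧ θ ≤ s ∧
      Real.log (1 / y) ≤ -Real.log s * (2 * M) := by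
    by_cases h : t < thresholdTime K 𝔡
    · refine ⟨t / thresholdTime K 𝔡, by positivity, by rw [div_le_one hK]; exact h.le, hθ1, ?_⟩
      have h1 := truncationOrder_mul_log (y := y) ht0 h
      have h2 : Real.log (thresholdTime K 𝔡 / t) = -Real.log (t / thresholdTime K 𝔡) := by
        rw [← Real.log_inv, inv_div]
      rw [← hM, h2] at h1
      have h3 : 0 ≤ Real.log (1 / y) := Real.log_nonneg (by rw [le_div_iff₀ hy]; linarith)
      nlinarith
    · refine ⟨1 / 2, by norm_num, by norm_num, hθ2, ?_⟩
      have h1 := log_le_truncationOrder ht (not_lt.1 h) hy (by linarith) rfl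
      rw [one_div (2 : ℝ), Real.log_inv, neg_neg]
      have h2 := Real.log_two_gt_d9
      rw [← hM] at h1
      nlinarith
  have hlog : Real.log s ≤ 0 := Real.log_nonpos hs0.le hs1
  -- The `J` extra powers of `y ≤ 1 / 2` pay for the prefactor `2 ^ J`.
  have h1 : s ^ (ℓ + 1) ≤ y ^ (J + 1) := by
    rw [← Real.log_le_log_iff (by positivity) (by positivity), Real.log_pow, Real.log_pow]
    push_cast
    have h2 : Real.log (1 / y) = -Real.log y := by rw [one_div, Real.log_inv]
    have h3 : (ℓ + 1 : ℝ) * Real.log s ≤ 2 * (J + 1) * M * Real.log s :=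
      mul_le_mul_of_nonpos_right hℓ hlog
    have h4 : (J + 1 : ℝ) * Real.log (1 / y) ≤ (J + 1) * (-Real.log s * (2 * M)) := by gcongr
    rw [h2] at h4
    linarith
  calc 2 ^ J * θ ^ (ℓ + 1) ≤ 2 ^ J * s ^ (ℓ + 1) := by gcongr
    _ ≤ 2 ^ J * y ^ (J + 1) := by gcongr
    _ = (2 * y) ^ J * y := by rw [mul_pow, pow_succ]; ring
    _ ≤ 1 ^ J * y := by gcongr; linarith
    _ = y := by simp

/-- The base of the power is at least `exp 1`, `ε ^ (1 / p)` is at most 1, and `log n` is at least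
`log 2`. So any circuit size `exp e` fits under the rate up to a constant. -/
lemma le_depthRate {D K Λ 𝔡 p n : ℕ} (h𝔡 : 1 ≤ 𝔡) (hn : 2 ≤ n) {ε : ℝ} (hε : 0 < ε) (hε1 : ε < 1)
    {e : ℝ} (he : 0 ≤ e) :
    Real.log 2 ^ D * Real.exp e ≤ depthRate D K Λ 𝔡 p n ε e := by
  have h2 : 0 < Real.log 2 := Real.log_pos (by norm_num)
  have hn' : (2 : ℝ) ≤ n := by exact_mod_cast hn
  have h1 : Real.log 2 ≤ Real.log n := Real.log_le_log (by norm_num) hn'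
  have h𝔡' : (1 : ℝ) ≤ 𝔡 := by exact_mod_cast h𝔡
  have hB : Real.exp 1 ≤ (4 : ℝ) ^ (K * Λ) * Real.exp 1 * 𝔡 := by
    have : (1 : ℝ) ≤ 4 ^ (K * Λ) := one_le_pow₀ (by norm_num)
    calc Real.exp 1 = 1 * Real.exp 1 * 1 := by ring
      _ ≤ _ := by gcongr
  have h3 : Real.exp e ≤ ((4 : ℝ) ^ (K * Λ) * Real.exp 1 * 𝔡) ^ e := by
    rw [← Real.exp_one_rpow e]
    exact Real.rpow_le_rpow (Real.exp_pos 1).le hB he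
  have h4 : ε ^ (1 / (p : ℝ)) ≤ 1 := Real.rpow_le_one hε.le hε1.le (by positivity)
  have h5 : 0 < ε ^ (1 / (p : ℝ)) := Real.rpow_pos_of_pos hε _
  rw [depthRate, le_div_iff₀ h5]
  calc _ ≤ Real.log 2 ^ D * Real.exp e * 1 := by gcongr
    _ = Real.log 2 ^ D * Real.exp e := mul_one _
    _ ≤ _ := by gcongr

/-- Bounds on the size of the circuit for an adequate number of repetitions. -/
lemma exists_repetitions {n N L : ℕ} (hL : 1 ≤ L) {κ ε : ℝ} (hn : 2 ≤ n)
    (hε : 0 < ε) (hε1 : ε < 1) : ∃ r : ℕ, 1 ≤ r ∧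
      n * (3 * (ε / n) + 8 * κ ^ 2 * (1 / 2 + 3 * L) ^ 2 / r) ≤ 4 * ε ∧
      ((n + n * (r * (N * (1 + 3 * L) * (2 * (n + n) + 1))) : ℕ) : ℝ) ≤
        (1 + 20 * N * (128 * κ ^ 2 + 2)) * L ^ 3 * (n / ε) ^ 3 := by
  have hn' : (2 : ℝ) ≤ n := by exact_mod_cast hn
  have hL' : (1 : ℝ) ≤ L := by exact_mod_cast hL
  set X : ℝ := n / ε with hX
  have hnX : (n : ℝ) ≤ X := by
    rw [hX, le_div_iff₀ hε]
    nlinarith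
  have hX1 : 1 ≤ X := by linarith
  set a : ℝ := 8 * κ ^ 2 * (1 / 2 + 3 * L) ^ 2 with ha
  have ha0 : 0 ≤ a := by positivity
  have ha' : a ≤ 128 * κ ^ 2 * L ^ 2 := by
    have : (1 / 2 + 3 * L : ℝ) ≤ 4 * L := by linarith
    calc a ≤ 8 * κ ^ 2 * (4 * L) ^ 2 := by rw [ha]; gcongr
      _ = _ := by ring
  -- About `a n / ε` repetitions bring the total product formula error below `ε`; the added 1 keeps
  -- `r` positive when `a = 0`.
  set r : ℕ := ⌈a * X⌉₊ + 1 with hr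
  have hr1 : a * X ≤ r := by
    rw [hr]; push_cast
    linarith [Nat.le_ceil (a * X)]
  have hr2 : (r : ℝ) ≤ (128 * κ ^ 2 + 2) * L ^ 2 * X := by
    have h1 := (Nat.ceil_lt_add_one (show 0 ≤ a * X by positivity)).le
    have h2 : (r : ℝ) ≤ a * X + 2 := by rw [hr]; push_cast; linarith
    have h3 : a * X ≤ 128 * κ ^ 2 * L ^ 2 * X := by gcongr
    have h4 : (1 : ℝ) ≤ L ^ 2 * X := one_le_mul_of_one_le_of_one_le (one_le_pow₀ hL') hX1
    nlinarith
  have hr0 : (0 : ℝ) < r := by rw [hr]; push_cast; positivity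
  refine ⟨r, by omega, ?_, ?_⟩
  · have h1 : a * n / r ≤ ε := by
      rw [div_le_iff₀ hr0]
      calc a * n = ε * (a * X) := by rw [hX]; field_simp
        _ ≤ ε * r := by gcongr
    have h2 : (n : ℝ) * (3 * (ε / n) + a / r) = 3 * ε + a * n / r := by
      field_simp
    rw [h2]
    linarith
  · push_cast
    have h1 : (1 + 3 * L : ℝ) ≤ 4 * L := by linarith
    have h2 : (2 * (n + n) + 1 : ℝ) ≤ 5 * X := by linarith
    have h3 : (n : ℝ) ≤ L ^ 3 * X ^ 3 := by
      have h4 : (1 : ℝ) ≤ L ^ 3 := one_le_pow₀ hL'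
      have h5 : X ≤ X ^ 3 := le_self_pow₀ hX1 (by norm_num)
      nlinarith
    have h4 : (n : ℝ) * (r * (N * (1 + 3 * L) * (2 * (n + n) + 1))) ≤
        X * (((128 * κ ^ 2 + 2) * L ^ 2 * X) * (N * (4 * L) * (5 * X))) := by gcongr
    calc _ ≤ (L : ℝ) ^ 3 * X ^ 3 +
          X * (((128 * κ ^ 2 + 2) * L ^ 2 * X) * (N * (4 * L) * (5 * X))) := add_le_add h3 h4
      _ = _ := by ring

/-- The growth rate of the number of linked Pauli strings. -/
def growthRate (K Λ 𝔡 : ℕ) : ℕ :=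
  (K * ((Λ + 1) * (𝔡 + 1)) + 2) ^ (2 * K) * 4 ^ (Λ * K)

lemma one_le_growthRate (K Λ 𝔡 : ℕ) : 1 ≤ growthRate K Λ 𝔡 :=
  Nat.one_le_iff_ne_zero.2 (by unfold growthRate; positivity)

/-- Rounding the order up costs a single extra factor of the growth rate. -/
lemma growthRate_pow_le {K Λ 𝔡 m : ℕ} {c₁ M : ℝ} (h : 0 ≤ c₁ * M) (hm : m = ⌈c₁ * M⌉₊) :
    (growthRate K Λ 𝔡 : ℝ) ^ m ≤
      growthRate K Λ 𝔡 * Real.exp (c₁ * Real.log (growthRate K Λ 𝔡) * M) := by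
  have hE : (1 : ℝ) ≤ growthRate K Λ 𝔡 := by exact_mod_cast one_le_growthRate K Λ 𝔡
  set E : ℝ := (growthRate K Λ 𝔡 : ℝ)
  have h1 : (m : ℝ) ≤ c₁ * M + 1 := by rw [hm]; exact (Nat.ceil_lt_add_one h).le
  calc E ^ m = E ^ (m : ℝ) := (Real.rpow_natCast E m).symm
    _ ≤ E ^ (c₁ * M + 1) := Real.rpow_le_rpow_of_exponent_le hE h1
    _ = E * Real.exp (c₁ * Real.log E * M) := by
      rw [Real.rpow_add_one (by positivity), Real.rpow_def_of_pos (by positivity), mul_comm]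
      ring_nf

lemma size_le_exp {K Λ 𝔡 m : ℕ} {c₁ M X c d : ℝ} (hX : 0 < X) (hc : 0 ≤ c) (h : 0 ≤ c₁ * M)
    (hm : m = ⌈c₁ * M⌉₊) (hd : d ≤ c * ((4 * growthRate K Λ 𝔡 ^ m : ℕ) : ℝ) ^ 3 * X ^ 3) :
    d ≤ c * (4 * growthRate K Λ 𝔡) ^ 3 *
      Real.exp (3 * (c₁ * Real.log (growthRate K Λ 𝔡)) * M + 3 * Real.log X) := by
  have h1 := growthRate_pow_le (K := K) (Λ := Λ) (𝔡 := 𝔡) h hm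
  push_cast at hd
  set E : ℝ := (growthRate K Λ 𝔡 : ℝ)
  set e := Real.exp (c₁ * Real.log E * M) with he
  have h2 : Real.exp (3 * (c₁ * Real.log E) * M + 3 * Real.log X) = e ^ 3 * X ^ 3 := by
    rw [Real.exp_add, he, ← Real.exp_nat_mul]
    congr 1
    · push_cast; ring_nf
    · rw [← Real.rpow_natCast, Real.rpow_def_of_pos hX]
      push_cast; ring_nf
  have hE : 0 ≤ E := Nat.cast_nonneg _
  rw [h2]
  calc d ≤ _ := hd
    _ ≤ c * (4 * (E * e)) ^ 3 * X ^ 3 := by gcongr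
    _ = _ := by ring

end Constants

/-! ### Accuracy and size of the circuits, and the choice of the constants -/

section Main

variable {n D K : ℕ} {pos : Fin n → Fin D → ℤ} {R Λ 𝔡 : ℕ}

lemma card_linkedPaulis_le_growthRate_pow (H : Fin K → LocalHamiltonian pos R Λ 𝔡) (i : Fin n)
    (m : ℕ) : (linkedPaulis H i m).card ≤ 4 * growthRate K Λ 𝔡 ^ m := by
  refine (card_linkedPaulis_le H i m).trans (le_of_eq ?_)
  rw [growthRate, mul_pow, ← pow_mul, ← pow_mul, pow_add]
  ring_nf

/-- A circuit for the trotterized operator with accuracy and size bounds. -/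
lemma exists_trotterized_circuit {p Np : ℕ} {κ : ℝ}
    (hTS : ∀ (ι : Type) [Fintype ι] [DecidableEq ι] (A : List (QOp ι)) (τ : ℂ),
      HasFactors 1 κ Np A τ (trotterSuzuki p A τ))
    {H : Fin K → LocalHamiltonian pos R Λ 𝔡} {t : Fin K → ℝ} {ε c₁ M : ℝ} {m : ℕ}
    {α : PauliModel n} (hn : 2 ≤ n) (hε : 0 < ε) (hε1 : ε < 1) (hc : 0 ≤ c₁ * M)
    (hm : m = ⌈c₁ * M⌉₊) (hα : IsLearnedModel H t m (ε / n) α) :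
    ∃ (r : ℕ) (circ : QCircuit (Fin n ⊕ Fin n)), 1 ≤ r ∧ circ.toOp = trotterizedOp H m α p r ∧
      diamondDist (reducedChannel circ.toOp) (conjChannel (evolution H t)) ≤
        ENNReal.ofReal (8 * ε) ∧
      (circ.depth : ℝ) ≤ (1 + 20 * Np * (128 * κ ^ 2 + 2)) * (4 * growthRate K Λ 𝔡) ^ 3 *
        Real.exp (3 * (c₁ * Real.log (growthRate K Λ 𝔡)) * M + 3 * Real.log (n / ε)) := by
  have hn' : (2 : ℝ) ≤ n := by exact_mod_cast hn
  have hn0 : (0 : ℝ) < n := by linarith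
  have hL1 : 1 ≤ 4 * growthRate K Λ 𝔡 ^ m := by
    have := Nat.one_le_pow m _ (one_le_growthRate K Λ 𝔡)
    omega
  obtain ⟨r, hr, hacc, hdepth⟩ := exists_repetitions (N := Np) (κ := κ) hL1 hn hε hε1
  obtain ⟨hWu, hW, hgate⟩ := trotterizedOp_spec hTS ((div_le_one hn0).2 (by linarith)) hα
    (card_linkedPaulis_le_growthRate_pow H · m) hr
  obtain ⟨circ, hcirc, hcd⟩ := hgate.exists_circuit
  refine ⟨r, circ, hr, hcirc, ?_, ?_⟩
  · rw [hcirc]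
    refine (diamondDist_reducedChannel_conjChannel_le (evolution_mem_unitary t) hWu
      (hW.trans hacc)).trans (ENNReal.ofReal_le_ofReal ?_)
    linarith
  · exact size_le_exp (by positivity) (by positivity) hc hm ((Nat.cast_le.2 hcd).trans hdepth)

end Main

theorem mainTheorem6 (D R K Λ 𝔡 p : ℕ) (hK : 1 ≤ K) (h𝔡 : 1 ≤ 𝔡) (hp : 1 ≤ p) (T : ℝ) :
    ∃ c₁ c₂ C : ℝ, 0 < c₁ ∧ 0 < c₂ ∧ 0 < C ∧
    ∀ τ : ℝ, 0 < τ → ∃ c₃ : ℝ, 0 < c₃ ∧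
    ∀ n : ℕ, 2 ≤ n →
    ∀ pos : Fin n → Fin D → ℤ, Function.Injective pos →
    ∀ (H : Fin K → LocalHamiltonian pos R Λ 𝔡) (t : Fin K → ℝ) (tmax : ℝ),
    IsGreatest (Set.range fun k => |t k|) tmax → tmax ≤ T →
    ∀ ε : ℝ, 0 < ε → ε < 1 →
    ∀ (M : ℝ) (m : ℕ), M = truncationOrder K 𝔡 tmax (ε / n) → m = ⌈c₁ * M⌉₊ →
      (∃ α : PauliModel n, IsLearnedModel H t m (ε / n) α) ∧
      ∀ α : PauliModel n, IsLearnedModel H t m (ε / n) α →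
        compiledOp H m α ∈ Matrix.unitaryGroup (Fin n ⊕ Fin n → Fin 2) ℂ ∧
        diamondDist (reducedChannel (compiledOp H m α)) (conjChannel (evolution H t))
          ≤ ENNReal.ofReal (C * ε) ∧
        ∃ (r : ℕ) (circ : QCircuit (Fin n ⊕ Fin n)), 1 ≤ r ∧
          circ.toOp = trotterizedOp H m α p r ∧
          diamondDist (reducedChannel circ.toOp) (conjChannel (evolution H t))
            ≤ ENNReal.ofReal (C * ε) ∧
          (circ.depth : ℝ) ≤ C * depthRate D K Λ 𝔡 p n ε (c₂ * max M (Real.log (n / ε))) ∧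
          (τ ≤ tmax → (circ.depth : ℝ) ≤ C * depthRate D K Λ 𝔡 p n ε (c₃ * M)) := by
  obtain ⟨κ, Np, hTS⟩ := exists_hasFactors_trotterSuzuki p
  have hts := thresholdTime_pos hK h𝔡
  set ts := thresholdTime K 𝔡 with hts_def
  set g : ℝ := 4 * (𝔡 + 1) * (1 + Λ) with hg
  have hg0 : 0 < g := by positivity
  -- The first summand gives `4 * x ≤ tmax / ts`, the rate needed for short times; the second gives
  -- `4 * x ≤ 1 / 2` for all times up to `T`.
  set N : ℕ := ⌈4 * g * ts + 8 * g * |T|⌉₊ + 1 with hN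
  set J : ℕ := K * N with hJ
  -- `4 ^ J` is the growth of cluster sizes over `J` steps; `2 * (J + 1)` is what the truncation
  -- error requires.
  set c₁ : ℝ := 4 ^ J * (2 * (J + 1)) with hc₁
  have hc₁0 : 0 < c₁ := by positivity
  have hE1 : (1 : ℝ) ≤ growthRate K Λ 𝔡 := by exact_mod_cast one_le_growthRate K Λ 𝔡
  set E : ℝ := (growthRate K Λ 𝔡 : ℝ) with hE
  have hlogE : 0 ≤ Real.log E := Real.log_nonneg hE1
  have hl2 : 0 < Real.log 2 := Real.log_pos (by norm_num)
  set C₀ : ℝ := (1 + 20 * Np * (128 * κ ^ 2 + 2)) * (4 * E) ^ 3 with hC₀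
  have hC₀0 : 0 < C₀ := by positivity
  refine ⟨c₁, 3 * (c₁ * Real.log E) + 3, 8 + C₀ / Real.log 2 ^ D, hc₁0, by positivity,
    by positivity, fun τ hτ => ?_⟩
  -- Chosen so that `log (n / ε) ≤ q * M` whenever `tmax ≥ τ`.
  set q : ℝ := 1 + |Real.log (ts / τ)| with hq
  refine ⟨3 * (c₁ * Real.log E) + 3 * q, by positivity, ?_⟩
  intro n hn pos _ H t tmax htmax htT ε hε hε1 M m hM hm
  have hn' : (2 : ℝ) ≤ n := by exact_mod_cast hn
  have hn0 : (0 : ℝ) < n := by linarith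
  have ht0 : 0 ≤ tmax := by
    obtain ⟨k, hk⟩ := htmax.1
    exact hk ▸ abs_nonneg _
  have htk : ∀ k, |t k| ≤ tmax := fun k => htmax.2 ⟨k, rfl⟩
  set y : ℝ := ε / n with hy
  have hy0 : 0 < y := by positivity
  have hy2 : y ≤ 1 / 2 := by rw [hy, div_le_iff₀ hn0]; linarith
  have hyX : (n : ℝ) / ε = 1 / y := by rw [hy, one_div_div]
  have hM0 : 0 ≤ M := hM ▸ truncationOrder_nonneg ht0 hy0 (by linarith)
  have hlogX : 0 ≤ Real.log (n / ε) :=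
    Real.log_nonneg (by rw [le_div_iff₀ hε]; linarith)
  have hN0 : (0 : ℝ) < N := by rw [hN]; push_cast; positivity
  have hNle : 4 * g * ts + 8 * g * |T| ≤ N := by
    rw [hN]; push_cast
    linarith [Nat.le_ceil (4 * g * ts + 8 * g * |T|)]
  constructor
  · set x : ℝ := 4 * (tmax / N) * (𝔡 + 1) * (1 + Λ) with hx
    have hx0 : 0 ≤ x := by positivity
    have hxg : 4 * x = 4 * g * tmax / N := by rw [hx, hg]; ring
    have hx1 : 4 * x ≤ tmax / ts := by
      rw [hxg, div_le_div_iff₀ hN0 hts]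
      have : 4 * g * ts ≤ N := by linarith [show 0 ≤ 8 * g * |T| by positivity]
      nlinarith
    have hx2 : 4 * x ≤ 1 / 2 := by
      rw [hxg, div_le_iff₀ hN0]
      have h1 : tmax ≤ |T| := htT.trans (le_abs_self T)
      have h2 : 8 * g * tmax ≤ 8 * g * |T| := by gcongr
      have h3 : 0 < 4 * g * ts := by positivity
      linarith
    -- Rounding down keeps the clusters within `m` terms; the exponent `ℓ + 1` of the error makes up
    -- for the loss.
    set ℓ : ℕ := m / 4 ^ J with hℓ
    obtain ⟨α, hα⟩ := exists_isLearnedModel (H := H) t (N := N) (δ := tmax / N) (x := x) (ℓ := ℓ)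
      (m := m) (by omega) (fun k => by gcongr; exact htk k) hx hx0 (by linarith)
      (Nat.mul_div_le m (4 ^ J))
    refine ⟨α, fun i a ha => (hα i a ha).trans ?_⟩
    refine truncation_error_le ht0 hts hy0 hy2 (by positivity) hx1 hx2 ?_
    rw [← hM]
    have h1 : m < 4 ^ J * (ℓ + 1) := by
      rw [hℓ]
      exact Nat.lt_mul_div_succ m (by positivity)
    have h2 : (m : ℝ) ≤ 4 ^ J * (ℓ + 1) := by exact_mod_cast h1.le
    have h3 : c₁ * M ≤ m := hm ▸ Nat.le_ceil _
    have h4 : (4 : ℝ) ^ J * (2 * (J + 1) * M) ≤ 4 ^ J * (ℓ + 1) := by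
      calc (4 : ℝ) ^ J * (2 * (J + 1) * M) = c₁ * M := by rw [hc₁]; ring
        _ ≤ _ := h3.trans h2
    exact le_of_mul_le_mul_left h4 (by positivity)
  · intro α hα
    have hC8 : 8 * ε ≤ (8 + C₀ / Real.log 2 ^ D) * ε := by
      gcongr
      linarith [show 0 < C₀ / Real.log 2 ^ D by positivity]
    refine ⟨compiledOp_mem_unitary m α, ?_, ?_⟩
    · have h1 := norm_swapOp_mul_prod_sub_le hα _ (exp_sewnExponent_mem_unitary (H := H) m α)
        (η := 0) (fun i => by simp)
      have h2 : (n : ℝ) * (3 * y + 0) = 3 * ε := by rw [hy]; field_simp; ring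
      rw [← compiledOp_eq, h2] at h1
      refine (diamondDist_reducedChannel_conjChannel_le (evolution_mem_unitary t)
        (compiledOp_mem_unitary m α) h1).trans (ENNReal.ofReal_le_ofReal ?_)
      linarith
    · obtain ⟨r, circ, hr, hcirc, hdist, hcd⟩ :=
        exists_trotterized_circuit hTS hn hε hε1 (mul_nonneg hc₁0.le hM0) hm hα
      have hrate : ∀ e : ℝ, 3 * (c₁ * Real.log E) * M + 3 * Real.log (n / ε) ≤ e →
          (circ.depth : ℝ) ≤ (8 + C₀ / Real.log 2 ^ D) * depthRate D K Λ 𝔡 p n ε e := by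
        intro e he
        have he0 : 0 ≤ e := le_trans (by positivity) he
        have h1 := le_depthRate (D := D) (K := K) (Λ := Λ) (p := p) h𝔡 hn hε hε1 he0
        have h2 : C₀ * Real.exp e ≤ C₀ / Real.log 2 ^ D * depthRate D K Λ 𝔡 p n ε e := by
          calc C₀ * Real.exp e = C₀ / Real.log 2 ^ D * (Real.log 2 ^ D * Real.exp e) := by
                rw [← mul_assoc, div_mul_cancel₀ _ (pow_pos hl2 D).ne']
            _ ≤ _ := by gcongr
        have h3 : 0 ≤ depthRate D K Λ 𝔡 p n ε e := le_trans (by positivity) h1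
        have h4 : C₀ * Real.exp (3 * (c₁ * Real.log E) * M + 3 * Real.log (n / ε)) ≤
            C₀ * Real.exp e := by gcongr
        linarith
      refine ⟨r, circ, hr, hcirc, ?_, hrate _ ?_, fun hτt => hrate _ ?_⟩
      · exact hdist.trans (ENNReal.ofReal_le_ofReal hC8)
      · have h1 : 3 * (c₁ * Real.log E) * M ≤
            3 * (c₁ * Real.log E) * max M (Real.log (n / ε)) := by
          gcongr; exact le_max_left _ _
        linarith [le_max_right M (Real.log (n / ε))]
      -- Below the threshold `log (n / ε)` is exactly `M * log (ts / tmax)`, and `tmax ≥ τ` bounds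
      -- the logarithm. Above the threshold it is at most `M`.
      · have h1 : Real.log (n / ε) ≤ q * M := by
          rw [hyX]
          by_cases h : tmax < ts
          · have h2 := truncationOrder_mul_log (y := y) (hτ.trans_le hτt) h
            rw [← hM, ← hts_def] at h2
            have h3 : Real.log (ts / tmax) ≤ q := by
              have h4 : Real.log (ts / tmax) ≤ Real.log (ts / τ) :=
                Real.log_le_log (div_pos hts (hτ.trans_le hτt)) (by gcongr)
              linarith [le_abs_self (Real.log (ts / τ))]
            rw [← h2, mul_comm]
            gcongr
          · have h2 := log_le_truncationOrder ht0 (not_lt.1 h) hy0 (by linarith) rfl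
            rw [← hM] at h2
            have h3 : 1 * M ≤ q * M := by
              gcongr
              linarith [abs_nonneg (Real.log (ts / τ))]
            linarith
        linarith
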